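/- Let $(\Sigma_1,g_1)$ and $(\Sigma_2,g_2)$ be Lorentzian surfaces, i.e. connected oriented smooth $2$-manifolds with smooth metrics of indefinite signature, and let $\kappa_1,\kappa_2$ be their Gauss curvatures. For $k=1,2$ let $j_k$ be the endomorphism field of $T\Sigma_k$ with $j_ke_1=e_2$, $j_ke_2=e_1$ for every positively oriented frame $(e_1,e_2)$ with $g_k(e_1,e_1)=1$, $g_k(e_2,e_2)=-1$, $g_k(e_1,e_2)=0$, and let $\omega_k=g_k(j_k\cdot,\cdot)$. Let $\epsilon\in\{-1,1\}$ and define on $\Sigma_1\times\Sigma_2$, with projections $\pi_k$ onto $\Sigma_k$, $$G^\epsilon=\pi_1^*g_1+\epsilon\,\pi_2^*g_2,\qquad J=j_1\oplus j_2,\qquad \Omega^\epsilon=\pi_1^*\omega_1+\epsilon\,\pi_2^*\omega_2 .$$ Then: 1. $(\Sigma_1\times\Sigma_2,G^\epsilon,J,\Omega^\epsilon)$ is a para-Kähler structure: $G^\epsilon$ is a smooth pseudo-Riemannian metric; $J$ is smooth, $J^2=\mathrm{Id}$, and the Nijenhuis tensor $N^J(X,Y)=[X,Y]+[JX,JY]-J[JX,Y]-J[X,JY]$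 vanishes; $G^\epsilon(J\cdot,J\cdot)=-G^\epsilon$; and $\Omega^\epsilon=G^\epsilon(J\cdot,\cdot)$ is a symplectic form. 2. $G^\epsilon$ is locally conformally flat (every point has an open neighbourhood $U$ with a smooth function $f$ on $U$ such that $e^{2f}G^\epsilon$ has vanishing curvature tensor on $U$) if and only if $\kappa_1$ and $\kappa_2$ are constant and $\kappa_1=-\epsilon\kappa_2$. 3. $G^\epsilon$ is Einstein (its Ricci tensor equals $c\,G^\epsilon$ for some real constant $c$) if and only if $\kappa_1$ and $\kappa_2$ are constant and $\kappa_1=\epsilon\kappa_2$. -/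

import Mathlib

open Set Filter Topology Manifold Bundle
open scoped ContDiff

noncomputable section

namespace PK

/-! ### Curvature of a nondegenerate bilinear form field on a vector space -/

section Local

variable {E : Type*} [NormedAddCommGroup E] [NormedSpace ℝ E]

/-- The Koszul functional `Z ↦ ½ (∂_X h(Y,Z) + ∂_Y h(X,Z) - ∂_Z h(X,Y))` at `u`, for constant
fields `X, Y, Z` and a field `h` of bilinear forms on `E`. -/
def koszul (h : E → E →L[ℝ] E →L[ℝ] ℝ) (u X Y : E) : E →L[ℝ] ℝ :=
  (1 / 2 : ℝ) • (fderiv ℝ (fun u' ↦ h u' Y) u X + fderiv ℝ (fun u' ↦ h u' X) u Y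
    - fderiv ℝ (fun u' ↦ h u' X Y) u)

/-- The Christoffel map `Γ_u(X, Y) = D_X Y` of the Levi-Civita connection of `h`, for constant
fields `X, Y`: the vector with `h(Γ_u(X,Y), Z)` equal to the Koszul functional at `Z`. -/
def christoffel (h : E → E →L[ℝ] E →L[ℝ] ℝ) (u X Y : E) : E :=
  (h u).inverse (koszul h u X Y)

/-- The curvature tensor `R(X,Y)Z = D_X D_Y Z - D_Y D_X Z - D_[X,Y] Z` of `h` at `u`. -/
def riemann (h : E → E →L[ℝ] E →L[ℝ] ℝ) (u X Y Z : E) : E :=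
  fderiv ℝ (fun u' ↦ christoffel h u' Y Z) u X - fderiv ℝ (fun u' ↦ christoffel h u' X Z) u Y
    + christoffel h u X (christoffel h u Y Z) - christoffel h u Y (christoffel h u X Z)

/-- The Ricci tensor `Ric(Y,Z) = tr (X ↦ R(X,Y)Z)`, the trace being computed in a basis of `E`. -/
def ricci [FiniteDimensional ℝ E] (h : E → E →L[ℝ] E →L[ℝ] ℝ) (u Y Z : E) : ℝ :=
  ∑ i, (Module.finBasis ℝ E).coord i (riemann h u (Module.finBasis ℝ E i) Y Z)

/-- The sectional curvature of the plane spanned by `X` and `Y`. -/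
def sectional (h : E → E →L[ℝ] E →L[ℝ] ℝ) (u X Y : E) : ℝ :=
  h u (riemann h u X Y Y) X / (h u X X * h u Y Y - h u X Y ^ 2)

end Local

/-! ### Tensor fields on a manifold -/

section Manifolds

variable {E : Type*} [NormedAddCommGroup E] [NormedSpace ℝ E]
  {H : Type*} [TopologicalSpace H] (I : ModelWithCorners ℝ E H)
  (M : Type*) [TopologicalSpace M] [ChartedSpace H M]

/-- Fields of bilinear forms on the tangent spaces of `M` (no regularity required). -/
abbrev FormField := ∀ x : M, TangentSpace I x →L[ℝ] TangentSpace I x →L[ℝ] ℝ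

/-- Fields of endomorphisms of the tangent spaces of `M` (no regularity required). -/
abbrev EndField := ∀ x : M, TangentSpace I x →L[ℝ] TangentSpace I x

variable {M}

/-- Smoothness of a field of bilinear forms, as a section of the bundle of bilinear forms. -/
def SmoothForm [IsManifold I ∞ M] (B : FormField I M) : Prop :=
  ContMDiff I (I.prod 𝓘(ℝ, E →L[ℝ] E →L[ℝ] ℝ)) ∞
    (fun x ↦ TotalSpace.mk' (E →L[ℝ] E →L[ℝ] ℝ)
      (E := fun x : M ↦ TangentSpace I x →L[ℝ] TangentSpace I x →L[ℝ] ℝ) x (B x))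

/-- Smoothness of a field of endomorphisms, as a section of the endomorphism bundle. -/
def SmoothEnd [IsManifold I ∞ M] (J : EndField I M) : Prop :=
  ContMDiff I (I.prod 𝓘(ℝ, E →L[ℝ] E)) ∞
    (fun x ↦ TotalSpace.mk' (E →L[ℝ] E)
      (E := fun x : M ↦ TangentSpace I x →L[ℝ] TangentSpace I x) x (J x))

/-- A pseudo-Riemannian metric: a smooth field of symmetric nondegenerate bilinear forms. -/
structure IsPseudoRiemannian [IsManifold I ∞ M] (g : FormField I M) : Prop where
  smooth : SmoothForm I g
  symm : ∀ (x : M) (v w : TangentSpace I x), g x v w = g x w v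
  nondeg : ∀ (x : M) (v : TangentSpace I x), (∀ w : TangentSpace I x, g x v w = 0) → v = 0

/-- The expression of `B` in the chart at `p`, i.e. the pullback of `B` by the inverse of that
chart. At the image of `p` this is `B p` itself, because Mathlib identifies the tangent space at
`p` with the model space `E` through the chart at `p`. -/
def chartForm (B : FormField I M) (p : M) (u : E) : E →L[ℝ] E →L[ℝ] ℝ :=
  let b : E →L[ℝ] E →L[ℝ] ℝ := B ((extChartAt I p).symm u)
  let A : E →L[ℝ] E := mfderivWithin 𝓘(ℝ, E) I (extChartAt I p).symm (range I) u
  b.bilinearComp A A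

/-- The curvature tensor of `g` at `p`, computed in the chart at `p`. -/
def riemannAt (g : FormField I M) (p : M) (X Y Z : TangentSpace I p) : TangentSpace I p :=
  riemann (E := E) (chartForm I g p) (extChartAt I p p) X Y Z

/-- The Ricci tensor of `g` at `p`, computed in the chart at `p`. -/
def ricciAt [FiniteDimensional ℝ E] (g : FormField I M) (p : M) (Y Z : TangentSpace I p) : ℝ :=
  ricci (E := E) (chartForm I g p) (extChartAt I p p) Y Z

/-- `Ric = c g` for a real constant `c`. -/
def IsEinstein [FiniteDimensional ℝ E] (g : FormField I M) : Prop :=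
  ∃ c : ℝ, ∀ (p : M) (Y Z : TangentSpace I p), ricciAt I g p Y Z = c * g p Y Z

/-- Every point has an open neighbourhood `U` and a smooth `f` on `U` such that `e^{2f} g` is flat
on `U`. -/
def IsLocallyConformallyFlat (g : FormField I M) : Prop :=
  ∀ p : M, ∃ (U : Set M) (f : M → ℝ), IsOpen U ∧ p ∈ U ∧ ContMDiffOn I 𝓘(ℝ, ℝ) ∞ f U ∧
    ∀ q ∈ U, ∀ X Y Z : TangentSpace I q,
      riemannAt I (fun x ↦ Real.exp (2 * f x) • g x) q X Y Z = 0

/-- `dΩ = 0`: at every point, in the chart at that point, the cyclic sum of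
`∂_X Ω(Y,Z)` over constant fields `X, Y, Z` vanishes. -/
def IsClosedForm (Ω : FormField I M) : Prop :=
  ∀ (p : M) (X Y Z : E),
    fderiv ℝ (fun u ↦ chartForm I Ω p u Y Z) (extChartAt I p p) X
      + fderiv ℝ (fun u ↦ chartForm I Ω p u Z X) (extChartAt I p p) Y
      + fderiv ℝ (fun u ↦ chartForm I Ω p u X Y) (extChartAt I p p) Z = 0

/-- A symplectic form: a smooth closed nondegenerate 2-form. -/
structure IsSymplectic [IsManifold I ∞ M] (Ω : FormField I M) : Prop where
  smooth : SmoothForm I Ω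
  alt : ∀ (x : M) (v : TangentSpace I x), Ω x v v = 0
  nondeg : ∀ (x : M) (v : TangentSpace I x), (∀ w : TangentSpace I x, Ω x v w = 0) → v = 0
  closed : IsClosedForm I Ω

/-- The Nijenhuis tensor `[X,Y] + [JX,JY] - J[JX,Y] - J[X,JY]` at `p`. -/
def nijenhuis (J : EndField I M) (X Y : ∀ x : M, TangentSpace I x) (p : M) : TangentSpace I p :=
  VectorField.mlieBracket I X Y p
    + VectorField.mlieBracket I (fun x ↦ J x (X x)) (fun x ↦ J x (Y x)) p
    - J p (VectorField.mlieBracket I (fun x ↦ J x (X x)) Y p)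
    - J p (VectorField.mlieBracket I X (fun x ↦ J x (Y x)) p)

/-- A para-Kähler structure `(G, J, Ω)`: a pseudo-Riemannian metric `G`, an integrable
paracomplex structure `J` with `G(J·,J·) = -G`, and a symplectic form `Ω = G(J·,·)`. (The
eigenspaces of `J` for `1` and `-1` have the same dimension because they are `G`-isotropic.) -/
structure IsParaKahler [IsManifold I ∞ M] (G : FormField I M) (J : EndField I M)
    (Ω : FormField I M) : Prop where
  metric : IsPseudoRiemannian I G
  smooth_J : SmoothEnd I J
  J_sq : ∀ (x : M) (v : TangentSpace I x), J x (J x v) = v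
  integrable : ∀ (X Y : ∀ x : M, TangentSpace I x) (p : M),
    ContMDiffAt I I.tangent ∞ (fun x ↦ (⟨x, X x⟩ : TangentBundle I M)) p →
    ContMDiffAt I I.tangent ∞ (fun x ↦ (⟨x, Y x⟩ : TangentBundle I M)) p →
    nijenhuis I J X Y p = 0
  compatible : ∀ (x : M) (v w : TangentSpace I x), G x (J x v) (J x w) = -G x v w
  form_eq : ∀ (x : M) (v w : TangentSpace I x), Ω x v w = G x (J x v) w
  symplectic : IsSymplectic I Ω

end Manifolds

/-! ### Oriented Lorentzian surfaces -/

section Surfaces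

/-- The model plane. -/
abbrev Plane := EuclideanSpace ℝ (Fin 2)

/-- The standard basis of the model plane. -/
def stdBasis : Module.Basis (Fin 2) ℝ Plane := (EuclideanSpace.basisFun (Fin 2) ℝ).toBasis

/-- For an orientation `o` of the plane and an indefinite symmetric form `B`, the endomorphism
that maps `e₁ ↦ e₂ ↦ e₁` for every positively oriented basis `(e₁, e₂)` with `B(e₁,e₁) = 1`,
`B(e₂,e₂) = -1`, `B(e₁,e₂) = 0`; see `paraRotation_apply` and `exists_lorentzFrame`. -/
def paraRotation (o : Orientation ℝ Plane (Fin 2)) (B : Plane →L[ℝ] Plane →L[ℝ] ℝ) :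
    Plane →L[ℝ] Plane :=
  open Classical in
  let a := B (stdBasis 0) (stdBasis 0)
  let b := B (stdBasis 0) (stdBasis 1)
  let d := B (stdBasis 1) (stdBasis 1)
  let s : ℝ := if stdBasis.orientation = o then 1 else -1
  Matrix.toEuclideanCLM (n := Fin 2) (𝕜 := ℝ)
    ((s / Real.sqrt (b ^ 2 - a * d)) • !![-b, -d; a, b])

/-- A positively oriented basis `(e₁, e₂)` with `B(e₁,e₁) = 1`, `B(e₂,e₂) = -1`,
`B(e₁,e₂) = 0`. -/
structure IsLorentzFrame (o : Orientation ℝ Plane (Fin 2)) (B : Plane →L[ℝ] Plane →L[ℝ] ℝ)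
    (e : Module.Basis (Fin 2) ℝ Plane) : Prop where
  pos : e.orientation = o
  spacelike : B (e 0) (e 0) = 1
  timelike : B (e 1) (e 1) = -1
  orthogonal : B (e 0) (e 1) = 0

theorem form_apply (B : Plane →L[ℝ] Plane →L[ℝ] ℝ) (v w : Plane) :
    B v w = v 0 * (w 0 * B (stdBasis 0) (stdBasis 0) + w 1 * B (stdBasis 0) (stdBasis 1))
      + v 1 * (w 0 * B (stdBasis 1) (stdBasis 0) + w 1 * B (stdBasis 1) (stdBasis 1)) := by
  have h (u : Plane) : u = u 0 • stdBasis 0 + u 1 • stdBasis 1 := by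
    ext i; fin_cases i <;> simp [stdBasis]
  conv_lhs => rw [h v, h w]
  simp only [map_add, map_smul, add_apply, smul_apply, smul_eq_mul]
  ring

/-- `paraRotation o B` swaps the two vectors of every positively oriented Lorentz frame. -/
theorem paraRotation_apply (o : Orientation ℝ Plane (Fin 2)) (B : Plane →L[ℝ] Plane →L[ℝ] ℝ)
    (hB : ∀ v w, B v w = B w v) (e : Module.Basis (Fin 2) ℝ Plane) (he : IsLorentzFrame o B e) :
    paraRotation o B (e 0) = e 1 ∧ paraRotation o B (e 1) = e 0 := by
  obtain ⟨hp, h1, h2, h3⟩ := he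
  have hdet : stdBasis.det e = e 0 0 * e 1 1 - e 0 1 * e 1 0 := by
    rw [Module.Basis.det_apply, Matrix.det_fin_two]
    simp [Module.Basis.toMatrix, stdBasis]; ring
  have hne : stdBasis.det e ≠ 0 := (Module.Basis.isUnit_det stdBasis e).ne_zero
  have hor := stdBasis.orientation_eq_iff_det_pos e
  rw [hp, hdet] at hor
  rw [hdet] at hne
  rw [form_apply] at h1 h2 h3
  have hab := hB (stdBasis 1) (stdBasis 0)
  unfold paraRotation
  simp only [hor]
  rw [hab] at h1 h2 h3
  generalize B (stdBasis 0) (stdBasis 0) = a at *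
  generalize B (stdBasis 0) (stdBasis 1) = b at *
  generalize B (stdBasis 1) (stdBasis 1) = d at *
  set x := e 0 0
  set y := e 0 1
  set z := e 1 0
  set w := e 1 1
  set δ := x * w - y * z with hδ
  have hδ2 : (b ^ 2 - a * d) * δ ^ 2 = 1 := by
    have : (b ^ 2 - a * d) * δ ^ 2 =
      (x * (z * a + w * b) + y * (z * b + w * d)) ^ 2
      - (x * (x * a + y * b) + y * (x * b + y * d))
        * (z * (z * a + w * b) + w * (z * b + w * d)) := by rw [hδ]; ring
    rw [this, h1, h2, h3]; ring
  have hsq : Real.sqrt (b ^ 2 - a * d) = |δ|⁻¹ := by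
    rw [show b ^ 2 - a * d = (|δ|⁻¹) ^ 2 by
      rw [inv_pow, sq_abs]; exact eq_inv_of_mul_eq_one_left hδ2]
    exact Real.sqrt_sq (by positivity)
  have hs : (if 0 < δ then (1 : ℝ) else -1) / Real.sqrt (b ^ 2 - a * d) = δ := by
    rw [hsq]
    split_ifs with h
    · rw [abs_of_pos h]; simp
    · rw [abs_of_nonpos (not_lt.1 h)]; simp
  simp only [hs]
  constructor
  · ext i
    fin_cases i
    · simp [Matrix.mulVec, dotProduct, Fin.sum_univ_two]
      change -(δ * b * x) + -(δ * d * y) = z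
      rw [hδ]; linear_combination z * h1 - x * h3
    · simp [Matrix.mulVec, dotProduct, Fin.sum_univ_two]
      change δ * a * x + δ * b * y = w
      rw [hδ]; linear_combination w * h1 - y * h3
  · ext i
    fin_cases i
    · simp [Matrix.mulVec, dotProduct, Fin.sum_univ_two]
      change -(δ * b * z) + -(δ * d * w) = x
      rw [hδ]; linear_combination z * h3 - x * h2
    · simp [Matrix.mulVec, dotProduct, Fin.sum_univ_two]
      change δ * a * z + δ * b * w = y
      rw [hδ]; linear_combination w * h3 - y * h2

/-- Positively oriented Lorentz frames exist. -/
theorem exists_lorentzFrame (o : Orientation ℝ Plane (Fin 2)) (B : Plane →L[ℝ] Plane →L[ℝ] ℝ)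
    (hB : ∀ v w, B v w = B w v) (hpos : ∃ v, 0 < B v v) (hneg : ∃ w, B w w < 0) :
    ∃ e, IsLorentzFrame o B e := by
  obtain ⟨v, hv⟩ := hpos
  obtain ⟨w, hw⟩ := hneg
  obtain ⟨e₀, he₀⟩ : ∃ e₀, B e₀ e₀ = 1 := by
    refine ⟨(Real.sqrt (B v v))⁻¹ • v, ?_⟩
    simp only [map_smul, smul_apply, smul_eq_mul]
    rw [← mul_assoc, ← mul_inv, Real.mul_self_sqrt hv.le, inv_mul_cancel₀ hv.ne']
  set w' := w - B e₀ w • e₀ with hw'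
  have ho : B e₀ w' = 0 := by simp [hw', he₀]
  have hn : B w' w' < 0 := by
    have : B w' w' = B w w - (B e₀ w) ^ 2 := by
      simp [hw', he₀, hB w e₀]; ring
    rw [this]; nlinarith [sq_nonneg (B e₀ w)]
  obtain ⟨e₁, he₁, ho₁⟩ : ∃ e₁, B e₁ e₁ = -1 ∧ B e₀ e₁ = 0 := by
    refine ⟨(Real.sqrt (-B w' w'))⁻¹ • w', ?_, by simp [ho]⟩
    simp only [map_smul, smul_apply, smul_eq_mul]
    rw [← mul_assoc, ← mul_inv, Real.mul_self_sqrt (by linarith)]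
    rw [inv_mul_eq_div, div_neg, div_self hn.ne]
  have key (u : Plane) (hu : B u u = -1) (hu' : B e₀ u = 0) :
      LinearIndependent ℝ ![e₀, u] := by
    rw [LinearIndependent.pair_iff]
    intro s t hst
    have h1 : B e₀ (s • e₀ + t • u) = 0 := by rw [hst]; simp
    have h2 : B u (s • e₀ + t • u) = 0 := by rw [hst]; simp
    simp [he₀, hu', hu, hB u e₀] at h1 h2
    exact ⟨h1, h2⟩
  let mk (u : Plane) (hu : B u u = -1) (hu' : B e₀ u = 0) : Module.Basis (Fin 2) ℝ Plane :=
    basisOfLinearIndependentOfCardEqFinrank (key u hu hu') (by simp)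
  by_cases h : (mk e₁ he₁ ho₁).orientation = o
  · exact ⟨mk e₁ he₁ ho₁, h, by simpa [mk] using he₀, by simpa [mk] using he₁,
      by simpa [mk] using ho₁⟩
  · have he₁' : B (-e₁) (-e₁) = -1 := by simpa using he₁
    have ho₁' : B e₀ (-e₁) = 0 := by simpa using ho₁
    refine ⟨mk (-e₁) he₁' ho₁', ?_, by simpa [mk] using he₀, by simpa [mk] using he₁',
      by simpa [mk] using ho₁'⟩
    have h' := ((mk e₁ he₁ ho₁).orientation_ne_iff_eq_neg o).1 (Ne.symm h)
    rw [h', eq_comm, ← not_ne_iff]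
    intro hne
    have h2 := mt (Module.Basis.orientation_eq_iff_det_pos (mk e₁ he₁ ho₁) (mk (-e₁) he₁' ho₁')).1
    have hd : (mk e₁ he₁ ho₁).det (mk (-e₁) he₁' ho₁') = -1 := by
      have hb : (mk (-e₁) he₁' ho₁' : Fin 2 → Plane)
          = (mk e₁ he₁ ho₁).isUnitSMul (w := ![1, -1])
            (by intro i; fin_cases i <;> simp) := by
        funext i
        fin_cases i <;> simp [mk, Module.Basis.isUnitSMul_apply]
      rw [hb, Module.Basis.det_isUnitSMul]
      simp
    have h3 := h2 (by rw [hd]; norm_num)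
    have h4 := (Module.Basis.orientation_ne_iff_eq_neg (mk e₁ he₁ ho₁) _).1 (Ne.symm h3)
    exact hne h4.symm

variable {S : Type*} [TopologicalSpace S] [ChartedSpace Plane S] [IsManifold (𝓡 2) ∞ S]

/-- A Lorentzian metric on a surface: a pseudo-Riemannian metric of indefinite signature. -/
structure IsLorentzian (g : FormField (𝓡 2) S) : Prop extends IsPseudoRiemannian (𝓡 2) g where
  indefinite : ∀ x : S, (∃ v : TangentSpace (𝓡 2) x, 0 < g x v v) ∧
    ∃ w : TangentSpace (𝓡 2) x, g x w w < 0

/-- An orientation of the surface `S`: an orientation of each tangent space, such that every point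
has an open neighbourhood with a smooth positively oriented frame. -/
def IsSurfaceOrientation (o : ∀ x : S, Orientation ℝ (TangentSpace (𝓡 2) x) (Fin 2)) : Prop :=
  ∀ p : S, ∃ (U : Set S) (e : ∀ x : S, Module.Basis (Fin 2) ℝ (TangentSpace (𝓡 2) x)),
    IsOpen U ∧ p ∈ U ∧
    (∀ i, ContMDiffOn (𝓡 2) (𝓡 2).tangent ∞
      (fun x ↦ (⟨x, e x i⟩ : TangentBundle (𝓡 2) S)) U) ∧
    ∀ x ∈ U, (e x).orientation = o x

/-- The paracomplex structure of the oriented Lorentzian surface `(S, g, o)`. -/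
def surfaceJ (g : FormField (𝓡 2) S)
    (o : ∀ x : S, Orientation ℝ (TangentSpace (𝓡 2) x) (Fin 2)) : EndField (𝓡 2) S :=
  fun x ↦ paraRotation (o x) (g x)

/-- The 2-form `ω = g(j·,·)` of the oriented Lorentzian surface `(S, g, o)`. -/
def surfaceForm (g : FormField (𝓡 2) S)
    (o : ∀ x : S, Orientation ℝ (TangentSpace (𝓡 2) x) (Fin 2)) : FormField (𝓡 2) S :=
  fun x ↦ (g x).comp (surfaceJ g o x)

/-- The Gauss curvature of `g` at `x`: the sectional curvature of the tangent plane. -/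
def gaussCurvature (g : FormField (𝓡 2) S) (x : S) : ℝ :=
  sectional (chartForm (𝓡 2) g x) (extChartAt (𝓡 2) x x) (stdBasis 0) (stdBasis 1)

end Surfaces

/-! ### Product structures -/

section Products

variable {E₁ E₂ : Type*} [NormedAddCommGroup E₁] [NormedSpace ℝ E₁]
  [NormedAddCommGroup E₂] [NormedSpace ℝ E₂]
  {H₁ H₂ : Type*} [TopologicalSpace H₁] [TopologicalSpace H₂]
  {I₁ : ModelWithCorners ℝ E₁ H₁} {I₂ : ModelWithCorners ℝ E₂ H₂}
  {M₁ M₂ : Type*} [TopologicalSpace M₁] [ChartedSpace H₁ M₁]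
  [TopologicalSpace M₂] [ChartedSpace H₂ M₂]

/-- `π₁^* B₁ + ε π₂^* B₂`. -/
def prodForm (ε : ℝ) (B₁ : FormField I₁ M₁) (B₂ : FormField I₂ M₂) :
    FormField (I₁.prod I₂) (M₁ × M₂) := fun p ↦
  let b₁ : E₁ →L[ℝ] E₁ →L[ℝ] ℝ := B₁ p.1
  let b₂ : E₂ →L[ℝ] E₂ →L[ℝ] ℝ := B₂ p.2
  let pr₁ : E₁ × E₂ →L[ℝ] E₁ := ContinuousLinearMap.fst ℝ E₁ E₂
  let pr₂ : E₁ × E₂ →L[ℝ] E₂ := ContinuousLinearMap.snd ℝ E₁ E₂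
  b₁.bilinearComp pr₁ pr₁ + ε • b₂.bilinearComp pr₂ pr₂

/-- `J₁ ⊕ J₂`. -/
def prodEnd (J₁ : EndField I₁ M₁) (J₂ : EndField I₂ M₂) :
    EndField (I₁.prod I₂) (M₁ × M₂) := fun p ↦ (J₁ p.1).prodMap (J₂ p.2)

end Products

end PK

end

/-!
The product metric `G = g₁ + ε g₂` has block-diagonal Levi-Civita connection and curvature, and on
a surface the curvature tensor is `R(X,Y)Z = κ (g(Y,Z) X - g(X,Z) Y)`. Everything is computed in
charts, for fields of bilinear forms on a vector space (`IsMetricOn`), and transferred between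
charts by `riemann_transition`.

*Para-Kähler structure.* Pointwise identities are checked on a Lorentz frame. In a chart, `j` is an
explicit smooth function of the metric, up to a sign given by the orientation, which is locally
constant (`eventually_orientation_eq`). The Nijenhuis tensor and `dΩ` split into contributions of
the two factors, which vanish for reasons of dimension: differentiating `j² = 1` kills the Nijenhuis
tensor on a frame `(e, j e)` (`nijenhuisTensor_plane`), and there are no nonzero 3-forms on a plane
(`cyclic_fderiv_plane`).

*Einstein condition.* `Ric(G) = κ₁ g₁ + κ₂ g₂`, so that `Ric(G) = c G` means `κ₁ = c` and
`κ₂ = ε c`.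

*Conformal flatness.* If `e^{2f} G` is flat, the curvature of `G` is the Kulkarni–Nomizu product of
`G` with a symmetric form (`IsMetricOn.riemann_conformal`). For an orthonormal frame `a, b, c, d`
adapted to the product this forces `K(a,b) + K(c,d) = K(a,c) + K(b,d) = 0`, that is
`κ₁(x) + ε κ₂(y) = 0` for all `x` and `y`; hence both curvatures are constant. Conversely let
`κ₁ = k` and `κ₂ = -ε k`. Near each point of the first surface there is a positive function `φ` with
`Hess φ = -k φ g₁` and `|dφ|² = -k φ²` (`IsMetricOn.exists_conformal_factor`), and `φ^{-2} G` is flat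
(`IsMetricOn.riemann_conformal_prod_eq_zero`). Such a `φ` comes from a parallel
section `(φ, dφ)` of a linear connection on pairs of a function and a 1-form (`hessConnection`),
which is flat exactly because `g₁` has constant curvature `k`. The case of the Frobenius theorem that
is needed, local parallel sections of a flat linear connection, is `exists_parallel_section`:
sections are transported along the rays from a point.
-/

-- Mathlib's own setting, needed for instances on iterated spaces of continuous linear maps
set_option maxSynthPendingDepth 3

namespace PK

/-! ### The Levi-Civita connection of a metric on a vector space -/

section LeviCivita

variable {E : Type*} [NormedAddCommGroup E] [NormedSpace ℝ E]

/-- A smooth pseudo-Riemannian metric on an open subset `s` of a vector space. Nondegeneracy is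
encoded as invertibility of `h u : E → E*`. -/
structure IsMetricOn (h : E → E →L[ℝ] E →L[ℝ] ℝ) (s : Set E) : Prop where
  isOpen : IsOpen s
  smooth : ContDiffOn ℝ ∞ h s
  symm : ∀ u ∈ s, ∀ X Y, h u X Y = h u Y X
  inv : ∀ u ∈ s, (h u).IsInvertible

variable {h : E → E →L[ℝ] E →L[ℝ] ℝ} {s : Set E} {u : E}

theorem IsMetricOn.contDiffAt (hh : IsMetricOn h s) (hu : u ∈ s) : ContDiffAt ℝ ∞ h u :=
  hh.smooth.contDiffAt (hh.isOpen.mem_nhds hu)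

theorem IsMetricOn.differentiableAt (hh : IsMetricOn h s) (hu : u ∈ s) :
    DifferentiableAt ℝ h u :=
  (hh.contDiffAt hu).differentiableAt (by simp)

theorem IsMetricOn.nondeg (hh : IsMetricOn h s) (hu : u ∈ s) {v w : E}
    (H : ∀ Z, h u v Z = h u w Z) : v = w :=
  (hh.inv u hu).injective (ContinuousLinearMap.ext H)

theorem fderiv_clm_apply_const {F G : Type*} [NormedAddCommGroup F] [NormedSpace ℝ F]
    [NormedAddCommGroup G] [NormedSpace ℝ G] {A : E → F →L[ℝ] G}
    (hA : DifferentiableAt ℝ A u) (v : F) (X : E) :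
    fderiv ℝ (fun u' ↦ A u' v) u X = fderiv ℝ A u X v := by
  rw [fderiv_clm_apply hA (differentiableAt_const v)]
  simp

theorem fderiv_clm_apply_const₂ {F G K : Type*} [NormedAddCommGroup F] [NormedSpace ℝ F]
    [NormedAddCommGroup G] [NormedSpace ℝ G] [NormedAddCommGroup K] [NormedSpace ℝ K]
    {A : E → F →L[ℝ] G →L[ℝ] K}
    (hA : DifferentiableAt ℝ A u) (v : F) (w : G) (X : E) :
    fderiv ℝ (fun u' ↦ A u' v w) u X = fderiv ℝ A u X v w := by
  rw [fderiv_clm_apply_const (A := fun u' ↦ A u' v) (hA.clm_apply (differentiableAt_const v)),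
    fderiv_clm_apply_const hA]

theorem differentiableAt_clm_apply₂ {F G K : Type*} [NormedAddCommGroup F] [NormedSpace ℝ F]
    [NormedAddCommGroup G] [NormedSpace ℝ G] [NormedAddCommGroup K] [NormedSpace ℝ K]
    {A : E → F →L[ℝ] G →L[ℝ] K} {p : E → F} {q : E → G} (hA : DifferentiableAt ℝ A u)
    (hp : DifferentiableAt ℝ p u) (hq : DifferentiableAt ℝ q u) :
    DifferentiableAt ℝ (fun u' ↦ A u' (p u') (q u')) u :=
  (hA.clm_apply hp).clm_apply hq

theorem fderiv_clm_apply₂ {F G K : Type*} [NormedAddCommGroup F] [NormedSpace ℝ F]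
    [NormedAddCommGroup G] [NormedSpace ℝ G] [NormedAddCommGroup K] [NormedSpace ℝ K]
    {A : E → F →L[ℝ] G →L[ℝ] K} {p : E → F} {q : E → G} (hA : DifferentiableAt ℝ A u)
    (hp : DifferentiableAt ℝ p u) (hq : DifferentiableAt ℝ q u) (X : E) :
    fderiv ℝ (fun u' ↦ A u' (p u') (q u')) u X = fderiv ℝ A u X (p u) (q u)
      + A u (fderiv ℝ p u X) (q u) + A u (p u) (fderiv ℝ q u X) := by
  rw [fderiv_clm_apply (hA.clm_apply hp) hq, fderiv_clm_apply hA hp]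
  simp [add_comm]

theorem koszul_apply (hd : DifferentiableAt ℝ h u) (X Y Z : E) :
    koszul h u X Y Z = (1 / 2 : ℝ) *
      (fderiv ℝ h u X Y Z + fderiv ℝ h u Y X Z - fderiv ℝ h u Z X Y) := by
  simp [koszul, fderiv_clm_apply_const hd, fderiv_clm_apply_const₂ hd]

/-- The Levi-Civita connection is the only torsion-free metric one: the fundamental theorem of
pseudo-Riemannian geometry, at one point. -/
theorem IsMetricOn.christoffel_eq (hh : IsMetricOn h s) (hu : u ∈ s) {c : E → E → E}
    (hc : ∀ X Y, c X Y = c Y X)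
    (hm : ∀ X Y Z, fderiv ℝ h u X Y Z = h u (c X Y) Z + h u Y (c X Z)) (X Y : E) :
    christoffel h u X Y = c X Y := by
  unfold christoffel
  rw [(hh.inv u hu).inverse_apply_eq]
  ext Z
  rw [koszul_apply (hh.differentiableAt hu), hm, hm, hm, hc Y X, hc Z X, hc Z Y,
    hh.symm u hu (c X Z) Y]
  ring

/-- The bundled Koszul functional, as a function of the derivative `D` of the metric. -/
noncomputable def koszulL (D : E →L[ℝ] E →L[ℝ] E →L[ℝ] ℝ) : E →L[ℝ] E →L[ℝ] E →L[ℝ] ℝ :=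
  (1 / 2 : ℝ) • (D + D.flip
    - (ContinuousLinearMap.flipₗᵢ ℝ E E ℝ).toContinuousLinearEquiv.toContinuousLinearMap ∘L D.flip)

/-- The Christoffel map of `h` as a field of bilinear maps. -/
noncomputable def christoffelL (h : E → E →L[ℝ] E →L[ℝ] ℝ) (u : E) : E →L[ℝ] E →L[ℝ] E :=
  (ContinuousLinearMap.compL ℝ E (E →L[ℝ] ℝ) E (h u).inverse) ∘L koszulL (fderiv ℝ h u)

theorem IsMetricOn.christoffelL_apply (hh : IsMetricOn h s) (hu : u ∈ s) (X Y : E) :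
    christoffelL h u X Y = christoffel h u X Y := by
  have : koszulL (fderiv ℝ h u) X Y = koszul h u X Y := by
    ext Z
    rw [koszul_apply (hh.differentiableAt hu)]
    simp [koszulL]
  simp [christoffelL, christoffel, this]

theorem IsMetricOn.contDiffAt_inverse [CompleteSpace E] (hh : IsMetricOn h s) (hu : u ∈ s) :
    ContDiffAt ℝ ∞ (fun u' ↦ (h u').inverse) u :=
  ((hh.inv u hu).contDiffAt_map_inverse).comp u (hh.contDiffAt hu)

set_option synthInstance.maxHeartbeats 200000 in
theorem IsMetricOn.contDiffAt_christoffelL [CompleteSpace E] (hh : IsMetricOn h s) (hu : u ∈ s) :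
    ContDiffAt ℝ ∞ (christoffelL h) u := by
  have hD : ContDiffAt ℝ ∞ (fderiv ℝ h) u := (hh.contDiffAt hu).fderiv_right (by simp)
  have hflip : ContDiffAt ℝ ∞ (fun u' ↦ (fderiv ℝ h u').flip) u :=
    (ContinuousLinearMap.flipₗᵢ ℝ E E (E →L[ℝ] ℝ)).toContinuousLinearEquiv.contDiff.contDiffAt.comp
      u hD
  have hk : ContDiffAt ℝ ∞ (fun u' ↦ koszulL (fderiv ℝ h u')) u := by
    unfold koszulL
    exact ((hD.add hflip).sub (contDiffAt_const.clm_comp hflip)).const_smul _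
  exact ((ContinuousLinearMap.contDiff _).contDiffAt.comp u (hh.contDiffAt_inverse hu)).clm_comp hk

theorem IsMetricOn.differentiableAt_christoffelL [CompleteSpace E] (hh : IsMetricOn h s)
    (hu : u ∈ s) : DifferentiableAt ℝ (christoffelL h) u :=
  (hh.contDiffAt_christoffelL hu).differentiableAt (by simp)

theorem IsMetricOn.h_christoffelL (hh : IsMetricOn h s) (hu : u ∈ s) (X Y Z : E) :
    h u (christoffelL h u X Y) Z = (1 / 2 : ℝ) *
      (fderiv ℝ h u X Y Z + fderiv ℝ h u Y X Z - fderiv ℝ h u Z X Y) := by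
  rw [hh.christoffelL_apply hu, christoffel, ← koszul_apply (hh.differentiableAt hu)]
  have := (hh.inv u hu).self_apply_inverse (koszul h u X Y)
  rw [this]

theorem IsMetricOn.fderiv_symm (hh : IsMetricOn h s) (hu : u ∈ s) (X Y Z : E) :
    fderiv ℝ h u X Y Z = fderiv ℝ h u X Z Y := by
  rw [← fderiv_clm_apply_const₂ (hh.differentiableAt hu),
    ← fderiv_clm_apply_const₂ (hh.differentiableAt hu)]
  have : (fun u' ↦ h u' Y Z) =ᶠ[𝓝 u] fun u' ↦ h u' Z Y := by
    filter_upwards [hh.isOpen.mem_nhds hu] with u' hu'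
    exact hh.symm u' hu' Y Z
  rw [this.fderiv_eq]

theorem IsMetricOn.christoffelL_symm (hh : IsMetricOn h s) (hu : u ∈ s) (X Y : E) :
    christoffelL h u X Y = christoffelL h u Y X := by
  apply hh.nondeg hu
  intro Z
  rw [hh.h_christoffelL hu, hh.h_christoffelL hu, hh.fderiv_symm hu Z X Y]
  ring

/-- The Levi-Civita connection is metric: `∇h = 0`. -/
theorem IsMetricOn.metric_compat (hh : IsMetricOn h s) (hu : u ∈ s) (X Y Z : E) :
    fderiv ℝ h u X Y Z
      = h u (christoffelL h u X Y) Z + h u Y (christoffelL h u X Z) := by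
  rw [hh.symm u hu Y, hh.h_christoffelL hu, hh.h_christoffelL hu, hh.fderiv_symm hu X Z Y,
    hh.fderiv_symm hu Y X Z, hh.fderiv_symm hu Z X Y]
  ring

theorem IsMetricOn.fderiv_christoffel [CompleteSpace E] (hh : IsMetricOn h s) (hu : u ∈ s)
    (X Y Z : E) : fderiv ℝ (fun u' ↦ christoffel h u' Y Z) u X
      = fderiv ℝ (christoffelL h) u X Y Z := by
  rw [← fderiv_clm_apply_const₂ (hh.differentiableAt_christoffelL hu)]
  refine congrArg (fun L : E →L[ℝ] E ↦ L X) (EventuallyEq.fderiv_eq ?_)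
  filter_upwards [hh.isOpen.mem_nhds hu] with u' hu'
  exact (hh.christoffelL_apply hu' Y Z).symm

theorem IsMetricOn.riemann_eq [CompleteSpace E] (hh : IsMetricOn h s) (hu : u ∈ s) (X Y Z : E) :
    riemann h u X Y Z = fderiv ℝ (christoffelL h) u X Y Z - fderiv ℝ (christoffelL h) u Y X Z
      + christoffelL h u X (christoffelL h u Y Z) - christoffelL h u Y (christoffelL h u X Z) := by
  simp only [riemann, hh.fderiv_christoffel hu, ← hh.christoffelL_apply hu]

theorem fderiv_fderiv_symm {F : Type*} [NormedAddCommGroup F] [NormedSpace ℝ F] {f : E → F}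
    (hf : ContDiffAt ℝ ∞ f u) (X Y : E) :
    fderiv ℝ (fderiv ℝ f) u X Y = fderiv ℝ (fderiv ℝ f) u Y X :=
  (hf.isSymmSndFDerivAt (by simpa using ENat.LEInfty.out)).eq X Y

/-- The curvature operators of a metric connection are skew. -/
theorem IsMetricOn.riemann_skew [CompleteSpace E] (hh : IsMetricOn h s) (hu : u ∈ s)
    (X Y Z W : E) : h u (riemann h u X Y Z) W = - h u (riemann h u X Y W) Z := by
  have hC := hh.differentiableAt_christoffelL hu
  have hd := hh.differentiableAt hu
  -- the second derivative of `h` by metric compatibility; its symmetry in `X, Y` gives the claim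
  have key (X Y : E) : fderiv ℝ (fderiv ℝ h) u X Y Z W =
      fderiv ℝ h u X (christoffelL h u Y Z) W + h u (fderiv ℝ (christoffelL h) u X Y Z) W
      + (fderiv ℝ h u X Z (christoffelL h u Y W) + h u Z (fderiv ℝ (christoffelL h) u X Y W)) := by
    have hD : DifferentiableAt ℝ (fderiv ℝ h) u :=
      ((hh.contDiffAt hu).fderiv_right (m := ∞) (by simp)).differentiableAt (by simp)
    have hCY (V : E) : DifferentiableAt ℝ (fun u' ↦ christoffelL h u' Y V) u :=
      (hC.clm_apply (differentiableAt_const Y)).clm_apply (differentiableAt_const V)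
    have h1 : fderiv ℝ (fun u' ↦ fderiv ℝ h u' Y Z W) u X
        = fderiv ℝ (fderiv ℝ h) u X Y Z W := by
      rw [fderiv_clm_apply_const₂ (A := fun u' ↦ fderiv ℝ h u' Y)
        (hD.clm_apply (differentiableAt_const Y)), fderiv_clm_apply_const hD]
    have h2 : (fun u' ↦ fderiv ℝ h u' Y Z W) =ᶠ[𝓝 u] fun u' ↦
        h u' (christoffelL h u' Y Z) W + h u' Z (christoffelL h u' Y W) := by
      filter_upwards [hh.isOpen.mem_nhds hu] with u' hu'
      exact hh.metric_compat hu' Y Z W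
    rw [← h1, h2.fderiv_eq, fderiv_fun_add (differentiableAt_clm_apply₂ hd (hCY Z) (by fun_prop))
      (differentiableAt_clm_apply₂ hd (by fun_prop) (hCY W)), add_apply,
      fderiv_clm_apply₂ hd (hCY Z) (by fun_prop), fderiv_clm_apply₂ hd (by fun_prop) (hCY W)]
    simp only [fderiv_clm_apply_const₂ hC, fderiv_fun_const, Pi.zero_apply, zero_apply, map_zero,
      add_zero]
  have h1 := key X Y
  have h2 := key Y X
  rw [fderiv_fderiv_symm (hh.contDiffAt hu) X Y] at h1
  rw [hh.riemann_eq hu, hh.riemann_eq hu, hh.symm u hu _ Z]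
  simp only [hh.metric_compat hu] at h1 h2
  simp only [map_sub, map_add, sub_apply, add_apply]
  linarith

end LeviCivita

/-! ### Curvature of planes and of product metrics -/

section FiniteDim

variable {E : Type*} [NormedAddCommGroup E] [NormedSpace ℝ E] [FiniteDimensional ℝ E]

theorem isInvertible_of_nondeg (b : E →L[ℝ] E →L[ℝ] ℝ) (H : ∀ v, (∀ w, b v w = 0) → v = 0) :
    b.IsInvertible := by
  have hinj : Function.Injective b.toLinearMap := by
    rw [← LinearMap.ker_eq_bot, LinearMap.ker_eq_bot']
    intro v hv
    exact H v fun w ↦ DFunLike.congr_fun hv w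
  have hdim : Module.finrank ℝ E = Module.finrank ℝ (E →L[ℝ] ℝ) := by
    rw [← (LinearMap.toContinuousLinearMap (𝕜 := ℝ) (E := E) (F' := ℝ)).finrank_eq]
    exact (Subspace.dual_finrank_eq (K := ℝ) (V := E)).symm
  exact ⟨(LinearEquiv.ofInjectiveOfFinrankEq b.toLinearMap hinj hdim).toContinuousLinearEquiv, by
    ext; rfl⟩

theorem contDiffOn_form_iff {F G : Type*} [NormedAddCommGroup F] [NormedSpace ℝ F]
    [NormedAddCommGroup G] [NormedSpace ℝ G] {n : ℕ∞ω}
    {h : F → E →L[ℝ] E →L[ℝ] G} {s : Set F} :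
    ContDiffOn ℝ n h s ↔ ∀ v w, ContDiffOn ℝ n (fun u ↦ h u v w) s := by
  rw [contDiffOn_clm_apply]
  exact forall_congr' fun v ↦ contDiffOn_clm_apply

end FiniteDim

section Linearity

variable {E : Type*} [NormedAddCommGroup E] [NormedSpace ℝ E]
  {h : E → E →L[ℝ] E →L[ℝ] ℝ} {s : Set E} {u : E}

theorem riemann_swap (h : E → E →L[ℝ] E →L[ℝ] ℝ) (u X Y Z : E) :
    riemann h u X Y Z = -riemann h u Y X Z := by
  simp only [riemann]; abel

variable [CompleteSpace E]

theorem IsMetricOn.riemann_add_left (hh : IsMetricOn h s) (hu : u ∈ s) (X X' Y Z : E) :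
    riemann h u (X + X') Y Z = riemann h u X Y Z + riemann h u X' Y Z := by
  simp only [hh.riemann_eq hu, map_add, add_apply]; abel

theorem IsMetricOn.riemann_smul_left (hh : IsMetricOn h s) (hu : u ∈ s) (c : ℝ) (X Y Z : E) :
    riemann h u (c • X) Y Z = c • riemann h u X Y Z := by
  simp only [hh.riemann_eq hu, map_smul, smul_apply]; module

theorem IsMetricOn.riemann_add_right (hh : IsMetricOn h s) (hu : u ∈ s) (X Y Z Z' : E) :
    riemann h u X Y (Z + Z') = riemann h u X Y Z + riemann h u X Y Z' := by
  simp only [hh.riemann_eq hu, map_add]; abel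

theorem IsMetricOn.riemann_smul_right (hh : IsMetricOn h s) (hu : u ∈ s) (c : ℝ) (X Y Z : E) :
    riemann h u X Y (c • Z) = c • riemann h u X Y Z := by
  simp only [hh.riemann_eq hu, map_smul]; module

end Linearity

section Plane

theorem plane_eq (v : Plane) : v = v 0 • stdBasis 0 + v 1 • stdBasis 1 := by
  ext i; fin_cases i <;> simp [stdBasis]

/-- A skew-symmetric bilinear map on the plane is a multiple of the determinant. -/
theorem plane_skew_eq {V : Type*} [AddCommGroup V] [Module ℝ V] (f : Plane → Plane → V)
    (hadd : ∀ X X' Y, f (X + X') Y = f X Y + f X' Y)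
    (hsmul : ∀ (c : ℝ) X Y, f (c • X) Y = c • f X Y)
    (hswap : ∀ X Y, f X Y = -f Y X) (X Y : Plane) :
    f X Y = (X 0 * Y 1 - X 1 * Y 0) • f (stdBasis 0) (stdBasis 1) := by
  have hself (X : Plane) : f X X = 0 := by
    have := hswap X X
    have h2 : (2 : ℝ) • f X X = 0 := by rw [two_smul]; nth_rw 1 [this]; simp
    simpa using h2
  have hadd' (X Y Y' : Plane) : f X (Y + Y') = f X Y + f X Y' := by
    rw [hswap, hadd, hswap Y, hswap Y']; abel
  have hsmul' (c : ℝ) (X Y : Plane) : f X (c • Y) = c • f X Y := by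
    rw [hswap, hsmul, hswap Y]; simp
  conv_lhs => rw [plane_eq X, plane_eq Y]
  simp only [hadd, hadd', hsmul, hsmul', hself, hswap (stdBasis 1) (stdBasis 0)]
  module

variable {h : Plane → Plane →L[ℝ] Plane →L[ℝ] ℝ} {s : Set Plane} {u : Plane}

theorem IsMetricOn.det_ne_zero (hh : IsMetricOn h s) (hu : u ∈ s) :
    h u (stdBasis 0) (stdBasis 0) * h u (stdBasis 1) (stdBasis 1)
      - h u (stdBasis 0) (stdBasis 1) ^ 2 ≠ 0 := by
  intro hdet
  have hs := hh.symm u hu (stdBasis 1) (stdBasis 0)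
  have h1 : h u (stdBasis 1) (stdBasis 1) • stdBasis 0
      - h u (stdBasis 0) (stdBasis 1) • stdBasis 1 = 0 := by
    apply hh.nondeg hu
    intro Z
    rw [plane_eq Z]
    simp only [map_add, map_sub, map_smul, sub_apply, smul_apply, smul_eq_mul, hs, map_zero,
      zero_apply]
    linear_combination Z 0 * hdet
  have h2 : h u (stdBasis 0) (stdBasis 1) • stdBasis 0
      - h u (stdBasis 0) (stdBasis 0) • stdBasis 1 = 0 := by
    apply hh.nondeg hu
    intro Z
    rw [plane_eq Z]
    simp only [map_add, map_sub, map_smul, sub_apply, smul_apply, smul_eq_mul, hs, map_zero,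
      zero_apply]
    linear_combination (- Z 1) * hdet
  have ha : h u (stdBasis 0) (stdBasis 0) = 0 := by
    simpa [stdBasis] using congrArg (fun v : Plane ↦ v 1) h2
  have hb : h u (stdBasis 0) (stdBasis 1) = 0 := by
    simpa [stdBasis] using congrArg (fun v : Plane ↦ v 0) h2
  have : (stdBasis 0 : Plane) = 0 := by
    apply hh.nondeg hu
    intro Z
    rw [plane_eq Z]
    simp [ha, hb]
  exact stdBasis.ne_zero 0 this

/-- In dimension two the curvature tensor is determined by the sectional curvature. -/
theorem IsMetricOn.riemann_plane (hh : IsMetricOn h s) (hu : u ∈ s) (X Y Z : Plane) :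
    riemann h u X Y Z = sectional h u (stdBasis 0) (stdBasis 1) • (h u Y Z • X - h u X Z • Y) := by
  apply hh.nondeg hu
  intro W
  have hs := hh.symm u hu (stdBasis 1) (stdBasis 0)
  have h1 (X Y Z) := plane_skew_eq (fun X Y ↦ riemann h u X Y Z)
    (fun X X' Y ↦ hh.riemann_add_left hu X X' Y Z) (fun c X Y ↦ hh.riemann_smul_left hu c X Y Z)
    (fun X Y ↦ riemann_swap h u X Y Z) X Y
  have h2 (Z W) := plane_skew_eq (fun Z W ↦ h u (riemann h u (stdBasis 0) (stdBasis 1) Z) W)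
    (fun Z Z' W ↦ by simp only [hh.riemann_add_right hu, map_add, add_apply])
    (fun c Z W ↦ by simp only [hh.riemann_smul_right hu, map_smul, smul_apply])
    (fun Z W ↦ hh.riemann_skew hu _ _ Z W) Z W
  have h3 : sectional h u (stdBasis 0) (stdBasis 1)
      * (h u (stdBasis 0) (stdBasis 0) * h u (stdBasis 1) (stdBasis 1)
      - h u (stdBasis 0) (stdBasis 1) ^ 2)
      = - h u (riemann h u (stdBasis 0) (stdBasis 1) (stdBasis 0)) (stdBasis 1) := by
    rw [sectional, div_mul_cancel₀ _ (hh.det_ne_zero hu), hh.riemann_skew hu]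
  simp only at h1 h2
  rw [h1]
  simp only [map_smul, smul_apply, map_sub, sub_apply, smul_eq_mul]
  rw [h2, smul_eq_mul, form_apply (h u) Y Z, form_apply (h u) X Z, form_apply (h u) X W,
    form_apply (h u) Y W, hs]
  linear_combination ((X 0 * Y 1 - X 1 * Y 0) * (Z 0 * W 1 - Z 1 * W 0)) * h3

end Plane

section Product

variable {E₁ E₂ : Type*} [NormedAddCommGroup E₁] [NormedSpace ℝ E₁]
  [NormedAddCommGroup E₂] [NormedSpace ℝ E₂]

/-- The form `h₁ ⊕ ε h₂` on a product of vector spaces. -/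
noncomputable def prodMetric (ε : ℝ) (h₁ : E₁ → E₁ →L[ℝ] E₁ →L[ℝ] ℝ)
    (h₂ : E₂ → E₂ →L[ℝ] E₂ →L[ℝ] ℝ) (u : E₁ × E₂) :
    E₁ × E₂ →L[ℝ] E₁ × E₂ →L[ℝ] ℝ :=
  (h₁ u.1).bilinearComp (.fst ℝ E₁ E₂) (.fst ℝ E₁ E₂)
    + ε • (h₂ u.2).bilinearComp (.snd ℝ E₁ E₂) (.snd ℝ E₁ E₂)

variable {ε : ℝ} {h₁ : E₁ → E₁ →L[ℝ] E₁ →L[ℝ] ℝ} {h₂ : E₂ → E₂ →L[ℝ] E₂ →L[ℝ] ℝ}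
  {s₁ : Set E₁} {s₂ : Set E₂}

@[simp] theorem prodMetric_apply (u v w : E₁ × E₂) :
    prodMetric ε h₁ h₂ u v w = h₁ u.1 v.1 w.1 + ε * h₂ u.2 v.2 w.2 := rfl

theorem fderiv_prodMetric {u : E₁ × E₂} (hh₁ : DifferentiableAt ℝ h₁ u.1)
    (hh₂ : DifferentiableAt ℝ h₂ u.2) (hd : DifferentiableAt ℝ (prodMetric ε h₁ h₂) u)
    (X Y Z : E₁ × E₂) : fderiv ℝ (prodMetric ε h₁ h₂) u X Y Z
      = fderiv ℝ h₁ u.1 X.1 Y.1 Z.1 + ε * fderiv ℝ h₂ u.2 X.2 Y.2 Z.2 := by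
  rw [← fderiv_clm_apply_const₂ hd, ← fderiv_clm_apply_const₂ hh₁,
    ← fderiv_clm_apply_const₂ hh₂]
  simp only [prodMetric_apply]
  have k₁ : DifferentiableAt ℝ (fun u' ↦ h₁ u' Y.1 Z.1) u.1 := by fun_prop
  have k₂ : DifferentiableAt ℝ (fun u' ↦ h₂ u' Y.2 Z.2) u.2 := by fun_prop
  have := (k₁.hasFDerivAt.comp u hasFDerivAt_fst).add
    ((k₂.hasFDerivAt.comp u hasFDerivAt_snd).const_mul ε)
  exact congrArg (fun L : E₁ × E₂ →L[ℝ] ℝ ↦ L X) this.fderiv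

variable [FiniteDimensional ℝ E₁] [FiniteDimensional ℝ E₂]

theorem contDiffOn_prodMetric (hh₁ : ContDiffOn ℝ ∞ h₁ s₁) (hh₂ : ContDiffOn ℝ ∞ h₂ s₂) :
    ContDiffOn ℝ ∞ (prodMetric ε h₁ h₂) (s₁ ×ˢ s₂) := by
  rw [contDiffOn_form_iff] at hh₁ hh₂ ⊢
  intro v w
  simp only [prodMetric_apply]
  exact ((hh₁ v.1 w.1).comp contDiffOn_fst fun u hu ↦ hu.1).add
    (contDiffOn_const.mul ((hh₂ v.2 w.2).comp contDiffOn_snd fun u hu ↦ hu.2))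

theorem IsMetricOn.prod (hε : ε ≠ 0) (hh₁ : IsMetricOn h₁ s₁) (hh₂ : IsMetricOn h₂ s₂) :
    IsMetricOn (prodMetric ε h₁ h₂) (s₁ ×ˢ s₂) where
  isOpen := hh₁.isOpen.prod hh₂.isOpen
  smooth := contDiffOn_prodMetric hh₁.smooth hh₂.smooth
  symm u hu X Y := by simp [hh₁.symm u.1 hu.1 X.1, hh₂.symm u.2 hu.2 X.2]
  inv u hu := by
    apply isInvertible_of_nondeg
    intro v hv
    refine Prod.ext (hh₁.nondeg hu.1 fun Z ↦ ?_) (hh₂.nondeg hu.2 fun Z ↦ ?_)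
    · simpa using hv (Z, 0)
    · simpa [hε] using hv (0, Z)

theorem IsMetricOn.christoffel_prod (hε : ε ≠ 0) (hh₁ : IsMetricOn h₁ s₁)
    (hh₂ : IsMetricOn h₂ s₂) {u : E₁ × E₂} (hu : u ∈ s₁ ×ˢ s₂) (X Y : E₁ × E₂) :
    christoffel (prodMetric ε h₁ h₂) u X Y
      = (christoffel h₁ u.1 X.1 Y.1, christoffel h₂ u.2 X.2 Y.2) := by
  have hh := hh₁.prod hε hh₂
  apply hh.christoffel_eq hu (c := fun X Y ↦
    (christoffel h₁ u.1 X.1 Y.1, christoffel h₂ u.2 X.2 Y.2))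
  · intro X Y
    simp only [← hh₁.christoffelL_apply hu.1, ← hh₂.christoffelL_apply hu.2,
      hh₁.christoffelL_symm hu.1 X.1, hh₂.christoffelL_symm hu.2 X.2]
  · intro X Y Z
    rw [fderiv_prodMetric (hh₁.differentiableAt hu.1) (hh₂.differentiableAt hu.2)
      (hh.differentiableAt hu), hh₁.metric_compat hu.1, hh₂.metric_compat hu.2]
    simp only [← hh₁.christoffelL_apply hu.1, ← hh₂.christoffelL_apply hu.2, prodMetric_apply]
    ring

/-- The curvature tensor of a product metric is the sum of those of the factors. -/
theorem IsMetricOn.riemann_prod (hε : ε ≠ 0) (hh₁ : IsMetricOn h₁ s₁)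
    (hh₂ : IsMetricOn h₂ s₂) {u : E₁ × E₂} (hu : u ∈ s₁ ×ˢ s₂) (X Y Z : E₁ × E₂) :
    riemann (prodMetric ε h₁ h₂) u X Y Z
      = (riemann h₁ u.1 X.1 Y.1 Z.1, riemann h₂ u.2 X.2 Y.2 Z.2) := by
  have hh := hh₁.prod hε hh₂
  have key (X Y Z : E₁ × E₂) : fderiv ℝ (fun u' ↦ christoffel (prodMetric ε h₁ h₂) u' Y Z) u X
      = (fderiv ℝ (fun u' ↦ christoffel h₁ u' Y.1 Z.1) u.1 X.1,
        fderiv ℝ (fun u' ↦ christoffel h₂ u' Y.2 Z.2) u.2 X.2) := by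
    have h1 : (fun u' ↦ christoffel (prodMetric ε h₁ h₂) u' Y Z) =ᶠ[𝓝 u] fun u' ↦
        (christoffelL h₁ u'.1 Y.1 Z.1, christoffelL h₂ u'.2 Y.2 Z.2) := by
      filter_upwards [hh.isOpen.mem_nhds hu] with u' hu'
      rw [hh₁.christoffel_prod hε hh₂ hu', hh₁.christoffelL_apply hu'.1,
        hh₂.christoffelL_apply hu'.2]
    rw [h1.fderiv_eq, hh₁.fderiv_christoffel hu.1, hh₂.fderiv_christoffel hu.2]
    have d₁ := hh₁.differentiableAt_christoffelL hu.1
    have d₂ := hh₂.differentiableAt_christoffelL hu.2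
    have k₁ : DifferentiableAt ℝ (fun u' ↦ christoffelL h₁ u' Y.1 Z.1) u.1 := by fun_prop
    have k₂ : DifferentiableAt ℝ (fun u' ↦ christoffelL h₂ u' Y.2 Z.2) u.2 := by fun_prop
    have := (k₁.hasFDerivAt.comp u hasFDerivAt_fst).prodMk
      (k₂.hasFDerivAt.comp u hasFDerivAt_snd)
    rw [← fderiv_clm_apply_const₂ d₁, ← fderiv_clm_apply_const₂ d₂]
    exact congrArg (fun L : E₁ × E₂ →L[ℝ] E₁ × E₂ ↦ L X) this.fderiv
  unfold riemann
  simp only [key, hh₁.christoffel_prod hε hh₂ hu]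
  rfl

end Product

/-! ### Conformal changes and naturality of the curvature -/

section Conformal

variable {E : Type*} [NormedAddCommGroup E] [NormedSpace ℝ E]
  {h : E → E →L[ℝ] E →L[ℝ] ℝ} {s : Set E} {u : E} {f : E → ℝ}

/-- The gradient of `f` with respect to the metric `h`. -/
noncomputable def metricGrad (h : E → E →L[ℝ] E →L[ℝ] ℝ) (f : E → ℝ) (u : E) : E :=
  (h u).inverse (fderiv ℝ f u)

/-- The Hessian of `f` with respect to the Levi-Civita connection of `h`. -/
noncomputable def metricHess (h : E → E →L[ℝ] E →L[ℝ] ℝ) (f : E → ℝ) (u X Y : E) : ℝ :=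
  fderiv ℝ (fderiv ℝ f) u X Y - fderiv ℝ f u (christoffelL h u X Y)

/-- The change of the Schouten endomorphism, up to sign, under the conformal change
`h ↦ e^{2f} h`: the endomorphism `h`-dual to `Hess f - df ⊗ df + ½ |df|² h`. -/
noncomputable def schoutenChange (h : E → E →L[ℝ] E →L[ℝ] ℝ) (f : E → ℝ) (u X : E) : E :=
  fderiv ℝ (metricGrad h f) u X + christoffelL h u X (metricGrad h f u)
    - fderiv ℝ f u X • metricGrad h f u
    + (1 / 2 * fderiv ℝ f u (metricGrad h f u)) • X

theorem IsMetricOn.h_metricGrad (hh : IsMetricOn h s) (hu : u ∈ s) (f : E → ℝ) (Z : E) :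
    h u (metricGrad h f u) Z = fderiv ℝ f u Z := by
  have := (hh.inv u hu).self_apply_inverse (fderiv ℝ f u)
  rw [metricGrad, this]

theorem IsMetricOn.conformal (hh : IsMetricOn h s) (hf : ContDiffOn ℝ ∞ f s) :
    IsMetricOn (fun u ↦ Real.exp (2 * f u) • h u) s where
  isOpen := hh.isOpen
  smooth := ((contDiffOn_const.mul hf).exp).smul hh.smooth
  symm u hu X Y := by simp [hh.symm u hu X Y]
  inv u hu := by
    obtain ⟨e, he⟩ := hh.inv u hu
    refine ⟨e.trans (ContinuousLinearEquiv.smulLeft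
      (Units.mk0 (Real.exp (2 * f u)) (Real.exp_ne_zero _))), ?_⟩
    rw [← he]
    ext v w
    rfl

theorem IsMetricOn.fderiv_conformal (hh : IsMetricOn h s) (hf : ContDiffOn ℝ ∞ f s) (hu : u ∈ s)
    (X Y Z : E) : fderiv ℝ (fun u ↦ Real.exp (2 * f u) • h u) u X Y Z
      = Real.exp (2 * f u) * (fderiv ℝ h u X Y Z + 2 * fderiv ℝ f u X * h u Y Z) := by
  have hfd : DifferentiableAt ℝ f u :=
    (hf.contDiffAt (hh.isOpen.mem_nhds hu)).differentiableAt (by simp)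
  have he : HasFDerivAt (fun u ↦ Real.exp (2 * f u)) _ u := (hfd.hasFDerivAt.const_mul 2).exp
  rw [(he.fun_smul (hh.differentiableAt hu).hasFDerivAt).fderiv]
  simp
  ring

theorem IsMetricOn.christoffel_conformal (hh : IsMetricOn h s) (hf : ContDiffOn ℝ ∞ f s)
    (hu : u ∈ s) (X Y : E) :
    christoffel (fun u ↦ Real.exp (2 * f u) • h u) u X Y = christoffelL h u X Y
      + (fderiv ℝ f u X • Y + fderiv ℝ f u Y • X - h u X Y • metricGrad h f u) := by
  apply (hh.conformal hf).christoffel_eq hu (c := fun X Y ↦ christoffelL h u X Y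
      + (fderiv ℝ f u X • Y + fderiv ℝ f u Y • X - h u X Y • metricGrad h f u))
  · intro X Y
    simp only [hh.christoffelL_symm hu X Y, hh.symm u hu X Y]
    module
  · intro X Y Z
    rw [hh.fderiv_conformal hf hu, hh.metric_compat hu]
    simp only [map_add, map_sub, map_smul, add_apply, sub_apply, smul_apply, smul_eq_mul,
      hh.h_metricGrad hu, hh.symm u hu Y (metricGrad h f u), hh.symm u hu Y X]
    ring

variable [CompleteSpace E]

theorem IsMetricOn.differentiableAt_metricGrad (hh : IsMetricOn h s) (hf : ContDiffOn ℝ ∞ f s)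
    (hu : u ∈ s) : DifferentiableAt ℝ (metricGrad h f) u :=
  ((hh.contDiffAt_inverse hu).differentiableAt (by simp)).clm_apply
    (((hf.contDiffAt (hh.isOpen.mem_nhds hu)).fderiv_right (m := ∞) (by simp)).differentiableAt
      (by simp))

/-- The Hessian is the covariant derivative of the gradient. -/
theorem IsMetricOn.h_fderiv_metricGrad (hh : IsMetricOn h s) (hf : ContDiffOn ℝ ∞ f s)
    (hu : u ∈ s) (X Z : E) :
    h u (fderiv ℝ (metricGrad h f) u X + christoffelL h u X (metricGrad h f u)) Z
      = metricHess h f u X Z := by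
  have hd : DifferentiableAt ℝ (fderiv ℝ f) u :=
    ((hf.contDiffAt (hh.isOpen.mem_nhds hu)).fderiv_right (m := ∞) (by simp)).differentiableAt
      (by simp)
  have h1 : (fun u' ↦ h u' (metricGrad h f u') Z) =ᶠ[𝓝 u] fun u' ↦ fderiv ℝ f u' Z := by
    filter_upwards [hh.isOpen.mem_nhds hu] with u' hu'
    exact hh.h_metricGrad hu' f Z
  have h2 := congrArg (fun L : E →L[ℝ] ℝ ↦ L X) h1.fderiv_eq
  rw [fderiv_clm_apply₂ (hh.differentiableAt hu) (hh.differentiableAt_metricGrad hf hu)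
    (differentiableAt_const Z), fderiv_clm_apply_const hd, hh.metric_compat hu,
    hh.h_metricGrad hu] at h2
  simp only [fderiv_fun_const, Pi.zero_apply, zero_apply, map_zero, add_zero] at h2
  rw [metricHess, ← h2]
  simp only [map_add, add_apply]
  ring

theorem IsMetricOn.h_schoutenChange (hh : IsMetricOn h s) (hf : ContDiffOn ℝ ∞ f s)
    (hu : u ∈ s) (X Y : E) :
    h u (schoutenChange h f u X) Y = metricHess h f u X Y - fderiv ℝ f u X * fderiv ℝ f u Y
      + 1 / 2 * fderiv ℝ f u (metricGrad h f u) * h u X Y := by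
  rw [← hh.h_fderiv_metricGrad hf hu]
  simp only [schoutenChange, map_add, map_sub, map_smul, add_apply, sub_apply, smul_apply,
    smul_eq_mul, hh.h_metricGrad hu]

/-- The conformal change of the curvature tensor: `e^{2f} h` has curvature `R - h ∧ b`, where `b`
is the form dual to `schoutenChange` and `∧` is the Kulkarni–Nomizu product. -/
theorem IsMetricOn.riemann_conformal (hh : IsMetricOn h s) (hf : ContDiffOn ℝ ∞ f s)
    (hu : u ∈ s) (X Y Z : E) :
    riemann (fun u ↦ Real.exp (2 * f u) • h u) u X Y Z = riemann h u X Y Z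
      - (h u (schoutenChange h f u Y) Z • X - h u (schoutenChange h f u X) Z • Y
        + h u Y Z • schoutenChange h f u X - h u X Z • schoutenChange h f u Y) := by
  have hC := hh.differentiableAt_christoffelL hu
  have hN := hh.differentiableAt_metricGrad hf hu
  have hd := hh.differentiableAt hu
  have hfu := hf.contDiffAt (hh.isOpen.mem_nhds hu)
  have hd1 : DifferentiableAt ℝ (fderiv ℝ f) u :=
    (hfu.fderiv_right (m := ∞) (by simp)).differentiableAt (by simp)
  have key (X Y Z : E) :
      fderiv ℝ (fun u' ↦ christoffel (fun u ↦ Real.exp (2 * f u) • h u) u' Y Z) u X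
        = fderiv ℝ (christoffelL h) u X Y Z
        + (fderiv ℝ (fderiv ℝ f) u X Y • Z + fderiv ℝ (fderiv ℝ f) u X Z • Y
          - (fderiv ℝ h u X Y Z • metricGrad h f u + h u Y Z • fderiv ℝ (metricGrad h f) u X)) := by
    have h1 : (fun u' ↦ christoffel (fun u ↦ Real.exp (2 * f u) • h u) u' Y Z) =ᶠ[𝓝 u]
        fun u' ↦ christoffelL h u' Y Z
          + (fderiv ℝ f u' Y • Z + fderiv ℝ f u' Z • Y - h u' Y Z • metricGrad h f u') := by
      filter_upwards [hh.isOpen.mem_nhds hu] with u' hu'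
      exact hh.christoffel_conformal hf hu' Y Z
    have k1 : DifferentiableAt ℝ (fun u' ↦ christoffelL h u' Y Z) u := by fun_prop
    have k2 (V : E) : DifferentiableAt ℝ (fun u' ↦ fderiv ℝ f u' V) u := by fun_prop
    have k3 : DifferentiableAt ℝ (fun u' ↦ h u' Y Z) u := by fun_prop
    have h2 := k1.hasFDerivAt.add ((((k2 Y).hasFDerivAt.smul_const Z).add
      ((k2 Z).hasFDerivAt.smul_const Y)).sub (k3.hasFDerivAt.smul hN.hasFDerivAt))
    rw [h1.fderiv_eq]
    refine (congrArg (fun L : E →L[ℝ] E ↦ L X) h2.fderiv).trans ?_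
    simp only [add_apply, sub_apply, smul_apply, ContinuousLinearMap.smulRight_apply,
      fderiv_clm_apply_const₂ hC, fderiv_clm_apply_const hd1, fderiv_clm_apply_const₂ hd]
    module
  rw [hh.h_schoutenChange hf hu, hh.h_schoutenChange hf hu, hh.riemann_eq hu]
  unfold riemann
  simp only [key, hh.christoffel_conformal hf hu, hh.metric_compat hu, fderiv_fderiv_symm hfu Y X,
    map_add, map_sub, map_smul, schoutenChange, metricHess,
    hh.christoffelL_symm hu Y X, hh.symm u hu Y X, hh.symm u hu _ (metricGrad h f u),
    hh.h_metricGrad hu, smul_eq_mul,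
    hh.symm u hu Y (christoffelL h u X Z)]
  module

end Conformal

section Naturality

variable {E F : Type*} [NormedAddCommGroup E] [NormedSpace ℝ E]
  [NormedAddCommGroup F] [NormedSpace ℝ F]
  {h : F → F →L[ℝ] F →L[ℝ] ℝ} {s : Set F}
  {h' : E → E →L[ℝ] E →L[ℝ] ℝ} {s' : Set E} {u : E} {φ : E → F}

/-- The transformation law of the Christoffel map. -/
theorem IsMetricOn.christoffel_pullback (hh : IsMetricOn h s) (hh' : IsMetricOn h' s')
    (hφ : ContDiffOn ℝ ∞ φ s') (hmaps : MapsTo φ s' s)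
    (hinv : ∀ u ∈ s', (fderiv ℝ φ u).IsInvertible)
    (hpull : ∀ u ∈ s', ∀ X Y, h' u X Y = h (φ u) (fderiv ℝ φ u X) (fderiv ℝ φ u Y))
    (hu : u ∈ s') (X Y : E) :
    fderiv ℝ φ u (christoffelL h' u X Y)
      = christoffelL h (φ u) (fderiv ℝ φ u X) (fderiv ℝ φ u Y)
        + fderiv ℝ (fderiv ℝ φ) u X Y := by
  have hφu := hφ.contDiffAt (hh'.isOpen.mem_nhds hu)
  have hT : DifferentiableAt ℝ (fderiv ℝ φ) u :=
    (hφu.fderiv_right (m := ∞) (by simp)).differentiableAt (by simp)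
  set c : E → E → E := fun X Y ↦ (fderiv ℝ φ u).inverse
    (christoffelL h (φ u) (fderiv ℝ φ u X) (fderiv ℝ φ u Y) + fderiv ℝ (fderiv ℝ φ) u X Y) with hc
  have hcT (X Y : E) : fderiv ℝ φ u (c X Y)
      = christoffelL h (φ u) (fderiv ℝ φ u X) (fderiv ℝ φ u Y)
        + fderiv ℝ (fderiv ℝ φ) u X Y := (hinv u hu).self_apply_inverse _
  rw [hh'.christoffelL_apply hu, hh'.christoffel_eq hu (c := c), hcT]
  · intro X Y
    simp only [hc, hh.christoffelL_symm (hmaps hu) (fderiv ℝ φ u X), fderiv_fderiv_symm hφu X]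
  · intro X Y Z
    have hd : HasFDerivAt (fun u ↦ h (φ u)) (fderiv ℝ h (φ u) ∘L fderiv ℝ φ u) u :=
      (hh.differentiableAt (hmaps hu)).hasFDerivAt.comp u
        (hφu.differentiableAt (by simp)).hasFDerivAt
    have h1 : (fun u' ↦ h' u' Y Z) =ᶠ[𝓝 u]
        fun u' ↦ h (φ u') (fderiv ℝ φ u' Y) (fderiv ℝ φ u' Z) := by
      filter_upwards [hh'.isOpen.mem_nhds hu] with u' hu'
      exact hpull u' hu' Y Z
    rw [← fderiv_clm_apply_const₂ (hh'.differentiableAt hu), h1.fderiv_eq,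
      fderiv_clm_apply₂ hd.differentiableAt (hT.clm_apply (differentiableAt_const Y))
        (hT.clm_apply (differentiableAt_const Z)), hd.fderiv, fderiv_clm_apply_const hT,
      fderiv_clm_apply_const hT, hpull u hu, hpull u hu, hcT, hcT]
    simp only [ContinuousLinearMap.comp_apply, hh.metric_compat (hmaps hu), map_add, add_apply]
    ring

variable [CompleteSpace E] [CompleteSpace F]

/-- Naturality of the curvature tensor under local diffeomorphisms. -/
theorem IsMetricOn.riemann_pullback (hh : IsMetricOn h s) (hh' : IsMetricOn h' s')
    (hφ : ContDiffOn ℝ ∞ φ s') (hmaps : MapsTo φ s' s)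
    (hinv : ∀ u ∈ s', (fderiv ℝ φ u).IsInvertible)
    (hpull : ∀ u ∈ s', ∀ X Y, h' u X Y = h (φ u) (fderiv ℝ φ u X) (fderiv ℝ φ u Y))
    (hu : u ∈ s') (X Y Z : E) :
    fderiv ℝ φ u (riemann h' u X Y Z)
      = riemann h (φ u) (fderiv ℝ φ u X) (fderiv ℝ φ u Y) (fderiv ℝ φ u Z) := by
  have hφu := hφ.contDiffAt (hh'.isOpen.mem_nhds hu)
  have hTs : ContDiffAt ℝ ∞ (fderiv ℝ φ) u := hφu.fderiv_right (by simp)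
  have hT : DifferentiableAt ℝ (fderiv ℝ φ) u := hTs.differentiableAt (by simp)
  have hTT : DifferentiableAt ℝ (fderiv ℝ (fderiv ℝ φ)) u :=
    (hTs.fderiv_right (m := ∞) (by simp)).differentiableAt (by simp)
  have hC := hh.differentiableAt_christoffelL (hmaps hu)
  have hC' := hh'.differentiableAt_christoffelL hu
  have hd : HasFDerivAt (fun u ↦ christoffelL h (φ u))
      (fderiv ℝ (christoffelL h) (φ u) ∘L fderiv ℝ φ u) u :=
    hC.hasFDerivAt.comp u (hφu.differentiableAt (by simp)).hasFDerivAt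
  have hΓ (X Y : E) := hh.christoffel_pullback hh' hφ hmaps hinv hpull hu X Y
  have key (X Y Z : E) : fderiv ℝ (fderiv ℝ φ) u X (christoffelL h' u Y Z)
      + fderiv ℝ φ u (fderiv ℝ (christoffelL h') u X Y Z)
      = fderiv ℝ (christoffelL h) (φ u) (fderiv ℝ φ u X) (fderiv ℝ φ u Y) (fderiv ℝ φ u Z)
      + christoffelL h (φ u) (fderiv ℝ (fderiv ℝ φ) u X Y) (fderiv ℝ φ u Z)
      + christoffelL h (φ u) (fderiv ℝ φ u Y) (fderiv ℝ (fderiv ℝ φ) u X Z)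
      + fderiv ℝ (fderiv ℝ (fderiv ℝ φ)) u X Y Z := by
    -- differentiate the transformation law of the Christoffel map
    have h1 : (fun u' ↦ fderiv ℝ φ u' (christoffelL h' u' Y Z)) =ᶠ[𝓝 u]
        fun u' ↦ christoffelL h (φ u') (fderiv ℝ φ u' Y) (fderiv ℝ φ u' Z)
          + fderiv ℝ (fderiv ℝ φ) u' Y Z := by
      filter_upwards [hh'.isOpen.mem_nhds hu] with u' hu'
      exact hh.christoffel_pullback hh' hφ hmaps hinv hpull hu' Y Z
    have hTc (V : E) : DifferentiableAt ℝ (fun u' ↦ fderiv ℝ φ u' V) u := by fun_prop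
    have hCc : DifferentiableAt ℝ (fun u' ↦ christoffelL h' u' Y Z) u := by fun_prop
    have hDD : DifferentiableAt ℝ (fun u' ↦ fderiv ℝ (fderiv ℝ φ) u' Y Z) u := by fun_prop
    have h2 := congrArg (fun L : E →L[ℝ] F ↦ L X) h1.fderiv_eq
    rw [fderiv_clm_apply hT hCc, fderiv_fun_add
      (differentiableAt_clm_apply₂ hd.differentiableAt (hTc Y) (hTc Z)) hDD, add_apply, add_apply,
      fderiv_clm_apply₂ hd.differentiableAt (hTc Y) (hTc Z), hd.fderiv,
      fderiv_clm_apply_const hT, fderiv_clm_apply_const hT,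
      fderiv_clm_apply_const₂ hTT] at h2
    simp only [ContinuousLinearMap.comp_apply, ContinuousLinearMap.flip_apply,
      fderiv_clm_apply_const₂ hC'] at h2
    rw [add_comm] at h2
    exact h2
  have h1 := key X Y Z
  have h2 := key Y X Z
  rw [hh'.riemann_eq hu, hh.riemann_eq (hmaps hu)]
  simp only [map_add, map_sub, hΓ]
  rw [← eq_sub_iff_add_eq'] at h1 h2
  rw [h1, h2, fderiv_fderiv_symm hTs X Y, fderiv_fderiv_symm hφu X Y]
  abel

end Naturality

/-! ### Parallel sections of flat linear connections -/

section Frobenius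

variable {E F : Type*} [NormedAddCommGroup E] [NormedSpace ℝ E]
  [NormedAddCommGroup F] [NormedSpace ℝ F]

/-- Grönwall's inequality on the unit interval with Lipschitz constant `1`, using `e ≤ 3`. -/
theorem norm_le_of_deriv_unitInterval {w w' : ℝ → F} {δ η : ℝ} (hη : 0 ≤ η) (h0 : ‖w 0‖ ≤ δ)
    (hw : ∀ t ∈ Icc (0 : ℝ) 1, HasDerivWithinAt w (w' t) (Icc 0 1) t)
    (hb : ∀ t ∈ Icc (0 : ℝ) 1, ‖w' t‖ ≤ ‖w t‖ + η) {t : ℝ} (ht : t ∈ Icc (0 : ℝ) 1) :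
    ‖w t‖ ≤ 3 * δ + 2 * η := by
  have hδ : 0 ≤ δ := (norm_nonneg _).trans h0
  have := norm_le_gronwallBound_of_norm_deriv_right_le (f := w) (f' := w') (δ := δ) (K := 1)
    (ε := η) (a := 0) (b := 1) (fun t ht ↦ (hw t ht).continuousWithinAt)
    (fun t ht ↦ (hw t (Ico_subset_Icc_self ht)).mono_of_mem_nhdsWithin
      (Icc_mem_nhdsGE_of_mem ht)) h0
    (fun t ht ↦ by simpa using hb t (Ico_subset_Icc_self ht)) t ht
  refine this.trans ?_
  rw [gronwallBound_of_K_ne_0 one_ne_zero]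
  have he : Real.exp (1 * (t - 0)) ≤ 3 := by
    have : Real.exp (1 * (t - 0)) ≤ Real.exp 1 := Real.exp_le_exp.2 (by simpa using ht.2)
    exact this.trans (Real.exp_one_lt_d9.le.trans (by norm_num))
  have h1 := mul_le_mul_of_nonneg_left he hδ
  have h2 := mul_le_mul_of_nonneg_left he hη
  simp only [div_one]
  linarith

/-- With `‖a‖ ≤ 1/2`, the Picard–Lindelöf theorem applies on the whole unit interval, in the ball
of radius `‖v‖` around `v`. -/
theorem exists_linearODE_solution [CompleteSpace F] {a : ℝ → F →L[ℝ] F}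
    (ha : ContinuousOn a (Icc 0 1)) (hb : ∀ t ∈ Icc (0 : ℝ) 1, ‖a t‖ ≤ 1 / 2) (v : F) :
    ∃ α : ℝ → F, α 0 = v ∧
      ∀ t ∈ Icc (0 : ℝ) 1, HasDerivWithinAt α (a t (α t)) (Icc 0 1) t := by
  have hpl : IsPicardLindelof (fun t ↦ a t) (tmin := 0) (tmax := 1) ⟨0, by simp⟩ v
      ‖v‖₊ 0 ‖v‖₊ 1 := by
    refine ⟨fun t ht ↦ ?_, fun x _ ↦ ha.clm_apply continuousOn_const, fun t ht x hx ↦ ?_, ?_⟩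
    · refine LipschitzOnWith.of_dist_le_mul fun x _ y _ ↦ ?_
      rw [dist_eq_norm, dist_eq_norm, ← map_sub]
      refine ((a t).le_of_opNorm_le (hb t ht) _).trans ?_
      gcongr
      norm_num
    · refine ((a t).le_of_opNorm_le (hb t ht) _).trans ?_
      have : ‖x‖ ≤ ‖v‖ + ‖v‖ := by
        have h1 : ‖x - v‖ ≤ ‖v‖ := by simpa [dist_eq_norm] using hx
        calc ‖x‖ = ‖v + (x - v)‖ := by simp
          _ ≤ _ := (norm_add_le _ _).trans (by gcongr)
      simp only [coe_nnnorm]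
      linarith
    · simp
  exact hpl.exists_eq_forall_mem_Icc_hasDerivWithinAt₀

/-- Uniform first- and second-order Taylor estimates for a smooth map near a point. The domain need
not be locally compact: the bounds come from continuity of the derivatives at `x₀`. -/
theorem exists_taylor_bounds {G : Type*} [NormedAddCommGroup G] [NormedSpace ℝ G] {A : E → G}
    {x₀ : E} (hA : ContDiffAt ℝ ∞ A x₀) :
    ∃ ρ > 0, ∃ K ≥ 0, ∀ u ∈ Metric.ball x₀ ρ, ‖A u‖ ≤ K ∧ DifferentiableAt ℝ A u ∧
      ∀ u' ∈ Metric.ball x₀ ρ, ‖A u' - A u‖ ≤ K * ‖u' - u‖ ∧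
        ‖A u' - A u - fderiv ℝ A u (u' - u)‖ ≤ K * ‖u' - u‖ ^ 2 := by
  have h1 : ContDiffAt ℝ ∞ (fderiv ℝ A) x₀ := hA.fderiv_right (by simp)
  have h2 : ContDiffAt ℝ ∞ (fderiv ℝ (fderiv ℝ A)) x₀ := h1.fderiv_right (by simp)
  set K := max (‖A x₀‖ + 1) (max (‖fderiv ℝ A x₀‖ + 1) (‖fderiv ℝ (fderiv ℝ A) x₀‖ + 1))
  have e0 : ∀ᶠ u in 𝓝 x₀, ‖A u‖ < ‖A x₀‖ + 1 :=
    hA.continuousAt.norm.eventually_lt_const (lt_add_one _)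
  have e1 : ∀ᶠ u in 𝓝 x₀, ‖fderiv ℝ A u‖ < ‖fderiv ℝ A x₀‖ + 1 :=
    h1.continuousAt.norm.eventually_lt_const (lt_add_one _)
  have e2 : ∀ᶠ u in 𝓝 x₀, ‖fderiv ℝ (fderiv ℝ A) u‖ < ‖fderiv ℝ (fderiv ℝ A) x₀‖ + 1 :=
    h2.continuousAt.norm.eventually_lt_const (lt_add_one _)
  have d0 : ∀ᶠ u in 𝓝 x₀, ContDiffAt ℝ 1 A u :=
    (hA.of_le ENat.LEInfty.out).eventually (by simp)
  have d1 : ∀ᶠ u in 𝓝 x₀, ContDiffAt ℝ 1 (fderiv ℝ A) u :=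
    (h1.of_le ENat.LEInfty.out).eventually (by simp)
  obtain ⟨ρ, hρ, hball⟩ := Metric.eventually_nhds_iff_ball.1
    ((e0.and e1).and (e2.and (d0.and d1)))
  have hK : ‖A x₀‖ + 1 ≤ K ∧ ‖fderiv ℝ A x₀‖ + 1 ≤ K ∧ ‖fderiv ℝ (fderiv ℝ A) x₀‖ + 1 ≤ K := by
    simp [K]
  refine ⟨ρ, hρ, K, by linarith [norm_nonneg (A x₀)], fun u hu ↦ ?_⟩
  have hdA (u) (hu : u ∈ Metric.ball x₀ ρ) : DifferentiableAt ℝ A u :=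
    (hball u hu).2.2.1.differentiableAt (by simp)
  have hdA' (u) (hu : u ∈ Metric.ball x₀ ρ) : DifferentiableAt ℝ (fderiv ℝ A) u :=
    (hball u hu).2.2.2.differentiableAt (by simp)
  have hconv := convex_ball x₀ ρ
  refine ⟨(hball u hu).1.1.le.trans hK.1, hdA u hu, fun u' hu' ↦ ⟨?_, ?_⟩⟩
  · exact hconv.norm_image_sub_le_of_norm_fderiv_le hdA
      (fun x hx ↦ (hball x hx).1.2.le.trans hK.2.1) hu hu'
  · have hseg : segment ℝ u u' ⊆ Metric.ball x₀ ρ := hconv.segment_subset hu hu'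
    have := (convex_segment u u').norm_image_sub_le_of_norm_fderiv_le' (f := A)
      (φ := fderiv ℝ A u) (C := K * ‖u' - u‖) (fun x hx ↦ hdA x (hseg hx)) (fun x hx ↦ ?_)
      (left_mem_segment ℝ u u') (right_mem_segment ℝ u u')
    · rwa [mul_assoc, ← sq] at this
    · refine (hconv.norm_image_sub_le_of_norm_fderiv_le hdA'
        (fun x hx ↦ (hball x hx).2.1.le.trans hK.2.2) hu (hseg hx)).trans ?_
      gcongr
      obtain ⟨a, b, ha, hb, hab, rfl⟩ := hx
      have : a • u + b • u' - u = b • (u' - u) := by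
        rw [eq_sub_of_add_eq hab]; module
      rw [this, norm_smul, Real.norm_of_nonneg hb]
      exact mul_le_of_le_one_left (norm_nonneg _) (by linarith)

/-- Solutions of `dψ = A ψ` are smooth, by bootstrapping. -/
theorem contDiffOn_of_hasFDerivAt_linear {A : E → E →L[ℝ] F →L[ℝ] F} {B : Set E} (hB : IsOpen B)
    (hA : ContDiffOn ℝ ∞ A B) {ψ : E → F}
    (hψ : ∀ u ∈ B, HasFDerivAt ψ ((A u).flip (ψ u)) u) : ContDiffOn ℝ ∞ ψ B := by
  rw [contDiffOn_infty]
  intro n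
  induction n with
  | zero => exact contDiffOn_zero.2 fun u hu ↦ (hψ u hu).continuousAt.continuousWithinAt
  | succ n ih =>
    have : ((n + 1 : ℕ) : ℕ∞ω) = n + 1 := by norm_cast
    rw [this, contDiffOn_succ_iff_fderiv_of_isOpen hB]
    refine ⟨fun u hu ↦ (hψ u hu).differentiableAt.differentiableWithinAt, by simp, ?_⟩
    have hA' : ContDiffOn ℝ n (fun u ↦ (A u).flip) B :=
      (ContinuousLinearMap.flipₗᵢ ℝ E F F).toContinuousLinearEquiv.contDiff.comp_contDiffOn
        (hA.of_le (by exact_mod_cast le_top))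
    exact (hA'.clm_apply ih).congr fun u hu ↦ (hψ u hu).fderiv

/-- The linear case of the Frobenius theorem: a flat connection has parallel sections with any
prescribed value at a point. The section is obtained by parallel transport along the rays from
`x₀`. That it is parallel in all directions follows by comparing the transports `Ψ x`, `Ψ y` along
neighbouring rays with the Jacobi-type expansion `Ψ y t ≈ Ψ x t + t A(y - x) Ψ x t`: flatness makes
the defect satisfy a linear differential inequality with a source of size `‖y - x‖²`. -/
theorem exists_parallel_section [CompleteSpace F] {A : E → E →L[ℝ] F →L[ℝ] F} {s : Set E}
    (hs : IsOpen s) (hA : ContDiffOn ℝ ∞ A s)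
    (hflat : ∀ u ∈ s, ∀ X Y v, fderiv ℝ A u X Y v + A u Y (A u X v)
      = fderiv ℝ A u Y X v + A u X (A u Y v)) {x₀ : E} (hx₀ : x₀ ∈ s) (v : F) :
    ∃ r > 0, Metric.ball x₀ r ⊆ s ∧ ∃ ψ : E → F, ψ x₀ = v ∧
      ContDiffOn ℝ ∞ ψ (Metric.ball x₀ r) ∧
      ∀ u ∈ Metric.ball x₀ r, HasFDerivAt ψ ((A u).flip (ψ u)) u := by
  obtain ⟨ρ, hρ, K, hK, hbd⟩ := exists_taylor_bounds (hA.contDiffAt (hs.mem_nhds hx₀))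
  obtain ⟨ρ', hρ', hρs⟩ := Metric.isOpen_iff.1 hs x₀ hx₀
  -- the last bound makes `‖A u x‖ ≤ 1/2` for `‖x‖ < r`, as `exists_linearODE_solution` requires
  set r := min (min ρ ρ') (1 / (2 * (K + 1))) with hr
  have hr0 : 0 < r := by positivity
  have hrρ : r ≤ ρ := (min_le_left _ _).trans (min_le_left _ _)
  have hrs : Metric.ball x₀ r ⊆ s :=
    (Metric.ball_subset_ball ((min_le_left _ _).trans (min_le_right _ _))).trans hρs
  have hrK : K * r ≤ 1 / 2 := by
    have : r ≤ 1 / (2 * (K + 1)) := min_le_right _ _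
    rw [le_div_iff₀ (by positivity)] at this
    nlinarith
  have hr1 : r ≤ 1 := by
    have : r ≤ 1 / (2 * (K + 1)) := min_le_right _ _
    rw [le_div_iff₀ (by positivity)] at this
    nlinarith
  have hγ (x : E) (hx : ‖x‖ < r) (t : ℝ) (ht : t ∈ Icc (0 : ℝ) 1) :
      x₀ + t • x ∈ Metric.ball x₀ r := by
    rw [mem_ball_iff_norm, add_sub_cancel_left, norm_smul, Real.norm_of_nonneg ht.1]
    exact (mul_le_of_le_one_left (norm_nonneg _) ht.2).trans_lt hx
  have hγρ (x : E) (hx : ‖x‖ < r) (t : ℝ) (ht : t ∈ Icc (0 : ℝ) 1) :=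
    hbd _ (Metric.ball_subset_ball hrρ (hγ x hx t ht))
  have hγd (x : E) (t : ℝ) : HasDerivWithinAt (fun t : ℝ ↦ x₀ + t • x) x (Icc 0 1) t := by
    simpa using ((hasDerivAt_id t).smul_const x).const_add x₀ |>.hasDerivWithinAt
  have hex (x : E) : ∃ α : ℝ → F, ‖x‖ < r → α 0 = v ∧ ∀ t ∈ Icc (0 : ℝ) 1,
      HasDerivWithinAt α (A (x₀ + t • x) x (α t)) (Icc 0 1) t := by
    by_cases hx : ‖x‖ < r
    · obtain ⟨α, hα⟩ := exists_linearODE_solution (a := fun t ↦ A (x₀ + t • x) x)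
        (fun t ht ↦ by
          have := ((hγρ x hx t ht).2.1.continuousAt.comp_continuousWithinAt
            (f := fun t : ℝ ↦ x₀ + t • x) (hγd x t).continuousWithinAt)
          exact this.clm_apply continuousWithinAt_const)
        (fun t ht ↦ by
          refine ((A _).le_of_opNorm_le (hγρ x hx t ht).1 x).trans ?_
          exact (mul_le_mul_of_nonneg_left hx.le hK).trans hrK) v
      exact ⟨α, fun _ ↦ hα⟩
    · exact ⟨0, fun h ↦ absurd h hx⟩
  choose Ψ hΨ using hex
  have ha (x : E) (hx : ‖x‖ < r) (t : ℝ) (ht : t ∈ Icc (0 : ℝ) 1) (z : F) :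
      ‖A (x₀ + t • x) x z‖ ≤ ‖z‖ := by
    have h1 : ‖A (x₀ + t • x) x‖ ≤ 1 := by
      refine ((A _).le_of_opNorm_le (hγρ x hx t ht).1 x).trans ?_
      exact ((mul_le_mul_of_nonneg_left hx.le hK).trans hrK).trans (by norm_num)
    simpa using ContinuousLinearMap.le_of_opNorm_le _ h1 z
  set M := 3 * ‖v‖ with hM
  have hM0 : 0 ≤ M := by positivity
  have hΨM (x : E) (hx : ‖x‖ < r) (t : ℝ) (ht : t ∈ Icc (0 : ℝ) 1) : ‖Ψ x t‖ ≤ M := by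
    have := norm_le_of_deriv_unitInterval le_rfl (by rw [(hΨ x hx).1]) (hΨ x hx).2
      (fun t ht ↦ by simpa using ha x hx t ht _) ht
    simpa using this
  -- the second-order comparison of the transports along the rays through `x` and `y`
  have key (x y : E) (hx : ‖x‖ < r) (hy : ‖y‖ < r) :
      ‖Ψ y 1 - Ψ x 1 - A (x₀ + x) (y - x) (Ψ x 1)‖
        ≤ (2 * (2 * K * M + 2 * K * (4 * K * M))) * ‖y - x‖ ^ 2 := by
    set d := y - x with hd
    have hsub (t : ℝ) : x₀ + t • y - (x₀ + t • x) = t • d := by rw [hd]; module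
    have htd (t : ℝ) (ht : t ∈ Icc (0 : ℝ) 1) : ‖t • d‖ ≤ ‖d‖ := by
      rw [norm_smul, Real.norm_of_nonneg ht.1]
      exact mul_le_of_le_one_left (norm_nonneg _) ht.2
    have hA1 (t : ℝ) (ht : t ∈ Icc (0 : ℝ) 1) :
        ‖A (x₀ + t • y) - A (x₀ + t • x)‖ ≤ K * ‖d‖ := by
      have := ((hγρ x hx t ht).2.2 _ (Metric.ball_subset_ball hrρ (hγ y hy t ht))).1
      rw [hsub] at this
      exact this.trans (mul_le_mul_of_nonneg_left (htd t ht) hK)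
    have hA2 (t : ℝ) (ht : t ∈ Icc (0 : ℝ) 1) :
        ‖A (x₀ + t • y) - A (x₀ + t • x) - fderiv ℝ A (x₀ + t • x) (t • d)‖ ≤ K * ‖d‖ ^ 2 := by
      have := ((hγρ x hx t ht).2.2 _ (Metric.ball_subset_ball hrρ (hγ y hy t ht))).2
      rw [hsub] at this
      exact this.trans (mul_le_mul_of_nonneg_left
        (pow_le_pow_left₀ (norm_nonneg _) (htd t ht) 2) hK)
    have hdiff (t : ℝ) (ht : t ∈ Icc (0 : ℝ) 1) :
        ‖A (x₀ + t • y) y - A (x₀ + t • x) x‖ ≤ 2 * K * ‖d‖ := by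
      have : A (x₀ + t • y) y - A (x₀ + t • x) x
          = (A (x₀ + t • y) - A (x₀ + t • x)) y + A (x₀ + t • x) d := by
        rw [hd]; simp
      rw [this]
      refine (norm_add_le _ _).trans ?_
      have h1 := ((A (x₀ + t • y) - A (x₀ + t • x)).le_of_opNorm_le (hA1 t ht) y)
      have h2 := (A (x₀ + t • x)).le_of_opNorm_le (hγρ x hx t ht).1 d
      have h3 : K * ‖d‖ * ‖y‖ ≤ K * ‖d‖ :=
        mul_le_of_le_one_right (by positivity) (hy.le.trans hr1)
      linarith
    have hw1 (t : ℝ) (ht : t ∈ Icc (0 : ℝ) 1) : ‖Ψ y t - Ψ x t‖ ≤ 4 * K * M * ‖d‖ := by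
      have := norm_le_of_deriv_unitInterval (w := fun t ↦ Ψ y t - Ψ x t) (δ := 0)
        (η := 2 * K * ‖d‖ * M) (by positivity) (by simp [(hΨ x hx).1, (hΨ y hy).1])
        (fun t ht ↦ ((hΨ y hy).2 t ht).sub ((hΨ x hx).2 t ht)) (fun t ht ↦ ?_) ht
      · refine this.trans (le_of_eq ?_)
        ring
      · have h1 : A (x₀ + t • y) y (Ψ y t) - A (x₀ + t • x) x (Ψ x t)
            = A (x₀ + t • x) x (Ψ y t - Ψ x t)
              + (A (x₀ + t • y) y - A (x₀ + t • x) x) (Ψ y t) := by simp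
        rw [h1]
        refine (norm_add_le _ _).trans (add_le_add (ha x hx t ht _) ?_)
        exact (ContinuousLinearMap.le_of_opNorm_le_of_le _ (hdiff t ht) (hΨM y hy t ht))
    have hw2 := norm_le_of_deriv_unitInterval
      (w := fun t ↦ Ψ y t - Ψ x t - t • A (x₀ + t • x) d (Ψ x t)) (δ := 0)
      (η := (2 * K * M + 2 * K * (4 * K * M)) * ‖d‖ ^ 2)
      (w' := fun t ↦ A (x₀ + t • y) y (Ψ y t) - A (x₀ + t • x) x (Ψ x t)
        - (t • (fderiv ℝ A (x₀ + t • x) x d (Ψ x t)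
          + A (x₀ + t • x) d (A (x₀ + t • x) x (Ψ x t))) + A (x₀ + t • x) d (Ψ x t)))
      (by positivity) (by simp [(hΨ x hx).1, (hΨ y hy).1])
      (fun t ht ↦ ?_) (fun t ht ↦ ?_) (right_mem_Icc.2 zero_le_one)
    · simp only [one_smul] at hw2
      refine hw2.trans (le_of_eq ?_)
      ring
    · have hAt : HasDerivWithinAt (fun t : ℝ ↦ A (x₀ + t • x))
          (fderiv ℝ A (x₀ + t • x) x) (Icc 0 1) t :=
        (hγρ x hx t ht).2.1.hasFDerivAt.comp_hasDerivWithinAt t (hγd x t)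
      have h1 : HasDerivWithinAt (fun t : ℝ ↦ A (x₀ + t • x) d (Ψ x t))
          (fderiv ℝ A (x₀ + t • x) x d (Ψ x t)
          + A (x₀ + t • x) d (A (x₀ + t • x) x (Ψ x t))) (Icc 0 1) t := by
        have h2 := hAt.clm_apply (hasDerivWithinAt_const t (Icc (0 : ℝ) 1) d)
        simpa using h2.clm_apply ((hΨ x hx).2 t ht)
      have h3 := (hasDerivWithinAt_id t (Icc (0 : ℝ) 1)).smul h1
      simp only [one_smul, id] at h3
      exact (((hΨ y hy).2 t ht).sub ((hΨ x hx).2 t ht)).sub h3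
    · -- by flatness the terms of first order in `d` cancel
      have hfl := hflat _ (hrs (hγ x hx t ht)) x d (Ψ x t)
      have h1 : A (x₀ + t • y) y (Ψ y t) - A (x₀ + t • x) x (Ψ x t)
          - (t • (fderiv ℝ A (x₀ + t • x) x d (Ψ x t)
          + A (x₀ + t • x) d (A (x₀ + t • x) x (Ψ x t))) + A (x₀ + t • x) d (Ψ x t))
          = A (x₀ + t • x) x (Ψ y t - Ψ x t - t • A (x₀ + t • x) d (Ψ x t))
          + (((A (x₀ + t • y) - A (x₀ + t • x) - fderiv ℝ A (x₀ + t • x) (t • d)) x (Ψ x t)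
            + (A (x₀ + t • y) - A (x₀ + t • x)) d (Ψ x t))
          + (A (x₀ + t • y) y - A (x₀ + t • x) x) (Ψ y t - Ψ x t)) := by
        rw [hfl]
        have hyx : y = x + d := by rw [hd]; abel
        rw [hyx]
        simp only [map_add, map_sub, map_smul, add_apply, sub_apply, smul_apply]
        module
      rw [h1]
      refine (norm_add_le _ _).trans (add_le_add (ha x hx t ht _) ?_)
      have b1 := ContinuousLinearMap.le_of_opNorm_le_of_le _
        ((ContinuousLinearMap.le_of_opNorm_le_of_le _ (hA2 t ht) (hx.le.trans hr1)))
        (hΨM x hx t ht)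
      have b2 := ContinuousLinearMap.le_of_opNorm_le_of_le _
        ((ContinuousLinearMap.le_of_opNorm_le_of_le _ (hA1 t ht) (le_refl ‖d‖)))
        (hΨM x hx t ht)
      have b3 := ContinuousLinearMap.le_of_opNorm_le_of_le _ (hdiff t ht) (hw1 t ht)
      refine (norm_add_le _ _).trans ((add_le_add ((norm_add_le _ _).trans (add_le_add b1 b2))
        b3).trans (le_of_eq ?_))
      ring
  have hfd : ∀ u ∈ Metric.ball x₀ r,
      HasFDerivAt (fun u ↦ Ψ (u - x₀) 1) ((A u).flip (Ψ (u - x₀) 1)) u := by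
    intro u hu
    have hO : (fun u' ↦ Ψ (u' - x₀) 1 - Ψ (u - x₀) 1 - (A u).flip (Ψ (u - x₀) 1) (u' - u))
        =O[𝓝 u] fun u' ↦ ‖u' - u‖ ^ 2 := by
      refine Asymptotics.IsBigO.of_bound (2 * (2 * K * M + 2 * K * (4 * K * M))) ?_
      filter_upwards [Metric.isOpen_ball.mem_nhds hu] with u' hu'
      have := key (u - x₀) (u' - x₀) (mem_ball_iff_norm.1 hu) (mem_ball_iff_norm.1 hu')
      simpa using this
    have h1 := (hO.hasFDerivAt (by norm_num)).add
      (((A u).flip (Ψ (u - x₀) 1)).hasFDerivAt.comp u ((hasFDerivAt_id u).sub_const u))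
    have h2 := h1.add_const (Ψ (u - x₀) 1)
    convert h2 using 1
    · ext u'
      simp
    · ext; simp
  refine ⟨r, hr0, hrs, fun u ↦ Ψ (u - x₀) 1, ?_,
    contDiffOn_of_hasFDerivAt_linear Metric.isOpen_ball (hA.mono hrs) hfd, hfd⟩
  -- the transport along the constant ray is constant
  have h0 : ‖(0 : E)‖ < r := by simpa
  have := norm_le_of_deriv_unitInterval (w := fun t ↦ Ψ 0 t - v) (δ := 0) le_rfl
    (by simp [(hΨ 0 h0).1]) (fun t ht ↦ ((hΨ 0 h0).2 t ht).sub_const v) (fun t ht ↦ by simp)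
    (right_mem_Icc.2 zero_le_one)
  simpa [sub_eq_zero] using this

end Frobenius

/-! ### Conformal factors on a space of constant curvature -/

section HessianEquation

variable {E : Type*} [NormedAddCommGroup E] [NormedSpace ℝ E]
  {h : E → E →L[ℝ] E →L[ℝ] ℝ} {s : Set E}

/-- The connection on the bundle of pairs `(φ, α)` of a function and a 1-form whose parallel
sections are the pairs `(φ, dφ)` with `Hess φ = -k φ h`:
`dψ(X) = A X ψ` with `A X (φ, α) = (α X, α ∘ Γ X - k φ h X)`. -/
noncomputable def hessConnection (h : E → E →L[ℝ] E →L[ℝ] ℝ) (k : ℝ) (u : E) :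
    E →L[ℝ] (ℝ × (E →L[ℝ] ℝ)) →L[ℝ] (ℝ × (E →L[ℝ] ℝ)) :=
  (((ContinuousLinearMap.compL ℝ _ _ _ (.inl ℝ ℝ (E →L[ℝ] ℝ))) ∘L
    (ContinuousLinearMap.compL ℝ _ _ _).flip (.snd ℝ ℝ (E →L[ℝ] ℝ))) ∘L
      ContinuousLinearMap.apply ℝ ℝ)
  + ((ContinuousLinearMap.compL ℝ _ _ _ (.inr ℝ ℝ (E →L[ℝ] ℝ))) ∘L
      (ContinuousLinearMap.compL ℝ _ _ _).flip (.snd ℝ ℝ (E →L[ℝ] ℝ)) ∘L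
      (ContinuousLinearMap.compL ℝ E E ℝ).flip) ∘L christoffelL h u
  - k • (((ContinuousLinearMap.compL ℝ _ _ _ (.inr ℝ ℝ (E →L[ℝ] ℝ))) ∘L
      ContinuousLinearMap.smulRightL ℝ _ _ (.fst ℝ ℝ (E →L[ℝ] ℝ))) ∘L h u)

theorem hessConnection_apply (h : E → E →L[ℝ] E →L[ℝ] ℝ) (k : ℝ) (u X : E)
    (v : ℝ × (E →L[ℝ] ℝ)) : hessConnection h k u X v
      = (v.2 X, v.2 ∘L christoffelL h u X - (k * v.1) • h u X) := by
  simp only [hessConnection, add_apply, sub_apply, smul_apply, ContinuousLinearMap.comp_apply,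
    ContinuousLinearMap.compL_apply, ContinuousLinearMap.flip_apply]
  ext
  · simp
  · simp; ring

variable [CompleteSpace E]

theorem IsMetricOn.contDiffOn_hessConnection (hh : IsMetricOn h s) (k : ℝ) :
    ContDiffOn ℝ ∞ (hessConnection h k) s := by
  have hC : ContDiffOn ℝ ∞ (christoffelL h) s :=
    fun u hu ↦ (hh.contDiffAt_christoffelL hu).contDiffWithinAt
  exact (contDiffOn_const.add (contDiffOn_const.clm_comp hC)).sub
    ((contDiffOn_const.clm_comp hh.smooth).const_smul k)

theorem IsMetricOn.fderiv_hessConnection (hh : IsMetricOn h s) (k : ℝ) {u : E} (hu : u ∈ s)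
    (X Y : E) (v : ℝ × (E →L[ℝ] ℝ)) : fderiv ℝ (hessConnection h k) u X Y v
      = (0, v.2 ∘L fderiv ℝ (christoffelL h) u X Y - (k * v.1) • fderiv ℝ h u X Y) := by
  have hd := ((hh.contDiffOn_hessConnection k).contDiffAt (hh.isOpen.mem_nhds hu)).differentiableAt
    (by simp)
  have hC := hh.differentiableAt_christoffelL hu
  have hh' := hh.differentiableAt hu
  rw [← fderiv_clm_apply_const₂ hd]
  simp only [hessConnection_apply]
  have h1 : DifferentiableAt ℝ (fun u' ↦ christoffelL h u' Y) u := by fun_prop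
  have h2 : DifferentiableAt ℝ (fun u' ↦ h u' Y) u := by fun_prop
  have h3 : HasFDerivAt (fun u' ↦ v.2 ∘L christoffelL h u' Y) _ u :=
    (ContinuousLinearMap.compL ℝ E E ℝ v.2).hasFDerivAt.comp u h1.hasFDerivAt
  have h4 := (hasFDerivAt_const (v.2 Y) u).prodMk (h3.sub (h2.hasFDerivAt.const_smul (k * v.1)))
  refine (congrArg (fun L : E →L[ℝ] ℝ × (E →L[ℝ] ℝ) ↦ L X) h4.fderiv).trans ?_
  simp [fderiv_clm_apply_const hC, fderiv_clm_apply_const hh']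

/-- On a space of constant curvature `k` the connection `hessConnection h k` is flat, so that
`Hess φ = -k φ h` has local solutions with arbitrary initial value and differential. -/
theorem IsMetricOn.exists_hess_eq (hh : IsMetricOn h s) {k : ℝ}
    (hR : ∀ u ∈ s, ∀ X Y Z, riemann h u X Y Z = k • (h u Y Z • X - h u X Z • Y)) {x₀ : E}
    (hx₀ : x₀ ∈ s) (c : ℝ) (α : E →L[ℝ] ℝ) :
    ∃ r > 0, Metric.ball x₀ r ⊆ s ∧ ∃ φ : E → ℝ, ContDiffOn ℝ ∞ φ (Metric.ball x₀ r) ∧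
      φ x₀ = c ∧ fderiv ℝ φ x₀ = α ∧
      ∀ u ∈ Metric.ball x₀ r, ∀ X Y, metricHess h φ u X Y = -(k * φ u) * h u X Y := by
  have hflat : ∀ u ∈ s, ∀ (X Y : E) (v : ℝ × (E →L[ℝ] ℝ)),
      fderiv ℝ (hessConnection h k) u X Y v + hessConnection h k u Y (hessConnection h k u X v)
        = fderiv ℝ (hessConnection h k) u Y X v
          + hessConnection h k u X (hessConnection h k u Y v) := by
    intro u hu X Y v
    rw [hh.fderiv_hessConnection k hu, hh.fderiv_hessConnection k hu]
    simp only [hessConnection_apply]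
    ext Z
    · simp [hh.christoffelL_symm hu X Y, hh.symm u hu X Y]
    · have h1 := congrArg v.2 (hR u hu X Y Z)
      rw [hh.riemann_eq hu] at h1
      simp only [map_add, map_sub, map_smul, smul_eq_mul] at h1
      simp [hh.metric_compat hu, hh.christoffelL_symm hu X Y]
      linear_combination h1
  obtain ⟨r, hr, hrs, ψ, hψ₀, hψs, hψ⟩ := exists_parallel_section hh.isOpen
    (hh.contDiffOn_hessConnection k) hflat hx₀ (c, α)
  have hφ (u) (hu : u ∈ Metric.ball x₀ r) : fderiv ℝ (fun u ↦ (ψ u).1) u = (ψ u).2 := by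
    ext X
    have : HasFDerivAt (fun u ↦ (ψ u).1) _ u := hasFDerivAt_fst.comp u (hψ u hu)
    rw [this.fderiv]
    simp [hessConnection_apply]
  refine ⟨r, hr, hrs, fun u ↦ (ψ u).1, hψs.fst, by simp [hψ₀],
    by rw [hφ _ (Metric.mem_ball_self hr), hψ₀], fun u hu X Y ↦ ?_⟩
  have h1 : fderiv ℝ (fun u ↦ (ψ u).1) =ᶠ[𝓝 u] fun u ↦ (ψ u).2 := by
    filter_upwards [Metric.isOpen_ball.mem_nhds hu] with u' hu'
    exact hφ u' hu'
  have h2 : HasFDerivAt (fun u ↦ (ψ u).2) _ u := hasFDerivAt_snd.comp u (hψ u hu)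
  rw [metricHess, h1.fderiv_eq, hφ u hu, h2.fderiv]
  simp [hessConnection_apply]

/-- `|dφ|² + k φ²` is a first integral of the equation `Hess φ = -k φ h`. -/
theorem IsMetricOn.hasFDerivAt_firstIntegral (hh : IsMetricOn h s) {k : ℝ} {φ : E → ℝ}
    (hφ : ContDiffOn ℝ ∞ φ s)
    (hH : ∀ u ∈ s, ∀ X Y, metricHess h φ u X Y = -(k * φ u) * h u X Y) {u : E} (hu : u ∈ s) :
    HasFDerivAt (fun u ↦ fderiv ℝ φ u (metricGrad h φ u) + k * φ u ^ 2) (0 : E →L[ℝ] ℝ) u := by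
  have hφu := hφ.contDiffAt (hh.isOpen.mem_nhds hu)
  have hd : DifferentiableAt ℝ (fderiv ℝ φ) u :=
    (hφu.fderiv_right (m := ∞) (by simp)).differentiableAt (by simp)
  have hN := hh.differentiableAt_metricGrad hφ hu
  have h1 := (hd.hasFDerivAt.clm_apply hN.hasFDerivAt).add
    (((hφu.differentiableAt (by simp)).hasFDerivAt.pow 2).const_mul k)
  refine HasFDerivAt.congr_fderiv h1 ?_
  ext X
  have h2 := hh.h_fderiv_metricGrad hφ hu X (metricGrad h φ u)
  have h3 := hH u hu X (metricGrad h φ u)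
  rw [map_add, add_apply, hh.symm u hu _ (metricGrad h φ u), hh.h_metricGrad hu,
    hh.symm u hu _ (metricGrad h φ u), hh.h_metricGrad hu] at h2
  rw [hh.symm u hu, hh.h_metricGrad hu] at h3
  have h4 : metricHess h φ u X (metricGrad h φ u) = fderiv ℝ (fderiv ℝ φ) u X (metricGrad h φ u)
    - fderiv ℝ φ u (christoffelL h u X (metricGrad h φ u)) := rfl
  simp
  linear_combination 2 * h3 - h4 + h2

/-- On an indefinite space of constant curvature `k`, the equation `Hess φ = -k φ h` has positive
local solutions with `|dφ|² = -k φ²`: since `|dφ|² + k φ²` is a first integral, it suffices to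
prescribe `φ(x₀) = 1` and a gradient of square norm `-k` at `x₀`, which exists because `h` is
indefinite. -/
theorem IsMetricOn.exists_conformal_factor (hh : IsMetricOn h s) {k : ℝ}
    (hR : ∀ u ∈ s, ∀ X Y Z, riemann h u X Y Z = k • (h u Y Z • X - h u X Z • Y)) {x₀ : E}
    (hx₀ : x₀ ∈ s) (hpos : ∃ v, 0 < h x₀ v v) (hneg : ∃ v, h x₀ v v < 0) :
    ∃ r > 0, Metric.ball x₀ r ⊆ s ∧ ∃ φ : E → ℝ, ContDiffOn ℝ ∞ φ (Metric.ball x₀ r) ∧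
      ∀ u ∈ Metric.ball x₀ r, 0 < φ u ∧
        (∀ X Y, metricHess h φ u X Y = -(k * φ u) * h u X Y) ∧
        fderiv ℝ φ u (metricGrad h φ u) = -k * φ u ^ 2 := by
  have hN₀ : ∃ N, h x₀ N N = -k := by
    have scale (v : E) (hv : h x₀ v v ≠ 0) (hk : 0 ≤ -k / h x₀ v v) : ∃ N, h x₀ N N = -k := by
      refine ⟨Real.sqrt (-k / h x₀ v v) • v, ?_⟩
      simp only [map_smul, smul_apply, smul_eq_mul]
      rw [← mul_assoc, Real.mul_self_sqrt hk, div_mul_cancel₀ _ hv]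
    obtain ⟨v, hv⟩ := hpos
    obtain ⟨w, hw⟩ := hneg
    rcases le_total k 0 with hk | hk
    · exact scale v hv.ne' (div_nonneg (by linarith) hv.le)
    · exact scale w hw.ne (div_nonneg_of_nonpos (by linarith) hw.le)
  obtain ⟨N, hN⟩ := hN₀
  obtain ⟨r, hr, hrs, φ, hφ, hφ₀, hdφ, hH⟩ := hh.exists_hess_eq hR hx₀ 1 (h x₀ N)
  have hx₀r := Metric.mem_ball_self (x := x₀) hr
  have hcont : ContinuousAt φ x₀ :=
    (hφ.contDiffAt (Metric.isOpen_ball.mem_nhds hx₀r)).continuousAt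
  obtain ⟨r', hr', hpos'⟩ := Metric.eventually_nhds_iff_ball.1
    (hcont.eventually_const_lt (u := 0) (by simp [hφ₀]))
  have hB : IsMetricOn h (Metric.ball x₀ r) :=
    ⟨Metric.isOpen_ball, hh.smooth.mono hrs, fun u hu ↦ hh.symm u (hrs hu),
      fun u hu ↦ hh.inv u (hrs hu)⟩
  have hmin₁ : Metric.ball x₀ (min r r') ⊆ Metric.ball x₀ r :=
    Metric.ball_subset_ball (min_le_left _ _)
  refine ⟨min r r', lt_min hr hr', hmin₁.trans hrs, φ, hφ.mono hmin₁, fun u hu ↦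
    ⟨hpos' u (Metric.ball_subset_ball (min_le_right _ _) hu), hH u (hmin₁ hu), ?_⟩⟩
  have hfi (u) (hu : u ∈ Metric.ball x₀ r) := hB.hasFDerivAt_firstIntegral hφ hH hu
  have hconst := Metric.isOpen_ball.is_const_of_fderiv_eq_zero (𝕜 := ℝ)
    (convex_ball x₀ r).isPreconnected
    (fun u hu ↦ (hfi u hu).differentiableAt.differentiableWithinAt)
    (fun u hu ↦ (hfi u hu).fderiv) (hmin₁ hu) hx₀r
  have hg : metricGrad h φ x₀ = N := by
    apply hh.nondeg hx₀
    intro Z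
    rw [hh.h_metricGrad hx₀, hdφ]
  simp only [hφ₀, hg, hdφ, hN] at hconst
  linarith

end HessianEquation

section FlatProduct

variable {E₁ E₂ : Type*} [NormedAddCommGroup E₁] [NormedSpace ℝ E₁]
  [NormedAddCommGroup E₂] [NormedSpace ℝ E₂] [FiniteDimensional ℝ E₁] [FiniteDimensional ℝ E₂]
  {ε : ℝ} {h₁ : E₁ → E₁ →L[ℝ] E₁ →L[ℝ] ℝ} {h₂ : E₂ → E₂ →L[ℝ] E₂ →L[ℝ] ℝ}
  {s₁ : Set E₁} {s₂ : Set E₂}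

/-- If `h₁` and `ε h₂` have constant curvatures `k` and `-k`, and `Hess φ = -k φ h₁`,
`|dφ|² = -k φ²` on the first factor, then `φ⁻² (h₁ ⊕ ε h₂)` is flat. -/
theorem IsMetricOn.riemann_conformal_prod_eq_zero (hε : ε ≠ 0) (hh₁ : IsMetricOn h₁ s₁)
    (hh₂ : IsMetricOn h₂ s₂) {k : ℝ}
    (hR₁ : ∀ u ∈ s₁, ∀ X Y Z, riemann h₁ u X Y Z = k • (h₁ u Y Z • X - h₁ u X Z • Y))
    (hR₂ : ∀ u ∈ s₂, ∀ X Y Z,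
      riemann h₂ u X Y Z = (-(ε * k)) • (h₂ u Y Z • X - h₂ u X Z • Y))
    {φ : E₁ → ℝ} (hφ : ContDiffOn ℝ ∞ φ s₁) (hpos : ∀ u ∈ s₁, 0 < φ u)
    (hH : ∀ u ∈ s₁, ∀ X Y, metricHess h₁ φ u X Y = -(k * φ u) * h₁ u X Y)
    (hg : ∀ u ∈ s₁, fderiv ℝ φ u (metricGrad h₁ φ u) = -k * φ u ^ 2)
    {u : E₁ × E₂} (hu : u ∈ s₁ ×ˢ s₂) (X Y Z : E₁ × E₂) :
    riemann (fun u ↦ Real.exp (2 * -Real.log (φ u.1)) • prodMetric ε h₁ h₂ u) u X Y Z = 0 := by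
  have hh := hh₁.prod hε hh₂
  set f : E₁ × E₂ → ℝ := fun u ↦ -Real.log (φ u.1) with hf
  have hfs : ContDiffOn ℝ ∞ f (s₁ ×ˢ s₂) :=
    ((hφ.log fun u hu ↦ (hpos u hu).ne').comp contDiffOn_fst fun u hu ↦ hu.1).neg
  have hφd (u) (hu : u ∈ s₁) : DifferentiableAt ℝ φ u :=
    (hφ.contDiffAt (hh₁.isOpen.mem_nhds hu)).differentiableAt (by simp)
  have hdf (u) (hu : u ∈ s₁ ×ˢ s₂) (Y : E₁ × E₂) :
      fderiv ℝ f u Y = -((φ u.1)⁻¹ * fderiv ℝ φ u.1 Y.1) := by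
    have h1 : HasFDerivAt f _ u := (((hφd u.1 hu.1).hasFDerivAt.comp u hasFDerivAt_fst).log
      (hpos u.1 hu.1).ne').neg
    rw [h1.fderiv]
    simp
  have hφ0 := (hpos u.1 hu.1).ne'
  have hddf (X Y : E₁ × E₂) : fderiv ℝ (fderiv ℝ f) u X Y
      = (φ u.1 ^ 2)⁻¹ * fderiv ℝ φ u.1 X.1 * fderiv ℝ φ u.1 Y.1
        - (φ u.1)⁻¹ * fderiv ℝ (fderiv ℝ φ) u.1 X.1 Y.1 := by
    have hd : DifferentiableAt ℝ (fderiv ℝ f) u :=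
      ((hfs.contDiffAt (hh.isOpen.mem_nhds hu)).fderiv_right (m := ∞) (by simp)).differentiableAt
        (by simp)
    have hd' : DifferentiableAt ℝ (fderiv ℝ φ) u.1 :=
      ((hφ.contDiffAt (hh₁.isOpen.mem_nhds hu.1)).fderiv_right (m := ∞)
        (by simp)).differentiableAt (by simp)
    have h1 : (fun u' ↦ fderiv ℝ f u' Y) =ᶠ[𝓝 u]
        fun u' ↦ -((φ u'.1)⁻¹ * fderiv ℝ φ u'.1 Y.1) := by
      filter_upwards [hh.isOpen.mem_nhds hu] with u' hu'
      exact hdf u' hu' Y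
    have h2 : DifferentiableAt ℝ (fun u' ↦ fderiv ℝ φ u' Y.1) u.1 := by fun_prop
    have h3 := (((hasDerivAt_inv hφ0).comp_hasFDerivAt u ((hφd u.1 hu.1).hasFDerivAt.comp u
      hasFDerivAt_fst)).mul (h2.hasFDerivAt.comp u hasFDerivAt_fst)).neg
    rw [← fderiv_clm_apply_const hd, h1.fderiv_eq]
    refine (congrArg (fun L : E₁ × E₂ →L[ℝ] ℝ ↦ L X) h3.fderiv).trans ?_
    simp [fderiv_clm_apply_const hd']
    ring
  have hgrad : metricGrad (prodMetric ε h₁ h₂) f u = (-(φ u.1)⁻¹ • metricGrad h₁ φ u.1, 0) := by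
    apply hh.nondeg hu
    intro Z
    rw [hh.h_metricGrad hu, hdf u hu, prodMetric_apply]
    simp [hh₁.h_metricGrad hu.1]
  -- the change of the Schouten tensor is `(k/2) (h₁ - ε h₂)`, whose Kulkarni–Nomizu product with
  -- the product metric is the curvature of the latter
  have hS (X : E₁ × E₂) :
      schoutenChange (prodMetric ε h₁ h₂) f u X = ((k / 2) • X.1, -(k / 2) • X.2) := by
    apply hh.nondeg hu
    intro Z
    rw [hh.h_schoutenChange hfs hu, metricHess, hddf, hgrad, hdf u hu, hdf u hu, hdf u hu, hdf u hu,
      hh.christoffelL_apply hu, hh₁.christoffel_prod hε hh₂ hu, ← hh₁.christoffelL_apply hu.1]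
    have h1 := hH u.1 hu.1 X.1 Z.1
    have h2 := hg u.1 hu.1
    rw [metricHess, sub_eq_iff_eq_add] at h1
    simp only [h1, map_smul, smul_eq_mul, h2, prodMetric_apply, smul_apply]
    field_simp
    ring
  rw [hh.riemann_conformal hfs hu, hh₁.riemann_prod hε hh₂ hu, hR₁ u.1 hu.1, hR₂ u.2 hu.2]
  simp only [hS, prodMetric_apply, map_smul, smul_apply, smul_eq_mul]
  ext1
  · simp only [Prod.fst_sub, Prod.fst_add, Prod.smul_fst, Prod.fst_zero]
    module
  · simp only [Prod.snd_sub, Prod.snd_add, Prod.smul_snd, Prod.snd_zero]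
    module

end FlatProduct

/-! ### Tensor fields in charts -/

section Charts

variable {E : Type*} [NormedAddCommGroup E] [NormedSpace ℝ E]
  {H : Type*} [TopologicalSpace H] (I : ModelWithCorners ℝ E H)
  {M : Type*} [TopologicalSpace M] [ChartedSpace H M]

/-- The differential of the inverse of the chart at `p`: the coordinate frame of that chart, at the
point with coordinates `u`. -/
noncomputable def chartFrame (p : M) (u : E) : E →L[ℝ] E :=
  mfderivWithin 𝓘(ℝ, E) I (extChartAt I p).symm (range I) u

theorem chartForm_apply (B : FormField I M) (p : M) (u X Y : E) :
    chartForm I B p u X Y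
      = (B ((extChartAt I p).symm u) : E →L[ℝ] E →L[ℝ] ℝ) (chartFrame I p u X)
        (chartFrame I p u Y) := rfl

/-- The set of coordinates, in the chart at `q`, of the points in the domain of the chart
at `p`. -/
def overlap (p q : M) : Set E :=
  (extChartAt I q).target ∩ (extChartAt I q).symm ⁻¹' (extChartAt I p).source

theorem isOpen_overlap [I.Boundaryless] (p q : M) : IsOpen (overlap I p q) :=
  (continuousOn_extChartAt_symm q).isOpen_inter_preimage (isOpen_extChartAt_target q)
    (isOpen_extChartAt_source p)

variable [IsManifold I ∞ M]

theorem chartFrame_eq_tangentCoordChange {p x : M} (hx : x ∈ (extChartAt I p).source) :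
    chartFrame I p (extChartAt I p x) = tangentCoordChange I p x x := by
  rw [extChartAt_source] at hx
  have h1 := TangentBundle.symmL_trivializationAt (I := I) (𝕜 := ℝ) hx
  have h2 := TangentBundle.symmL_trivializationAt_eq_core (I := I) (𝕜 := ℝ) hx
  exact h1.symm.trans h2

theorem isInvertible_chartFrame {p : M} {u : E} (hu : u ∈ (extChartAt I p).target) :
    (chartFrame I p u).IsInvertible :=
  isInvertible_mfderivWithin_extChartAt_symm hu

theorem chartFrame_self (p : M) : chartFrame I p (extChartAt I p p) = .id ℝ E := by
  rw [chartFrame_eq_tangentCoordChange I (mem_extChartAt_source p)]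
  ext v
  exact tangentCoordChange_self (mem_extChartAt_source p)

theorem chartForm_self (B : FormField I M) (p : M) :
    chartForm I B p (extChartAt I p p) = (B p : E →L[ℝ] E →L[ℝ] ℝ) := by
  have h : ∀ x, x = p → (B x : E →L[ℝ] E →L[ℝ] ℝ) = B p := by rintro _ rfl; rfl
  ext X Y
  rw [chartForm_apply, chartFrame_self, h _ (extChartAt_to_inv p)]
  rfl

variable [I.Boundaryless]

theorem hasFDerivAt_transition {p q x : M} (hq : x ∈ (extChartAt I q).source)
    (hp : x ∈ (extChartAt I p).source) :
    HasFDerivAt (extChartAt I p ∘ (extChartAt I q).symm) (tangentCoordChange I q p x)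
      (extChartAt I q x) := by
  have := hasFDerivWithinAt_tangentCoordChange (I := I) ⟨hq, hp⟩
  rwa [I.range_eq_univ, hasFDerivWithinAt_univ] at this

theorem chartFrame_transition {p q : M} {u : E} (hu : u ∈ (extChartAt I q).target)
    (hp : (extChartAt I q).symm u ∈ (extChartAt I p).source) :
    chartFrame I q u = chartFrame I p (extChartAt I p ((extChartAt I q).symm u))
      ∘L fderiv ℝ (extChartAt I p ∘ (extChartAt I q).symm) u := by
  obtain ⟨x, hx, rfl⟩ : ∃ x ∈ (extChartAt I q).source, extChartAt I q x = u :=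
    ⟨_, (extChartAt I q).map_target hu, (extChartAt I q).right_inv hu⟩
  rw [(extChartAt I q).left_inv hx] at hp ⊢
  rw [chartFrame_eq_tangentCoordChange I hx, chartFrame_eq_tangentCoordChange I hp,
    (hasFDerivAt_transition I hx hp).fderiv]
  ext v
  exact (tangentCoordChange_comp ⟨⟨hx, hp⟩, mem_extChartAt_source x⟩).symm

theorem chartForm_transition (B : FormField I M) {p q : M} {u : E}
    (hu : u ∈ (extChartAt I q).target) (hp : (extChartAt I q).symm u ∈ (extChartAt I p).source)
    (X Y : E) :
    chartForm I B q u X Y = chartForm I B p (extChartAt I p ((extChartAt I q).symm u))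
      (fderiv ℝ (extChartAt I p ∘ (extChartAt I q).symm) u X)
      (fderiv ℝ (extChartAt I p ∘ (extChartAt I q).symm) u Y) := by
  have h : ∀ x y, x = y → (B x : E →L[ℝ] E →L[ℝ] ℝ) = B y := by rintro _ _ rfl; rfl
  rw [chartForm_apply, chartForm_apply, chartFrame_transition I hu hp,
    h _ _ ((extChartAt I p).left_inv hp)]
  rfl

theorem isInvertible_fderiv_transition {p q : M} {u : E} (hu : u ∈ (extChartAt I q).target)
    (hp : (extChartAt I q).symm u ∈ (extChartAt I p).source) :
    (fderiv ℝ (extChartAt I p ∘ (extChartAt I q).symm) u).IsInvertible := by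
  have h1 := isInvertible_chartFrame I hu
  obtain ⟨e, he⟩ := isInvertible_chartFrame I ((extChartAt I p).map_source hp)
  rw [chartFrame_transition I hu hp, ← he] at h1
  exact ContinuousLinearMap.isInvertible_equiv_comp.1 h1

theorem contDiffOn_transition (p q : M) :
    ContDiffOn ℝ ∞ (extChartAt I p ∘ (extChartAt I q).symm) (overlap I p q) := by
  intro u hu
  have h := contDiffWithinAt_ext_coord_change (I := I) (n := ∞) p q (y := u) (by
    rw [PartialEquiv.trans_source]
    exact hu)
  rw [I.range_eq_univ] at h
  exact h.mono (subset_univ _)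

end Charts

section Smoothness

variable {E : Type*} [NormedAddCommGroup E] [NormedSpace ℝ E]
  {H : Type*} [TopologicalSpace H] (I : ModelWithCorners ℝ E H)
  {M : Type*} [TopologicalSpace M] [ChartedSpace H M] [IsManifold I ∞ M]

/-- Mathlib's trivialization of the bundle of bilinear forms at `p` is the chart expression. -/
theorem trivializationAt_form_eq (B : FormField I M) {p x : M} (hx : x ∈ (chartAt H p).source) :
    (trivializationAt (E →L[ℝ] E →L[ℝ] ℝ)
      (fun x : M ↦ TangentSpace I x →L[ℝ] TangentSpace I x →L[ℝ] ℝ) p ⟨x, B x⟩).2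
      = chartForm I B p (extChartAt I p x) := by
  have h : ∀ y, y = x → (B y : E →L[ℝ] E →L[ℝ] ℝ) = B x := by rintro _ rfl; rfl
  have hT := TangentBundle.symmL_trivializationAt (I := I) (𝕜 := ℝ) hx
  rw [hom_trivializationAt_apply]
  ext v w
  refine (inCoordinates_apply_eq₂ (E₃ := fun _ ↦ ℝ) (by simpa using hx) (by simpa using hx)
    (mem_univ _)).trans ?_
  rw [chartForm_apply, h _ ((extChartAt I p).left_inv (by simpa using hx))]
  have h1 (v : E) : (trivializationAt E (TangentSpace I) p).symm x v
      = chartFrame I p (extChartAt I p x) v := by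
    rw [← Trivialization.symmL_apply (R := ℝ) _ (by simpa using hx)]
    exact DFunLike.congr_fun hT v
  rw [h1, h1]
  simp
  rfl

theorem smoothForm_iff {B : FormField I M} :
    SmoothForm I B ↔ ∀ p, ContMDiffOn I 𝓘(ℝ, E →L[ℝ] E →L[ℝ] ℝ) ∞
      (fun x ↦ chartForm I B p (extChartAt I p x)) (chartAt H p).source := by
  have key (p : M) := (trivializationAt (E →L[ℝ] E →L[ℝ] ℝ)
      (fun x : M ↦ TangentSpace I x →L[ℝ] TangentSpace I x →L[ℝ] ℝ) p).contMDiffOn_section_iff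
        (IB := I) (n := ∞) (s := B) (chartAt H p).open_source (by
          simp [hom_trivializationAt_baseSet])
  have key' (p : M) := (key p).trans
    (contMDiffOn_congr fun x hx ↦ trivializationAt_form_eq I B hx)
  refine ⟨fun h p ↦ (key' p).1 h.contMDiffOn, fun h p ↦ ?_⟩
  exact ((key' p).2 (h p)).contMDiffAt ((chartAt H p).open_source.mem_nhds (mem_chart_source H p))

theorem SmoothForm.contDiffOn [I.Boundaryless] {B : FormField I M} (hB : SmoothForm I B) (p : M) :
    ContDiffOn ℝ ∞ (chartForm I B p) (extChartAt I p).target := by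
  rw [← contMDiffOn_iff_contDiffOn]
  refine (((smoothForm_iff I).1 hB p).comp (contMDiffOn_extChartAt_symm p) fun u hu ↦ ?_).congr
    fun u hu ↦ ?_
  · simpa using (extChartAt I p).map_target hu
  · change chartForm I B p u = chartForm I B p (extChartAt I p ((extChartAt I p).symm u))
    rw [(extChartAt I p).right_inv hu]

theorem SmoothForm.of_contDiffOn {B : FormField I M}
    (hB : ∀ p, ContDiffOn ℝ ∞ (chartForm I B p) (extChartAt I p).target) : SmoothForm I B := by
  rw [smoothForm_iff]
  intro p
  refine (contMDiffOn_iff_contDiffOn.2 (hB p)).comp contMDiffOn_extChartAt fun x hx ↦ ?_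
  exact (extChartAt I p).map_source (by simpa using hx)

/-- The expression of a field of endomorphisms in the chart at `p`. -/
noncomputable def chartEnd (J : EndField I M) (p : M) (u : E) : E →L[ℝ] E :=
  (chartFrame I p u).inverse ∘L (J ((extChartAt I p).symm u) : E →L[ℝ] E) ∘L chartFrame I p u

/-- Mathlib's trivialization of the tangent bundle at `p` inverts the coordinate frame. -/
theorem trivializationAt_vector_eq {p x : M} (hx : x ∈ (chartAt H p).source) (w : E) :
    (trivializationAt E (TangentSpace I) p ⟨x, w⟩).2
      = (chartFrame I p (extChartAt I p x)).inverse w := by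
  have hbase : x ∈ (trivializationAt E (TangentSpace I) p).baseSet := by simpa using hx
  have hT := TangentBundle.symmL_trivializationAt (I := I) (𝕜 := ℝ) hx
  have hinv := isInvertible_chartFrame I ((extChartAt I p).map_source (x := x) (by simpa using hx))
  have h1 (v : E) : chartFrame I p (extChartAt I p x) v
      = ((trivializationAt E (TangentSpace I) p).continuousLinearEquivAt ℝ x hbase).symm v :=
    (DFunLike.congr_fun hT v).symm.trans (Trivialization.symmL_apply (R := ℝ) _ hbase v)
  rw [eq_comm, hinv.inverse_apply_eq, h1]
  exact (((trivializationAt E (TangentSpace I) p).continuousLinearEquivAt ℝ x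
    hbase).symm_apply_apply w).symm

/-- Mathlib's trivialization of the endomorphism bundle at `p` is the chart expression. -/
theorem trivializationAt_end_eq (J : EndField I M) {p x : M} (hx : x ∈ (chartAt H p).source) :
    (trivializationAt (E →L[ℝ] E)
      (fun x : M ↦ TangentSpace I x →L[ℝ] TangentSpace I x) p ⟨x, J x⟩).2
      = chartEnd I J p (extChartAt I p x) := by
  have h : ∀ y, y = x → (J y : E →L[ℝ] E) = J x := by rintro _ rfl; rfl
  have hx' : x ∈ (extChartAt I p).source := by simpa using hx
  have hT := TangentBundle.symmL_trivializationAt (I := I) (𝕜 := ℝ) hx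
  have hbase : x ∈ (trivializationAt E (TangentSpace I) p).baseSet := by simpa using hx
  have h1 (v : E) : (trivializationAt E (TangentSpace I) p).symm x v
      = chartFrame I p (extChartAt I p x) v := by
    rw [← Trivialization.symmL_apply (R := ℝ) _ hbase]
    exact DFunLike.congr_fun hT v
  rw [hom_trivializationAt_apply]
  ext1 v
  rw [ContinuousLinearMap.inCoordinates_eq hbase hbase]
  have h3 : chartEnd I J p (extChartAt I p x) v
      = (chartFrame I p (extChartAt I p x)).inverse
        ((J x : E →L[ℝ] E) (chartFrame I p (extChartAt I p x) v)) :=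
    congrArg (chartFrame I p (extChartAt I p x)).inverse
      (DFunLike.congr_fun (h ((extChartAt I p).symm (extChartAt I p x))
        ((extChartAt I p).left_inv hx')) _)
  refine Eq.trans ?_ ((trivializationAt_vector_eq I hx _).trans h3.symm)
  exact congrArg (fun w : E ↦ (trivializationAt E (TangentSpace I) p).continuousLinearEquivAt ℝ x
    hbase ((J x : E →L[ℝ] E) w)) (h1 v)

theorem smoothEnd_of_contDiffOn {J : EndField I M}
    (hJ : ∀ p, ContDiffOn ℝ ∞ (chartEnd I J p) (extChartAt I p).target) : SmoothEnd I J := by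
  intro p
  have key := (trivializationAt (E →L[ℝ] E)
      (fun x : M ↦ TangentSpace I x →L[ℝ] TangentSpace I x) p).contMDiffOn_section_iff
        (IB := I) (n := ∞) (s := J) (chartAt H p).open_source (by
          simp [hom_trivializationAt_baseSet])
  have key' := key.trans (contMDiffOn_congr fun x hx ↦ trivializationAt_end_eq I J hx)
  refine (key'.2 ?_).contMDiffAt ((chartAt H p).open_source.mem_nhds (mem_chart_source H p))
  refine (contMDiffOn_iff_contDiffOn.2 (hJ p)).comp contMDiffOn_extChartAt fun x hx ↦ ?_
  exact (extChartAt I p).map_source (by simpa using hx)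

theorem chartEnd_self (J : EndField I M) (p : M) :
    chartEnd I J p (extChartAt I p p) = (J p : E →L[ℝ] E) := by
  have h : ∀ x, x = p → (J x : E →L[ℝ] E) = J p := by rintro _ rfl; rfl
  rw [chartEnd, chartFrame_self, h _ (extChartAt_to_inv p), ContinuousLinearMap.inverse_id]
  rfl

theorem chartFrame_chartEnd (J : EndField I M) {p : M} {u : E} (hu : u ∈ (extChartAt I p).target)
    (v : E) : chartFrame I p u (chartEnd I J p u v)
      = (J ((extChartAt I p).symm u) : E →L[ℝ] E) (chartFrame I p u v) :=
  (isInvertible_chartFrame I hu).self_apply_inverse _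

end Smoothness

section LieBracket

variable {E : Type*} [NormedAddCommGroup E] [NormedSpace ℝ E]
  {H : Type*} [TopologicalSpace H] (I : ModelWithCorners ℝ E H)
  {M : Type*} [TopologicalSpace M] [ChartedSpace H M] [IsManifold I ∞ M]

/-- The expression of a vector field in the chart at `p`. -/
noncomputable def chartField (V : ∀ x : M, TangentSpace I x) (p : M) (u : E) : E :=
  (chartFrame I p u).inverse (V ((extChartAt I p).symm u))

theorem chartField_end (J : EndField I M) (V : ∀ x : M, TangentSpace I x) {p : M} {u : E}
    (hu : u ∈ (extChartAt I p).target) :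
    chartField I (fun x ↦ J x (V x)) p u = chartEnd I J p u (chartField I V p u) := by
  have h := isInvertible_chartFrame I hu
  refine (h.inverse_apply_eq).2 ?_
  rw [chartFrame_chartEnd I J hu]
  exact congrArg (J ((extChartAt I p).symm u) : E →L[ℝ] E) (h.self_apply_inverse _).symm

theorem mlieBracket_eq_lieBracket_chartField [I.Boundaryless] (V W : ∀ x : M, TangentSpace I x)
    (p : M) :
    VectorField.mlieBracket I V W p
      = VectorField.lieBracket ℝ (chartField I V p) (chartField I W p) (extChartAt I p p) := by
  have h1 : (VectorField.mpullbackWithin 𝓘(ℝ, E) I (extChartAt I p).symm V (range I) : E → E)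
      = chartField I V p := rfl
  have h2 : (VectorField.mpullbackWithin 𝓘(ℝ, E) I (extChartAt I p).symm W (range I) : E → E)
      = chartField I W p := rfl
  have h3 : (mfderiv I 𝓘(ℝ, E) (extChartAt I p) p : E →L[ℝ] E) = .id ℝ E := mfderiv_extChartAt_self
  have h4 : (extChartAt I p).symm ⁻¹' univ ∩ range I = univ := by rw [I.range_eq_univ]; simp
  have h5 : VectorField.mlieBracket I V W p
      = (ContinuousLinearMap.inverse (M := E) (M₂ := E)
        (mfderiv I 𝓘(ℝ, E) (extChartAt I p) p : E →L[ℝ] E) : E →L[ℝ] E)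
        (VectorField.lieBracketWithin (E := E) ℝ (chartField I V p) (chartField I W p)
          ((extChartAt I p).symm ⁻¹' univ ∩ range I) (extChartAt I p p)) := rfl
  rw [h5, h4, h3, VectorField.lieBracketWithin_univ, ContinuousLinearMap.inverse_id]
  rfl

theorem differentiableAt_chartField [CompleteSpace E] [I.Boundaryless]
    {V : ∀ x : M, TangentSpace I x} {p : M}
    (hV : ContMDiffAt I I.tangent ∞ (fun x ↦ (⟨x, V x⟩ : TangentBundle I M)) p) :
    DifferentiableAt ℝ (chartField I V p) (extChartAt I p p) := by
  have h := VectorField.contMDiffWithinAt_mpullbackWithin_extChartAt_symm (I := I) (n := ∞)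
    (m := 1) (s := univ) (V := V) (x := p)
    ((hV.of_le ENat.LEInfty.out).contMDiffWithinAt) uniqueMDiffOn_univ (mem_univ p)
    (one_add_one_eq_two (R := WithTop ℕ∞) ▸ ENat.LEInfty.out)
  rw [contMDiffWithinAt_vectorSpace_iff_contDiffWithinAt] at h
  have hn : (extChartAt I p).target ∩ (extChartAt I p).symm ⁻¹' univ ∈ 𝓝 (extChartAt I p p) := by
    simpa using extChartAt_target_mem_nhds p
  exact (h.contDiffAt hn).differentiableAt (by simp)

end LieBracket

section ProductCharts

variable {E₁ E₂ : Type*} [NormedAddCommGroup E₁] [NormedSpace ℝ E₁]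
  [NormedAddCommGroup E₂] [NormedSpace ℝ E₂]
  {H₁ H₂ : Type*} [TopologicalSpace H₁] [TopologicalSpace H₂]
  {I₁ : ModelWithCorners ℝ E₁ H₁} {I₂ : ModelWithCorners ℝ E₂ H₂}
  {M₁ M₂ : Type*} [TopologicalSpace M₁] [ChartedSpace H₁ M₁]
  [TopologicalSpace M₂] [ChartedSpace H₂ M₂]

theorem extChartAt_target_prod (p : M₁ × M₂) : (extChartAt (I₁.prod I₂) p).target
    = (extChartAt I₁ p.1).target ×ˢ (extChartAt I₂ p.2).target := by
  rw [extChartAt_prod]; rfl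

variable [IsManifold I₁ ∞ M₁] [IsManifold I₂ ∞ M₂] [I₁.Boundaryless] [I₂.Boundaryless]

theorem chartFrame_prod (p : M₁ × M₂) {u : E₁ × E₂} (hu : u ∈ (extChartAt (I₁.prod I₂) p).target) :
    chartFrame (I₁.prod I₂) p u
      = (chartFrame I₁ p.1 u.1).prodMap (chartFrame I₂ p.2 u.2) := by
  obtain ⟨x, hx, rfl⟩ : ∃ x ∈ (extChartAt (I₁.prod I₂) p).source, extChartAt (I₁.prod I₂) p x = u :=
    ⟨_, (extChartAt _ p).map_target hu, (extChartAt _ p).right_inv hu⟩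
  have hx' := hx
  rw [extChartAt_prod] at hx'
  have h1 : x.1 ∈ (extChartAt I₁ p.1).source := hx'.1
  have h2 : x.2 ∈ (extChartAt I₂ p.2).source := hx'.2
  have e1 : (extChartAt (I₁.prod I₂) p x).1 = extChartAt I₁ p.1 x.1 := by rw [extChartAt_prod]; rfl
  have e2 : (extChartAt (I₁.prod I₂) p x).2 = extChartAt I₂ p.2 x.2 := by rw [extChartAt_prod]; rfl
  rw [e1, e2, chartFrame_eq_tangentCoordChange _ hx, chartFrame_eq_tangentCoordChange _ h1,
    chartFrame_eq_tangentCoordChange _ h2]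
  have d := hasFDerivAt_transition (I₁.prod I₂) hx (mem_extChartAt_source x)
  have d1 := hasFDerivAt_transition I₁ h1 (mem_extChartAt_source x.1)
  have d2 := hasFDerivAt_transition I₂ h2 (mem_extChartAt_source x.2)
  rw [← e1] at d1
  rw [← e2] at d2
  refine d.unique ?_
  have hfun : (extChartAt (I₁.prod I₂) x ∘ (extChartAt (I₁.prod I₂) p).symm)
      = Prod.map (extChartAt I₁ x.1 ∘ (extChartAt I₁ p.1).symm)
        (extChartAt I₂ x.2 ∘ (extChartAt I₂ p.2).symm) := by
    rw [extChartAt_prod, extChartAt_prod]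
    rfl
  rw [hfun]
  exact d1.prodMap _ d2

theorem chartForm_prodForm (ε : ℝ) (B₁ : FormField I₁ M₁) (B₂ : FormField I₂ M₂) (p : M₁ × M₂)
    {u : E₁ × E₂} (hu : u ∈ (extChartAt (I₁.prod I₂) p).target) :
    chartForm (I₁.prod I₂) (prodForm ε B₁ B₂) p u
      = prodMetric ε (chartForm I₁ B₁ p.1) (chartForm I₂ B₂ p.2) u := by
  refine ContinuousLinearMap.ext fun X ↦ ContinuousLinearMap.ext fun Y ↦ ?_
  rw [chartForm_apply, prodMetric_apply, chartForm_apply, chartForm_apply, chartFrame_prod p hu,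
    extChartAt_prod]
  rfl

theorem chartEnd_prodEnd (J₁ : EndField I₁ M₁) (J₂ : EndField I₂ M₂) (p : M₁ × M₂)
    {u : E₁ × E₂} (hu : u ∈ (extChartAt (I₁.prod I₂) p).target) :
    chartEnd (I₁.prod I₂) (prodEnd J₁ J₂) p u
      = (chartEnd I₁ J₁ p.1 u.1).prodMap (chartEnd I₂ J₂ p.2 u.2) := by
  have hu' := hu
  rw [extChartAt_target_prod] at hu'
  refine ContinuousLinearMap.ext fun v ↦ ?_
  apply (isInvertible_chartFrame _ hu).injective
  rw [chartFrame_chartEnd _ _ hu, chartFrame_prod p hu]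
  refine Prod.ext ?_ ?_
  · refine Eq.trans ?_ (chartFrame_chartEnd I₁ J₁ hu'.1 v.1).symm
    rw [extChartAt_prod]
    rfl
  · refine Eq.trans ?_ (chartFrame_chartEnd I₂ J₂ hu'.2 v.2).symm
    rw [extChartAt_prod]
    rfl

end ProductCharts

/-! ### Curvature of Lorentzian surfaces and of their products -/

section Germs

variable {E : Type*} [NormedAddCommGroup E] [NormedSpace ℝ E]
  {h h' : E → E →L[ℝ] E →L[ℝ] ℝ} {s t : Set E} {u : E}

theorem IsMetricOn.mono (hh : IsMetricOn h s) (ht : IsOpen t) (hts : t ⊆ s) : IsMetricOn h t where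
  isOpen := ht
  smooth := hh.smooth.mono hts
  symm u hu := hh.symm u (hts hu)
  inv u hu := hh.inv u (hts hu)

theorem IsMetricOn.congr (hh : IsMetricOn h s) (H : EqOn h' h s) : IsMetricOn h' s where
  isOpen := hh.isOpen
  smooth := hh.smooth.congr H
  symm u hu := by rw [H hu]; exact hh.symm u hu
  inv u hu := by rw [H hu]; exact hh.inv u hu

theorem christoffel_congr (H : h =ᶠ[𝓝 u] h') (X Y : E) :
    christoffel h u X Y = christoffel h' u X Y := by
  have H1 (Y : E) : (fun u' ↦ h u' Y) =ᶠ[𝓝 u] fun u' ↦ h' u' Y := by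
    filter_upwards [H] with u' hu'
    rw [hu']
  have H2 (X Y : E) : (fun u' ↦ h u' X Y) =ᶠ[𝓝 u] fun u' ↦ h' u' X Y := by
    filter_upwards [H] with u' hu'
    rw [hu']
  simp only [christoffel, koszul, H.eq_of_nhds, (H1 _).fderiv_eq, (H2 _ _).fderiv_eq]

theorem riemann_congr (H : h =ᶠ[𝓝 u] h') (X Y Z : E) :
    riemann h u X Y Z = riemann h' u X Y Z := by
  have H1 (X Y : E) : (fun u' ↦ christoffel h u' X Y) =ᶠ[𝓝 u] fun u' ↦ christoffel h' u' X Y := by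
    filter_upwards [H.eventually_nhds] with u' hu'
    exact christoffel_congr hu' X Y
  simp only [riemann, christoffel_congr H, (H1 _ _).fderiv_eq]

theorem ricci_eq_trace [FiniteDimensional ℝ E] (L : E →ₗ[ℝ] E) (Y Z : E)
    (hL : ∀ X, riemann h u X Y Z = L X) : ricci h u Y Z = LinearMap.trace ℝ E L := by
  rw [LinearMap.trace_eq_matrix_trace ℝ (Module.finBasis ℝ E), Matrix.trace]
  simp only [ricci, hL, Matrix.diag, LinearMap.toMatrix_apply, Module.Basis.coord_apply]

end Germs

section Metrics

variable {E : Type*} [NormedAddCommGroup E] [NormedSpace ℝ E]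
  {H : Type*} [TopologicalSpace H] {I : ModelWithCorners ℝ E H}
  {M : Type*} [TopologicalSpace M] [ChartedSpace H M]

theorem chartForm_exp_smul (g : FormField I M) (f : M → ℝ) (p : M) (u : E) :
    chartForm I (fun x ↦ Real.exp (2 * f x) • g x) p u
      = Real.exp (2 * f ((extChartAt I p).symm u)) • chartForm I g p u := rfl

variable [I.Boundaryless] [IsManifold I ∞ M]

theorem IsPseudoRiemannian.isMetricOn [FiniteDimensional ℝ E] {g : FormField I M}
    (hg : IsPseudoRiemannian I g) (p : M) :
    IsMetricOn (chartForm I g p) (extChartAt I p).target where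
  isOpen := isOpen_extChartAt_target p
  smooth := hg.smooth.contDiffOn I p
  symm u _ X Y := hg.symm ((extChartAt I p).symm u) (chartFrame I p u X) (chartFrame I p u Y)
  inv u hu := by
    obtain ⟨A, hA⟩ := isInvertible_chartFrame I hu
    apply isInvertible_of_nondeg
    intro v hv
    have key (b : E →L[ℝ] E →L[ℝ] ℝ) (hb : ∀ v : E, (∀ w : E, b v w = 0) → v = 0)
        (hv : ∀ w, b (chartFrame I p u v) (chartFrame I p u w) = 0) : v = 0 := by
      rw [← hA] at hv
      rw [← map_eq_zero_iff A A.injective]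
      exact hb _ fun w ↦ by simpa using hv (A.symm w)
    refine key (g ((extChartAt I p).symm u)) (hg.nondeg ((extChartAt I p).symm u)) hv

/-- Naturality of the curvature tensor under a change of charts. -/
theorem riemann_transition [CompleteSpace E] {B : FormField I M} {p q : M} {s s' : Set E}
    (hs : IsMetricOn (chartForm I B p) s) (hs' : IsMetricOn (chartForm I B q) s')
    (hst' : s' ⊆ (extChartAt I q).target) {u : E} (hu : u ∈ s')
    (hp : (extChartAt I q).symm u ∈ (extChartAt I p).source)
    (hpu : extChartAt I p ((extChartAt I q).symm u) ∈ s) (X Y Z : E) :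
    fderiv ℝ (extChartAt I p ∘ (extChartAt I q).symm) u (riemann (chartForm I B q) u X Y Z)
      = riemann (chartForm I B p) (extChartAt I p ((extChartAt I q).symm u))
        (fderiv ℝ (extChartAt I p ∘ (extChartAt I q).symm) u X)
        (fderiv ℝ (extChartAt I p ∘ (extChartAt I q).symm) u Y)
        (fderiv ℝ (extChartAt I p ∘ (extChartAt I q).symm) u Z) := by
  have hφ := contDiffOn_transition I p q
  have ho : IsOpen (overlap I p q ∩ (extChartAt I p ∘ (extChartAt I q).symm) ⁻¹' s) :=
    hφ.continuousOn.isOpen_inter_preimage (isOpen_overlap I p q) hs.isOpen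
  refine hs.riemann_pullback (φ := extChartAt I p ∘ (extChartAt I q).symm)
    (hs'.mono (hs'.isOpen.inter ho) inter_subset_left) (hφ.mono fun v hv ↦ hv.2.1)
    (fun v hv ↦ hv.2.2) (fun v hv ↦ isInvertible_fderiv_transition I hv.2.1.1 hv.2.1.2)
    (fun v hv ↦ chartForm_transition I B hv.2.1.1 hv.2.1.2) ⟨hu, ⟨hst' hu, hp⟩, hpu⟩ X Y Z

end Metrics

section Surface

variable {S : Type*} [TopologicalSpace S] [ChartedSpace Plane S] [IsManifold (𝓡 2) ∞ S]
  {g : FormField (𝓡 2) S}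

theorem IsLorentzian.isMetricOn (hg : IsLorentzian g) (p : S) :
    IsMetricOn (chartForm (𝓡 2) g p) (extChartAt (𝓡 2) p).target :=
  hg.toIsPseudoRiemannian.isMetricOn p

/-- The Gauss curvature determines the curvature tensor of a surface. -/
theorem IsLorentzian.riemann_center (hg : IsLorentzian g) (p : S) (X Y Z : Plane) :
    riemann (chartForm (𝓡 2) g p) (extChartAt (𝓡 2) p p) X Y Z = gaussCurvature g p •
      ((g p : Plane →L[ℝ] Plane →L[ℝ] ℝ) Y Z • X - (g p : Plane →L[ℝ] Plane →L[ℝ] ℝ) X Z • Y) := by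
  have := (hg.isMetricOn p).riemann_plane (mem_extChartAt_target p) X Y Z
  rw [chartForm_self] at this
  exact this

/-- If the Gauss curvature is constant, then the curvature tensor has the constant curvature form
at every point of every chart, not only at its centre. -/
theorem IsLorentzian.riemann_of_const (hg : IsLorentzian g) {k : ℝ}
    (hk : ∀ x, gaussCurvature g x = k) (p : S) {u : Plane} (hu : u ∈ (extChartAt (𝓡 2) p).target)
    (X Y Z : Plane) : riemann (chartForm (𝓡 2) g p) u X Y Z
      = k • (chartForm (𝓡 2) g p u Y Z • X - chartForm (𝓡 2) g p u X Z • Y) := by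
  -- `gaussCurvature` is defined in the chart centred at `x`; pass to that chart
  set x := (extChartAt (𝓡 2) p).symm u with hx
  have hxs := mem_extChartAt_source (I := 𝓡 2) x
  have h := riemann_transition (hg.isMetricOn x) (hg.isMetricOn p) subset_rfl hu hxs
    (mem_extChartAt_target x) X Y Z
  apply (isInvertible_fderiv_transition (𝓡 2) hu hxs).injective
  have h2 := chartForm_transition (𝓡 2) g hu hxs
  rw [h]
  rw [← hx] at h2 ⊢
  rw [hg.riemann_center, hk, map_smul, map_sub, map_smul, map_smul, h2, h2, chartForm_self]
  rfl

end Surface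

section Product

variable {S₁ S₂ : Type*} [TopologicalSpace S₁] [ChartedSpace Plane S₁]
    [TopologicalSpace S₂] [ChartedSpace Plane S₂]
    {g₁ : FormField (𝓡 2) S₁} {g₂ : FormField (𝓡 2) S₂} {ε : ℝ}

theorem nondeg_prodForm {B₁ : FormField (𝓡 2) S₁} {B₂ : FormField (𝓡 2) S₂} (hε : ε ≠ 0)
    (h₁ : ∀ (x : S₁) (v : Plane), (∀ w : Plane, (B₁ x : Plane →L[ℝ] Plane →L[ℝ] ℝ) v w = 0) → v = 0)
    (h₂ : ∀ (x : S₂) (v : Plane), (∀ w : Plane, (B₂ x : Plane →L[ℝ] Plane →L[ℝ] ℝ) v w = 0) → v = 0)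
    (p : S₁ × S₂) (v : Plane × Plane)
    (hv : ∀ w : Plane × Plane,
      (prodForm ε B₁ B₂ p : Plane × Plane →L[ℝ] Plane × Plane →L[ℝ] ℝ) v w = 0) : v = 0 := by
  have key (b₁ b₂ : Plane →L[ℝ] Plane →L[ℝ] ℝ) (h₁ : ∀ v, (∀ w, b₁ v w = 0) → v = 0)
      (h₂ : ∀ v, (∀ w, b₂ v w = 0) → v = 0)
      (hv : ∀ w : Plane × Plane, b₁ v.1 w.1 + ε * b₂ v.2 w.2 = 0) : v = 0 := by
    refine Prod.ext (h₁ v.1 fun w ↦ ?_) (h₂ v.2 fun w ↦ ?_)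
    · simpa using hv (w, 0)
    · simpa [hε] using hv (0, w)
  exact key (B₁ p.1) (B₂ p.2) (h₁ p.1) (h₂ p.2) hv

variable [IsManifold (𝓡 2) ∞ S₁] [IsManifold (𝓡 2) ∞ S₂]

theorem SmoothForm.prodForm {B₁ : FormField (𝓡 2) S₁} {B₂ : FormField (𝓡 2) S₂}
    (h₁ : SmoothForm (𝓡 2) B₁) (h₂ : SmoothForm (𝓡 2) B₂) (ε : ℝ) :
    SmoothForm ((𝓡 2).prod (𝓡 2)) (prodForm ε B₁ B₂) := by
  refine SmoothForm.of_contDiffOn _ fun p ↦ ?_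
  have := contDiffOn_prodMetric (ε := ε) (h₁.contDiffOn _ p.1) (h₂.contDiffOn _ p.2)
  rw [← extChartAt_target_prod] at this
  exact this.congr fun u hu ↦ chartForm_prodForm ε B₁ B₂ p hu

theorem IsPseudoRiemannian.prodForm (hg₁ : IsPseudoRiemannian (𝓡 2) g₁)
    (hg₂ : IsPseudoRiemannian (𝓡 2) g₂) (hε : ε ≠ 0) :
    IsPseudoRiemannian ((𝓡 2).prod (𝓡 2)) (prodForm ε g₁ g₂) where
  smooth := hg₁.smooth.prodForm hg₂.smooth ε
  symm p v w := congrArg₂ (fun a b ↦ a + ε * b) (hg₁.symm p.1 v.1 w.1) (hg₂.symm p.2 v.2 w.2)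
  nondeg := nondeg_prodForm hε hg₁.nondeg hg₂.nondeg

/-- The curvature tensor of the product of two Lorentzian surfaces, in the chart centred at the
point. -/
theorem riemann_prodForm_center (hg₁ : IsLorentzian g₁) (hg₂ : IsLorentzian g₂) (hε : ε ≠ 0)
    (p : S₁ × S₂) (X Y Z : Plane × Plane) :
    riemann (chartForm ((𝓡 2).prod (𝓡 2)) (prodForm ε g₁ g₂) p)
      (extChartAt ((𝓡 2).prod (𝓡 2)) p p) X Y Z
      = (gaussCurvature g₁ p.1 • ((g₁ p.1 : Plane →L[ℝ] Plane →L[ℝ] ℝ) Y.1 Z.1 • X.1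
          - (g₁ p.1 : Plane →L[ℝ] Plane →L[ℝ] ℝ) X.1 Z.1 • Y.1),
        gaussCurvature g₂ p.2 • ((g₂ p.2 : Plane →L[ℝ] Plane →L[ℝ] ℝ) Y.2 Z.2 • X.2
          - (g₂ p.2 : Plane →L[ℝ] Plane →L[ℝ] ℝ) X.2 Z.2 • Y.2)) := by
  have hp := mem_extChartAt_target (I := (𝓡 2).prod (𝓡 2)) p
  have H : chartForm ((𝓡 2).prod (𝓡 2)) (prodForm ε g₁ g₂) p
      =ᶠ[𝓝 (extChartAt ((𝓡 2).prod (𝓡 2)) p p)]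
        prodMetric ε (chartForm (𝓡 2) g₁ p.1) (chartForm (𝓡 2) g₂ p.2) := by
    filter_upwards [extChartAt_target_mem_nhds p] with u hu
    exact chartForm_prodForm ε g₁ g₂ p hu
  rw [extChartAt_target_prod] at hp
  rw [riemann_congr H, (hg₁.isMetricOn p.1).riemann_prod hε (hg₂.isMetricOn p.2) hp,
    ← hg₁.riemann_center, ← hg₂.riemann_center, extChartAt_prod]
  rfl

/-- `Ric(g₁ + ε g₂) = κ₁ g₁ + κ₂ g₂`. -/
theorem ricciAt_prodForm (hg₁ : IsLorentzian g₁) (hg₂ : IsLorentzian g₂) (hε : ε ≠ 0)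
    (p : S₁ × S₂) (Y Z : Plane × Plane) :
    ricciAt ((𝓡 2).prod (𝓡 2)) (prodForm ε g₁ g₂) p Y Z
      = gaussCurvature g₁ p.1 * (g₁ p.1 : Plane →L[ℝ] Plane →L[ℝ] ℝ) Y.1 Z.1
        + gaussCurvature g₂ p.2 * (g₂ p.2 : Plane →L[ℝ] Plane →L[ℝ] ℝ) Y.2 Z.2 := by
  -- the endomorphism `X ↦ k (b(Y,Z) X - b(X,Z) Y)` of a plane has trace `k b(Y,Z)`
  let L (b : Plane →L[ℝ] Plane →L[ℝ] ℝ) (k : ℝ) (Y Z : Plane) : Plane →ₗ[ℝ] Plane :=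
    k • (b Y Z • LinearMap.id - ((b.flip Z).toLinearMap.smulRight Y))
  have hL (b : Plane →L[ℝ] Plane →L[ℝ] ℝ) (k : ℝ) (Y Z : Plane) :
      LinearMap.trace ℝ Plane (L b k Y Z) = k * b Y Z := by
    simp only [L, map_smul, map_sub, LinearMap.trace_id, LinearMap.trace_smulRight]
    simp
    ring_nf
    simp
  refine (ricci_eq_trace (u := extChartAt ((𝓡 2).prod (𝓡 2)) p p)
    ((L (g₁ p.1) (gaussCurvature g₁ p.1) Y.1 Z.1).prodMap
      (L (g₂ p.2) (gaussCurvature g₂ p.2) Y.2 Z.2)) Y Z fun X ↦ ?_).trans ?_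
  · rw [riemann_prodForm_center hg₁ hg₂ hε]
    rfl
  · exact (LinearMap.trace_prodMap' _ _).trans (congrArg₂ (· + ·) (hL _ _ _ _) (hL _ _ _ _))

end Product

/-! ### The Einstein condition and conformal flatness -/

section Product

variable {S₁ S₂ : Type*} [TopologicalSpace S₁] [ChartedSpace Plane S₁] [IsManifold (𝓡 2) ∞ S₁]
    [TopologicalSpace S₂] [ChartedSpace Plane S₂] [IsManifold (𝓡 2) ∞ S₂]
    {g₁ : FormField (𝓡 2) S₁} {g₂ : FormField (𝓡 2) S₂} {ε : ℝ}

theorem isEinstein_prodForm_iff [Nonempty S₁] [Nonempty S₂] (hg₁ : IsLorentzian g₁)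
    (hg₂ : IsLorentzian g₂) (hε : ε * ε = 1) :
    IsEinstein ((𝓡 2).prod (𝓡 2)) (prodForm ε g₁ g₂) ↔
      ∃ c₁ c₂ : ℝ, (∀ x, gaussCurvature g₁ x = c₁) ∧ (∀ y, gaussCurvature g₂ y = c₂) ∧
        c₁ = ε * c₂ := by
  have hε0 : ε ≠ 0 := by rintro rfl; simp at hε
  have hR (c : ℝ) (p : S₁ × S₂) (Y Z : Plane × Plane) :
      ricciAt ((𝓡 2).prod (𝓡 2)) (prodForm ε g₁ g₂) p Y Z
          = c * (prodForm ε g₁ g₂ p : Plane × Plane →L[ℝ] Plane × Plane →L[ℝ] ℝ) Y Z ↔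
        gaussCurvature g₁ p.1 * (g₁ p.1 : Plane →L[ℝ] Plane →L[ℝ] ℝ) Y.1 Z.1
        + gaussCurvature g₂ p.2 * (g₂ p.2 : Plane →L[ℝ] Plane →L[ℝ] ℝ) Y.2 Z.2
        = c * ((g₁ p.1 : Plane →L[ℝ] Plane →L[ℝ] ℝ) Y.1 Z.1
          + ε * (g₂ p.2 : Plane →L[ℝ] Plane →L[ℝ] ℝ) Y.2 Z.2) := by
    rw [ricciAt_prodForm hg₁ hg₂ hε0]
    rfl
  constructor
  · rintro ⟨c, hc⟩
    have hc' (p : S₁ × S₂) (Y Z : Plane × Plane) := (hR c p Y Z).1 (hc p Y Z)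
    have key {b₁ b₂ : Plane →L[ℝ] Plane →L[ℝ] ℝ} {k₁ k₂ : ℝ}
        (h : ∀ Y Z : Plane × Plane, k₁ * b₁ Y.1 Z.1 + k₂ * b₂ Y.2 Z.2
          = c * (b₁ Y.1 Z.1 + ε * b₂ Y.2 Z.2))
        (h₁ : ∃ v, 0 < b₁ v v) (h₂ : ∃ v, 0 < b₂ v v) : k₁ = c ∧ k₂ = ε * c := by
      obtain ⟨v, hv⟩ := h₁
      obtain ⟨w, hw⟩ := h₂
      constructor
      · simpa [hv.ne'] using h (v, 0) (v, 0)
      · refine mul_right_cancel₀ hw.ne' ?_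
        have := h (0, w) (0, w)
        simp only [map_zero, mul_zero, zero_add] at this
        linear_combination this
    have key' (x : S₁) (y : S₂) : gaussCurvature g₁ x = c ∧ gaussCurvature g₂ y = ε * c :=
      key (hc' (x, y)) (hg₁.indefinite x).1 (hg₂.indefinite y).1
    obtain ⟨x₀⟩ := ‹Nonempty S₁›
    obtain ⟨y₀⟩ := ‹Nonempty S₂›
    exact ⟨c, ε * c, fun x ↦ (key' x y₀).1, fun y ↦ (key' x₀ y).2,
      by rw [← mul_assoc, hε, one_mul]⟩
  · rintro ⟨c₁, c₂, h₁, h₂, h⟩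
    refine ⟨c₁, fun p Y Z ↦ (hR c₁ p Y Z).2 ?_⟩
    rw [h₁, h₂, h]
    linear_combination (-c₂ * (g₂ p.2 : Plane →L[ℝ] Plane →L[ℝ] ℝ) Y.2 Z.2) * hε

/-- The algebraic core of the conformal flatness criterion. If the curvature `(k₁ R₁, k₂ R₂)` of an
orthogonal sum of two Lorentzian planes is the Kulkarni–Nomizu product of the metric with some
form, then the sectional curvatures `K` of the coordinate planes of an orthonormal frame
`a, b, c, d` satisfy `K(a,b) + K(c,d) = K(a,c) + K(b,d) = 0`. -/
theorem add_curvature_eq_zero_of_kulkarniNomizu {b₁ b₂ : Plane →L[ℝ] Plane →L[ℝ] ℝ}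
    {o₁ o₂ : Orientation ℝ Plane (Fin 2)} {e₁ e₂ : Module.Basis (Fin 2) ℝ Plane}
    (h₁ : IsLorentzFrame o₁ b₁ e₁) (h₂ : IsLorentzFrame o₂ b₂ e₂) (hε : ε * ε = 1)
    (hs₁ : ∀ v w, b₁ v w = b₁ w v) (hs₂ : ∀ v w, b₂ v w = b₂ w v)
    {G : Plane × Plane → Plane × Plane → ℝ} (hG : ∀ X Y, G X Y = b₁ X.1 Y.1 + ε * b₂ X.2 Y.2)
    {k₁ k₂ : ℝ} {S : Plane × Plane → Plane × Plane}
    (h : ∀ X Y Z : Plane × Plane, (k₁ • (b₁ Y.1 Z.1 • X.1 - b₁ X.1 Z.1 • Y.1),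
        k₂ • (b₂ Y.2 Z.2 • X.2 - b₂ X.2 Z.2 • Y.2))
      - (G (S Y) Z • X - G (S X) Z • Y + G Y Z • S X - G X Z • S Y) = 0) :
    k₁ = -ε * k₂ := by
  have hl (X Y Z W : Plane × Plane) :
      k₁ * (b₁ Y.1 Z.1 * b₁ X.1 W.1 - b₁ X.1 Z.1 * b₁ Y.1 W.1)
      + ε * (k₂ * (b₂ Y.2 Z.2 * b₂ X.2 W.2 - b₂ X.2 Z.2 * b₂ Y.2 W.2))
      - (G (S Y) Z * G X W - G (S X) Z * G Y W + G Y Z * G (S X) W - G X Z * G (S Y) W) = 0 := by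
    have e₁ := congrArg (fun v ↦ b₁ v W.1) (Prod.ext_iff.1 (h X Y Z)).1
    have e₂ := congrArg (fun v ↦ b₂ v W.2) (Prod.ext_iff.1 (h X Y Z)).2
    simp only [Prod.fst_sub, Prod.fst_add, Prod.smul_fst, Prod.fst_zero, Prod.snd_sub,
      Prod.snd_add, Prod.smul_snd, Prod.snd_zero, map_sub, map_add, map_smul, map_zero, sub_apply,
      add_apply, smul_apply, zero_apply, smul_eq_mul] at e₁ e₂
    rw [hG X W, hG Y W, hG (S X) W, hG (S Y) W]
    linear_combination e₁ + ε * e₂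
  have a1 := h₁.spacelike
  have a2 := h₁.timelike
  have a3 := h₁.orthogonal
  have a4 := hs₁ (e₁ 1) (e₁ 0)
  have c1 := h₂.spacelike
  have c2 := h₂.timelike
  have c3 := h₂.orthogonal
  have c4 := hs₂ (e₂ 1) (e₂ 0)
  rw [a3] at a4
  rw [c3] at c4
  -- the sectional curvatures of the coordinate planes, with `a, b = e₁` and `c, d = e₂`
  have hab := hl (e₁ 0, 0) (e₁ 1, 0) (e₁ 1, 0) (e₁ 0, 0)
  have hcd := hl (0, e₂ 0) (0, e₂ 1) (0, e₂ 1) (0, e₂ 0)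
  have hac := hl (e₁ 0, 0) (0, e₂ 0) (0, e₂ 0) (e₁ 0, 0)
  have hbd := hl (e₁ 1, 0) (0, e₂ 1) (0, e₂ 1) (e₁ 1, 0)
  have z₁ : b₁ 0 = 0 := map_zero b₁
  have z₂ : b₂ 0 = 0 := map_zero b₂
  simp only [hG (e₁ 0, 0), hG (e₁ 1, 0), hG (0, e₂ 0), hG (0, e₂ 1), a1, a2, a3, a4, c1, c2, c3,
    c4, z₁, z₂, map_zero, zero_apply, mul_zero, zero_mul, add_zero, zero_add, sub_zero, zero_sub,
    mul_one, mul_neg, neg_mul, one_mul] at hab hcd hac hbd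
  linear_combination (-1) * hab - hcd - ε * hac - ε * hbd
    + (G (S (e₁ 1, 0)) (e₁ 1, 0) - G (S (e₁ 0, 0)) (e₁ 0, 0)) * hε

theorem gaussCurvature_eq_of_isLocallyConformallyFlat (hg₁ : IsLorentzian g₁)
    (hg₂ : IsLorentzian g₂) (hε : ε * ε = 1)
    (h : IsLocallyConformallyFlat ((𝓡 2).prod (𝓡 2)) (prodForm ε g₁ g₂)) (x : S₁) (y : S₂) :
    gaussCurvature g₁ x = -ε * gaussCurvature g₂ y := by
  have hε0 : ε ≠ 0 := by rintro rfl; simp at hε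
  -- only the flatness at the point `(x, y)` itself is used, in the chart centred there
  obtain ⟨U, f, hU, hp, hf, hflat⟩ := h (x, y)
  set p : S₁ × S₂ := (x, y) with hpdef
  set K := (𝓡 2).prod (𝓡 2)
  have hG := (hg₁.toIsPseudoRiemannian.prodForm hg₂.toIsPseudoRiemannian hε0).isMetricOn p
  set G := chartForm K (prodForm ε g₁ g₂) p with hGdef
  set u := extChartAt K p p with hu
  set s := (extChartAt K p).target ∩ (extChartAt K p).symm ⁻¹' U with hs
  have hso : IsOpen s := (continuousOn_extChartAt_symm p).isOpen_inter_preimage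
    (isOpen_extChartAt_target p) hU
  have hus : u ∈ s := by
    refine ⟨mem_extChartAt_target p, ?_⟩
    rw [mem_preimage, hu, extChartAt_to_inv]
    exact hp
  have hfs : ContDiffOn ℝ ∞ (fun u ↦ f ((extChartAt K p).symm u)) s := by
    rw [← contMDiffOn_iff_contDiffOn]
    exact hf.comp ((contMDiffOn_extChartAt_symm p).mono inter_subset_left) fun v hv ↦ hv.2
  have hGs := hG.mono hso inter_subset_left
  have hR (X Y Z : Plane × Plane) : riemann G u X Y Z
      - (G u (schoutenChange G (fun u ↦ f ((extChartAt K p).symm u)) u Y) Z • X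
        - G u (schoutenChange G (fun u ↦ f ((extChartAt K p).symm u)) u X) Z • Y
        + G u Y Z • schoutenChange G (fun u ↦ f ((extChartAt K p).symm u)) u X
        - G u X Z • schoutenChange G (fun u ↦ f ((extChartAt K p).symm u)) u Y) = 0 := by
    rw [← hGs.riemann_conformal hfs hus X Y Z]
    exact hflat p hp X Y Z
  have hc (X Y Z : Plane × Plane) : riemann G u X Y Z = _ :=
    riemann_prodForm_center hg₁ hg₂ hε0 p X Y Z
  simp only [hc] at hR
  have hs₁ : ∀ v w : Plane, (g₁ x : Plane →L[ℝ] Plane →L[ℝ] ℝ) v w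
    = (g₁ x : Plane →L[ℝ] Plane →L[ℝ] ℝ) w v := hg₁.symm x
  have hs₂ : ∀ v w : Plane, (g₂ y : Plane →L[ℝ] Plane →L[ℝ] ℝ) v w
    = (g₂ y : Plane →L[ℝ] Plane →L[ℝ] ℝ) w v := hg₂.symm y
  obtain ⟨e₁, he₁⟩ := exists_lorentzFrame stdBasis.orientation (g₁ x) hs₁ (hg₁.indefinite x).1
    (hg₁.indefinite x).2
  obtain ⟨e₂, he₂⟩ := exists_lorentzFrame stdBasis.orientation (g₂ y) hs₂ (hg₂.indefinite y).1
    (hg₂.indefinite y).2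
  refine add_curvature_eq_zero_of_kulkarniNomizu he₁ he₂ hε hs₁ hs₂
    (G := fun X Y ↦ G u X Y) (fun X Y ↦ ?_) hR
  rw [hGdef, hu, chartForm_self]
  rfl

theorem isLocallyConformallyFlat_of_gaussCurvature (hg₁ : IsLorentzian g₁)
    (hg₂ : IsLorentzian g₂) (hε0 : ε ≠ 0) {k : ℝ} (h₁ : ∀ x, gaussCurvature g₁ x = k)
    (h₂ : ∀ y, gaussCurvature g₂ y = -(ε * k)) :
    IsLocallyConformallyFlat ((𝓡 2).prod (𝓡 2)) (prodForm ε g₁ g₂) := by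
  intro p
  set K := (𝓡 2).prod (𝓡 2)
  have hx := mem_extChartAt_target (I := 𝓡 2) p.1
  have hm₁ := hg₁.isMetricOn p.1
  have hm₂ := hg₂.isMetricOn p.2
  have hind := hg₁.indefinite p.1
  obtain ⟨r, hr, hsub, φ, hφ, hφ'⟩ := hm₁.exists_conformal_factor
    (fun u hu ↦ hg₁.riemann_of_const h₁ p.1 hu) hx
    (by rw [chartForm_self]; exact hind.1) (by rw [chartForm_self]; exact hind.2)
  set x₀ := extChartAt (𝓡 2) p.1 p.1
  have hm₁' := hm₁.mono Metric.isOpen_ball hsub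
  set f : S₁ × S₂ → ℝ := fun q ↦ -Real.log (φ (extChartAt (𝓡 2) p.1 q.1)) with hf
  set V := (extChartAt (𝓡 2) p.1).source ∩ extChartAt (𝓡 2) p.1 ⁻¹' Metric.ball x₀ r with hV
  have hVo : IsOpen V := (continuousOn_extChartAt p.1).isOpen_inter_preimage
    (isOpen_extChartAt_source p.1) Metric.isOpen_ball
  set U := V ×ˢ (extChartAt (𝓡 2) p.2).source with hU
  have hUo : IsOpen U := hVo.prod (isOpen_extChartAt_source p.2)
  have hfU : ContMDiffOn K 𝓘(ℝ, ℝ) ∞ f U := by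
    have hl : ContDiffOn ℝ ∞ (fun u ↦ -Real.log (φ u)) (Metric.ball x₀ r) :=
      (hφ.log fun u hu ↦ (hφ' u hu).1.ne').neg
    have hc : ContMDiffOn (𝓡 2) 𝓘(ℝ, Plane) ∞ (extChartAt (𝓡 2) p.1) V :=
      contMDiffOn_extChartAt.mono fun q hq ↦ by simpa using hq.1
    exact (contMDiffOn_iff_contDiffOn.2 hl).comp (hc.comp contMDiffOn_fst fun q hq ↦ hq.1)
      fun q hq ↦ hq.1.2
  refine ⟨U, f, hUo, ⟨⟨mem_extChartAt_source p.1, Metric.mem_ball_self hr⟩,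
    mem_extChartAt_source p.2⟩, hfU, fun q hq X Y Z ↦ ?_⟩
  set G := prodForm ε g₁ g₂ with hG
  set s := Metric.ball x₀ r ×ˢ (extChartAt (𝓡 2) p.2).target with hs
  have hst : s ⊆ (extChartAt K p).target := by
    rw [extChartAt_target_prod]
    exact prod_mono hsub subset_rfl
  set h₀ : Plane × Plane → Plane × Plane →L[ℝ] Plane × Plane →L[ℝ] ℝ :=
    fun u ↦ Real.exp (2 * -Real.log (φ u.1)) •
      prodMetric ε (chartForm (𝓡 2) g₁ p.1) (chartForm (𝓡 2) g₂ p.2) u with hh₀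
  have hEq : EqOn (chartForm K (fun x ↦ Real.exp (2 * f x) • G x) p) h₀ s := by
    intro u hu
    have e1 : extChartAt (𝓡 2) p.1 ((extChartAt K p).symm u).1 = u.1 := by
      rw [extChartAt_prod]
      exact (extChartAt (𝓡 2) p.1).right_inv (hsub hu.1)
    rw [chartForm_exp_smul, hG, chartForm_prodForm ε g₁ g₂ p (hst hu), hf, hh₀]
    simp only [e1]
  have hm : IsMetricOn (chartForm K (fun x ↦ Real.exp (2 * f x) • G x) p) s := by
    refine IsMetricOn.congr ?_ hEq
    refine (hm₁'.prod hε0 hm₂).conformal (f := fun u ↦ -Real.log (φ u.1)) ?_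
    exact ((hφ.comp contDiffOn_fst fun u hu ↦ hu.1).log fun u hu ↦ (hφ' u.1 hu.1).1.ne').neg
  have hflat : ∀ u ∈ s, ∀ X Y Z,
      riemann (chartForm K (fun x ↦ Real.exp (2 * f x) • G x) p) u X Y Z = 0 := by
    intro u hu X Y Z
    rw [riemann_congr (hEq.eventuallyEq_of_mem (hm.isOpen.mem_nhds hu))]
    exact hm₁'.riemann_conformal_prod_eq_zero hε0 hm₂
      (fun v hv ↦ hg₁.riemann_of_const h₁ p.1 (hsub hv))
      (fun v hv ↦ hg₂.riemann_of_const h₂ p.2 hv) hφ (fun v hv ↦ (hφ' v hv).1)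
      (fun v hv ↦ (hφ' v hv).2.1) (fun v hv ↦ (hφ' v hv).2.2) hu X Y Z
  -- flatness holds in the chart at `p`; transfer it to the chart at `q`
  have hqs : q ∈ (extChartAt K p).source := by
    rw [extChartAt_prod]
    exact ⟨hq.1.1, hq.2⟩
  have hqu : extChartAt K p q ∈ s := by
    rw [extChartAt_prod]
    exact ⟨hq.1.2, (extChartAt (𝓡 2) p.2).map_source hq.2⟩
  have hGq := (hg₁.toIsPseudoRiemannian.prodForm hg₂.toIsPseudoRiemannian hε0).isMetricOn q
  set s' := (extChartAt K q).target ∩ (extChartAt K q).symm ⁻¹' U with hs'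
  have hso' : IsOpen s' := (continuousOn_extChartAt_symm q).isOpen_inter_preimage
    (isOpen_extChartAt_target q) hUo
  have hm' : IsMetricOn (chartForm K (fun x ↦ Real.exp (2 * f x) • G x) q) s' := by
    refine (hGq.mono hso' inter_subset_left).conformal
      (f := fun u ↦ f ((extChartAt K q).symm u)) ?_
    rw [← contMDiffOn_iff_contDiffOn]
    exact hfU.comp ((contMDiffOn_extChartAt_symm q).mono inter_subset_left) fun v hv ↦ hv.2
  have hqt := mem_extChartAt_target (I := K) q
  have hq' : (extChartAt K q).symm (extChartAt K q q) = q := extChartAt_to_inv q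
  have htr := riemann_transition hm hm' inter_subset_left
    (u := extChartAt K q q) ⟨hqt, by rw [mem_preimage, hq']; exact hq⟩ (by rwa [hq'])
    (by rwa [hq']) X Y Z
  rw [hflat _ (by rwa [hq'])] at htr
  apply (isInvertible_fderiv_transition K hqt (by rwa [hq'] : _ ∈ (extChartAt K p).source)).injective
  exact htr.trans (map_zero _).symm

theorem isLocallyConformallyFlat_prodForm_iff [Nonempty S₁] [Nonempty S₂] (hg₁ : IsLorentzian g₁)
    (hg₂ : IsLorentzian g₂) (hε : ε * ε = 1) :
    IsLocallyConformallyFlat ((𝓡 2).prod (𝓡 2)) (prodForm ε g₁ g₂) ↔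
      ∃ c₁ c₂ : ℝ, (∀ x, gaussCurvature g₁ x = c₁) ∧ (∀ y, gaussCurvature g₂ y = c₂) ∧
        c₁ = -ε * c₂ := by
  constructor
  · intro h
    have key := gaussCurvature_eq_of_isLocallyConformallyFlat hg₁ hg₂ hε h
    obtain ⟨x₀⟩ := ‹Nonempty S₁›
    obtain ⟨y₀⟩ := ‹Nonempty S₂›
    refine ⟨gaussCurvature g₁ x₀, gaussCurvature g₂ y₀, fun x ↦ ?_, fun y ↦ ?_, key x₀ y₀⟩
    · rw [key x y₀, key x₀ y₀]
    · linear_combination ε * key x₀ y - ε * key x₀ y₀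
        + (gaussCurvature g₂ y₀ - gaussCurvature g₂ y) * hε
  · rintro ⟨c₁, c₂, h₁, h₂, rfl⟩
    refine isLocallyConformallyFlat_of_gaussCurvature hg₁ hg₂ (by rintro rfl; simp at hε) h₁
      fun y ↦ ?_
    rw [h₂]
    linear_combination (-c₂) * hε

end Product

/-! ### The paracomplex structure of a Lorentzian surface -/

section LorentzPlane

variable {o : Orientation ℝ Plane (Fin 2)} {B : Plane →L[ℝ] Plane →L[ℝ] ℝ}

/-- A symmetric bilinear form on the plane that takes positive and negative values. -/
structure IsIndefinite (B : Plane →L[ℝ] Plane →L[ℝ] ℝ) : Prop where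
  symm : ∀ v w, B v w = B w v
  pos : ∃ v, 0 < B v v
  neg : ∃ w, B w w < 0

theorem IsIndefinite.exists_frame (hB : IsIndefinite B) (o : Orientation ℝ Plane (Fin 2)) :
    ∃ e, IsLorentzFrame o B e ∧ paraRotation o B (e 0) = e 1 ∧ paraRotation o B (e 1) = e 0 := by
  obtain ⟨e, he⟩ := exists_lorentzFrame o B hB.symm hB.pos hB.neg
  exact ⟨e, he, paraRotation_apply o B hB.symm e he⟩

theorem basis_eq (e : Module.Basis (Fin 2) ℝ Plane) (v : Plane) :
    v = e.repr v 0 • e 0 + e.repr v 1 • e 1 := by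
  rw [← Fin.sum_univ_two (fun i ↦ e.repr v i • e i), e.sum_repr]

theorem IsIndefinite.paraRotation_sq (hB : IsIndefinite B) (o : Orientation ℝ Plane (Fin 2))
    (v : Plane) : paraRotation o B (paraRotation o B v) = v := by
  obtain ⟨e, -, h0, h1⟩ := hB.exists_frame o
  conv_lhs => rw [basis_eq e v]
  conv_rhs => rw [basis_eq e v]
  simp only [map_add, map_smul, h0, h1]

theorem IsIndefinite.apply_paraRotation (hB : IsIndefinite B) (o : Orientation ℝ Plane (Fin 2))
    (v w : Plane) : B (paraRotation o B v) (paraRotation o B w) = -B v w := by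
  obtain ⟨e, he, h0, h1⟩ := hB.exists_frame o
  have h10 : B (e 1) (e 0) = 0 := by rw [hB.symm, he.orthogonal]
  rw [basis_eq e v, basis_eq e w]
  simp only [map_add, map_smul, h0, h1, add_apply, smul_apply, smul_eq_mul, he.spacelike,
    he.timelike, he.orthogonal, h10]
  ring

theorem IsIndefinite.apply_paraRotation_self (hB : IsIndefinite B)
    (o : Orientation ℝ Plane (Fin 2)) (v : Plane) : B (paraRotation o B v) v = 0 := by
  have h := hB.apply_paraRotation o (paraRotation o B v) v
  rw [hB.paraRotation_sq, hB.symm] at h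
  linarith

theorem IsIndefinite.nondeg_paraRotation (hB : IsIndefinite B) (o : Orientation ℝ Plane (Fin 2))
    (v : Plane) (hv : ∀ w, B (paraRotation o B v) w = 0) : v = 0 := by
  obtain ⟨e, he, h0, h1⟩ := hB.exists_frame o
  have h10 : B (e 1) (e 0) = 0 := by rw [hB.symm, he.orthogonal]
  have a0 := hv (e 0)
  have a1 := hv (e 1)
  rw [basis_eq e v] at a0 a1
  simp only [map_add, map_smul, h0, h1, add_apply, smul_apply, smul_eq_mul, he.spacelike,
    he.timelike, he.orthogonal, h10] at a0 a1
  rw [basis_eq e v, show e.repr v 0 = 0 by linarith, show e.repr v 1 = 0 by linarith]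
  simp

/-- `paraRotation` is natural under linear isomorphisms. -/
theorem IsIndefinite.paraRotation_conj (hB : IsIndefinite B) (o : Orientation ℝ Plane (Fin 2))
    (A : Plane ≃L[ℝ] Plane) (v : Plane) :
    A.symm (paraRotation o B (A v)) = paraRotation
      (Orientation.map (Fin 2) A.symm.toLinearEquiv o)
      (B.bilinearComp (A : Plane →L[ℝ] Plane) (A : Plane →L[ℝ] Plane)) v := by
  obtain ⟨e, he, h0, h1⟩ := hB.exists_frame o
  have he' : IsLorentzFrame (Orientation.map (Fin 2) A.symm.toLinearEquiv o)
      (B.bilinearComp (A : Plane →L[ℝ] Plane) (A : Plane →L[ℝ] Plane))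
      (e.map A.symm.toLinearEquiv) := by
    refine ⟨by rw [Module.Basis.orientation_map, he.pos], ?_, ?_, ?_⟩
    · simpa using he.spacelike
    · simpa using he.timelike
    · simpa using he.orthogonal
  obtain ⟨k0, k1⟩ := paraRotation_apply _ _ (fun v w ↦ by simpa using hB.symm (A v) (A w)) _ he'
  rw [basis_eq (e.map A.symm.toLinearEquiv) v]
  simp only [map_add, map_smul, k0, k1]
  simp [h0, h1]

theorem IsIndefinite.disc_pos (hB : IsIndefinite B) :
    0 < B (stdBasis 0) (stdBasis 1) ^ 2
      - B (stdBasis 0) (stdBasis 0) * B (stdBasis 1) (stdBasis 1) := by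
  obtain ⟨v, hv⟩ := hB.pos
  obtain ⟨w, hw⟩ := hB.neg
  have hs := hB.symm (stdBasis 1) (stdBasis 0)
  rw [form_apply, hs] at hv hw
  by_contra! hd
  generalize B (stdBasis 0) (stdBasis 0) = a at *
  generalize B (stdBasis 0) (stdBasis 1) = b at *
  generalize B (stdBasis 1) (stdBasis 1) = d at *
  -- a binary form of nonpositive discriminant is semidefinite, with the sign of `a` or of `d`
  have hva (x y : ℝ) : 0 ≤ a * (x * (x * a + y * b) + y * (x * b + y * d)) := by
    nlinarith [sq_nonneg (a * x + b * y), sq_nonneg y, mul_nonneg (sq_nonneg y) (sub_nonneg.2 hd)]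
  have hvd (x y : ℝ) : 0 ≤ d * (x * (x * a + y * b) + y * (x * b + y * d)) := by
    nlinarith [sq_nonneg (d * y + b * x), sq_nonneg x, mul_nonneg (sq_nonneg x) (sub_nonneg.2 hd)]
  have ha : a = 0 := le_antisymm (by nlinarith [hva (w 0) (w 1)]) (by nlinarith [hva (v 0) (v 1)])
  have hdd : d = 0 := le_antisymm (by nlinarith [hvd (w 0) (w 1)]) (by nlinarith [hvd (v 0) (v 1)])
  subst ha hdd
  have hb : b = 0 := by nlinarith
  subst hb
  simp at hv

/-- For a fixed orientation, `paraRotation` depends smoothly on the form, because the discriminant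
under the square root is positive. -/
theorem contDiffAt_paraRotation {h : Plane → Plane →L[ℝ] Plane →L[ℝ] ℝ} {u : Plane}
    (hh : ContDiffAt ℝ ∞ h u) (hu : IsIndefinite (h u)) (o : Orientation ℝ Plane (Fin 2)) :
    ContDiffAt ℝ ∞ (fun u ↦ paraRotation o (h u)) u := by
  have hc (v w : Plane) : ContDiffAt ℝ ∞ (fun u ↦ h u v w) u :=
    (hh.clm_apply contDiffAt_const).clm_apply contDiffAt_const
  have hd := hu.disc_pos
  have hs : ContDiffAt ℝ ∞ (fun u ↦ (Real.sqrt (h u (stdBasis 0) (stdBasis 1) ^ 2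
      - h u (stdBasis 0) (stdBasis 0) * h u (stdBasis 1) (stdBasis 1)))⁻¹) u :=
    ((((hc _ _).pow 2).sub ((hc _ _).mul (hc _ _))).sqrt hd.ne').inv (Real.sqrt_pos.2 hd).ne'
  let T : Matrix (Fin 2) (Fin 2) ℝ →ₗ[ℝ] (Plane →L[ℝ] Plane) :=
    (Matrix.toEuclideanCLM (n := Fin 2) (𝕜 := ℝ)).toAlgEquiv.toLinearMap
  obtain ⟨s, hs'⟩ : ∃ s : ℝ, ∀ B : Plane →L[ℝ] Plane →L[ℝ] ℝ,
      paraRotation o B = (s * (Real.sqrt (B (stdBasis 0) (stdBasis 1) ^ 2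
      - B (stdBasis 0) (stdBasis 0) * B (stdBasis 1) (stdBasis 1)))⁻¹) •
        (B (stdBasis 0) (stdBasis 1) • T !![-1, 0; 0, 1]
          + B (stdBasis 0) (stdBasis 0) • T !![0, 0; 1, 0]
          + B (stdBasis 1) (stdBasis 1) • T !![0, -1; 0, 0]) := by
    classical
    refine ⟨if stdBasis.orientation = o then 1 else -1, fun B ↦ ?_⟩
    simp only [← map_smul, ← map_add]
    change T _ = T _
    congr 1
    ext i j
    fin_cases i <;> fin_cases j <;> simp [div_eq_mul_inv]
  simp only [hs']
  exact (contDiffAt_const.mul hs).smul ((((hc _ _).smul contDiffAt_const).add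
    ((hc _ _).smul contDiffAt_const)).add ((hc _ _).smul contDiffAt_const))

end LorentzPlane

section SurfaceJ

variable {S : Type*} [TopologicalSpace S] [ChartedSpace Plane S] [IsManifold (𝓡 2) ∞ S]
  {g : FormField (𝓡 2) S}
  {o : ∀ x : S, Orientation ℝ (TangentSpace (𝓡 2) x) (Fin 2)}

theorem IsLorentzian.isIndefinite (hg : IsLorentzian g) (x : S) :
    IsIndefinite (g x : Plane →L[ℝ] Plane →L[ℝ] ℝ) :=
  ⟨hg.symm x, (hg.indefinite x).1, (hg.indefinite x).2⟩

theorem IsIndefinite.comp {B : Plane →L[ℝ] Plane →L[ℝ] ℝ} (hB : IsIndefinite B)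
    (A : Plane ≃L[ℝ] Plane) :
    IsIndefinite (B.bilinearComp (A : Plane →L[ℝ] Plane) (A : Plane →L[ℝ] Plane)) := by
  obtain ⟨hs, ⟨v, hv⟩, w, hw⟩ := hB
  exact ⟨fun v w ↦ hs _ _, ⟨A.symm v, by simpa using hv⟩, A.symm w, by simpa using hw⟩

theorem IsLorentzian.isIndefinite_chartForm (hg : IsLorentzian g) (p : S) {u : Plane}
    (hu : u ∈ (extChartAt (𝓡 2) p).target) : IsIndefinite (chartForm (𝓡 2) g p u) := by
  obtain ⟨A, hA⟩ := isInvertible_chartFrame (𝓡 2) hu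
  have := (hg.isIndefinite ((extChartAt (𝓡 2) p).symm u)).comp A
  rw [hA] at this
  exact this

/-- In a chart, `j` is the paracomplex structure of the chart expression of the metric, for the
orientation pulled back by the coordinate frame. -/
theorem chartEnd_surfaceJ (hg : IsLorentzian g) (p : S) {u : Plane} (A : Plane ≃L[ℝ] Plane)
    (hA : (A : Plane →L[ℝ] Plane) = chartFrame (𝓡 2) p u) :
    chartEnd (𝓡 2) (surfaceJ g o) p u = paraRotation
      (Orientation.map (Fin 2) A.symm.toLinearEquiv (o ((extChartAt (𝓡 2) p).symm u)))
      (chartForm (𝓡 2) g p u) := by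
  ext1 v
  have h := (hg.isIndefinite ((extChartAt (𝓡 2) p).symm u)).paraRotation_conj
    (o ((extChartAt (𝓡 2) p).symm u)) A v
  have h2 : chartEnd (𝓡 2) (surfaceJ g o) p u v = (A : Plane →L[ℝ] Plane).inverse
      (paraRotation (o ((extChartAt (𝓡 2) p).symm u)) (g ((extChartAt (𝓡 2) p).symm u)) (A v)) := by
    have : A v = chartFrame (𝓡 2) p u v := by rw [← hA]; rfl
    rw [this, hA]
    rfl
  rw [h2, ContinuousLinearMap.inverse_equiv]
  refine h.trans ?_
  rw [hA]
  rfl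

/-- In a chart, the orientation of an oriented surface is locally constant: the determinant of a
smooth positively oriented frame is continuous and has no zeros. -/
theorem eventually_orientation_eq (ho : IsSurfaceOrientation o) (p : S) {u₀ : Plane}
    (hu₀ : u₀ ∈ (extChartAt (𝓡 2) p).target) : ∃ o' : Orientation ℝ Plane (Fin 2),
      ∀ᶠ u in 𝓝 u₀, ∀ A : Plane ≃L[ℝ] Plane, (A : Plane →L[ℝ] Plane) = chartFrame (𝓡 2) p u →
        Orientation.map (Fin 2) A.symm.toLinearEquiv (o ((extChartAt (𝓡 2) p).symm u)) = o' := by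
  obtain ⟨U, e, hU, hxU, he, heo⟩ := ho ((extChartAt (𝓡 2) p).symm u₀)
  set s := (extChartAt (𝓡 2) p).target ∩ (extChartAt (𝓡 2) p).symm ⁻¹' U with hs
  have hso : IsOpen s := (continuousOn_extChartAt_symm p).isOpen_inter_preimage
    (isOpen_extChartAt_target p) hU
  have hus : u₀ ∈ s := ⟨hu₀, hxU⟩
  let f (i : Fin 2) (u : Plane) : Plane := chartField (𝓡 2) (fun x ↦ e x i) p u
  have hf (i : Fin 2) : ContinuousOn (f i) s := by
    have h1 : ContinuousOn (fun x ↦ (trivializationAt Plane (TangentSpace (𝓡 2)) p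
        ⟨x, e x i⟩).2) ((chartAt Plane p).source ∩ U) := by
      have h2 : ContinuousOn (fun x ↦ (⟨x, e x i⟩ : TangentBundle (𝓡 2) S))
        ((chartAt Plane p).source ∩ U) := (he i).continuousOn.mono inter_subset_right
      refine continuous_snd.comp_continuousOn
        ((trivializationAt Plane (TangentSpace (𝓡 2)) p).continuousOn.comp h2 fun x hx ↦ ?_)
      rw [Trivialization.mem_source]
      simpa using hx.1
    have hmaps : MapsTo (extChartAt (𝓡 2) p).symm s ((chartAt Plane p).source ∩ U) := by
      intro u hu
      exact ⟨by simpa using (extChartAt (𝓡 2) p).map_target hu.1, hu.2⟩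
    refine (h1.comp ((continuousOn_extChartAt_symm p).mono inter_subset_left) hmaps).congr
      fun u hu ↦ ?_
    refine Eq.trans ?_ (trivializationAt_vector_eq (𝓡 2) (hmaps hu).1 _).symm
    rw [(extChartAt (𝓡 2) p).right_inv hu.1]
    rfl
  let D (u : Plane) : ℝ := f 0 u 0 * f 1 u 1 - f 0 u 1 * f 1 u 0
  have hD : ContinuousOn D s := by
    have hc (i j : Fin 2) : ContinuousOn (fun u ↦ f i u j) s :=
      (EuclideanSpace.proj j : Plane →L[ℝ] ℝ).continuous.comp_continuousOn (hf i)
    exact ((hc 0 0).mul (hc 1 1)).sub ((hc 0 1).mul (hc 1 0))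
  have key (u : Plane) (hu : u ∈ s) (A : Plane ≃L[ℝ] Plane)
      (hA : (A : Plane →L[ℝ] Plane) = chartFrame (𝓡 2) p u) :
      ∃ b : Module.Basis (Fin 2) ℝ Plane, stdBasis.det b = D u ∧
        Orientation.map (Fin 2) A.symm.toLinearEquiv (o ((extChartAt (𝓡 2) p).symm u))
          = b.orientation := by
    let e' : Module.Basis (Fin 2) ℝ Plane := e ((extChartAt (𝓡 2) p).symm u)
    refine ⟨e'.map A.symm.toLinearEquiv, ?_, ?_⟩
    · have hb (i : Fin 2) : e'.map A.symm.toLinearEquiv i = f i u := by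
        change A.symm (e' i) = (chartFrame (𝓡 2) p u).inverse (e' i)
        rw [← hA, ContinuousLinearMap.inverse_equiv]
        rfl
      rw [Module.Basis.det_apply, Matrix.det_fin_two]
      simp only [Module.Basis.toMatrix_apply, hb]
      simp [stdBasis, D]
      ring
    · rw [Module.Basis.orientation_map]
      exact congrArg _ (heo _ hu.2).symm
  have hD₀ : D u₀ ≠ 0 := by
    obtain ⟨A, hA⟩ := isInvertible_chartFrame (𝓡 2) hu₀
    obtain ⟨b, hb, -⟩ := key u₀ hus A hA
    rw [← hb]
    exact (Module.Basis.isUnit_det stdBasis b).ne_zero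
  have hDc : ContinuousAt D u₀ := hD.continuousAt (hso.mem_nhds hus)
  rcases lt_or_gt_of_ne hD₀ with hneg | hpos
  · refine ⟨-stdBasis.orientation, ?_⟩
    filter_upwards [hso.mem_nhds hus, hDc.eventually_lt_const hneg] with u hu hDu A hA
    obtain ⟨b, hb, hbo⟩ := key u hu A hA
    have h1 : stdBasis.orientation ≠ b.orientation := fun h ↦ by
      have := (stdBasis.orientation_eq_iff_det_pos b).1 h
      rw [hb] at this
      exact lt_asymm this hDu
    rw [hbo]
    exact (stdBasis.orientation_ne_iff_eq_neg b.orientation).1 h1.symm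
  · refine ⟨stdBasis.orientation, ?_⟩
    filter_upwards [hso.mem_nhds hus, hDc.eventually_const_lt hpos] with u hu hDu A hA
    obtain ⟨b, hb, hbo⟩ := key u hu A hA
    rw [hbo, eq_comm, stdBasis.orientation_eq_iff_det_pos b, hb]
    exact hDu

theorem contDiffOn_chartEnd_surfaceJ (hg : IsLorentzian g) (ho : IsSurfaceOrientation o) (p : S) :
    ContDiffOn ℝ ∞ (chartEnd (𝓡 2) (surfaceJ g o) p) (extChartAt (𝓡 2) p).target := by
  intro u₀ hu₀
  obtain ⟨o', ho'⟩ := eventually_orientation_eq ho p hu₀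
  refine ContDiffAt.contDiffWithinAt ?_
  refine (contDiffAt_paraRotation ((hg.isMetricOn p).contDiffAt hu₀)
    (hg.isIndefinite_chartForm p hu₀) o').congr_of_eventuallyEq ?_
  filter_upwards [ho', extChartAt_target_mem_nhds' hu₀] with u hu hut
  obtain ⟨A, hA⟩ := isInvertible_chartFrame (𝓡 2) hut
  rw [chartEnd_surfaceJ hg p A hA, hu A hA]

theorem chartForm_surfaceForm (p : S) {u : Plane} (hu : u ∈ (extChartAt (𝓡 2) p).target) :
    chartForm (𝓡 2) (surfaceForm g o) p u
      = (chartForm (𝓡 2) g p u).comp (chartEnd (𝓡 2) (surfaceJ g o) p u) := by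
  ext X Y
  have h := chartFrame_chartEnd (𝓡 2) (surfaceJ g o) hu X
  rw [chartForm_apply, ContinuousLinearMap.comp_apply, chartForm_apply, h]
  rfl

theorem smoothForm_surfaceForm (hg : IsLorentzian g) (ho : IsSurfaceOrientation o) :
    SmoothForm (𝓡 2) (surfaceForm g o) := by
  refine SmoothForm.of_contDiffOn _ fun p ↦ ?_
  exact ((hg.isMetricOn p).smooth.clm_comp (contDiffOn_chartEnd_surfaceJ hg ho p)).congr
    fun u hu ↦ chartForm_surfaceForm p hu

end SurfaceJ

/-! ### The para-Kähler structure of the product -/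

section Torsion

variable {E : Type*} [NormedAddCommGroup E] [NormedSpace ℝ E]

/-- The Nijenhuis tensor of a field `J` of endomorphisms of a vector space, evaluated on constant
vector fields. -/
noncomputable def nijenhuisTensor (J : E → E →L[ℝ] E) (u X Y : E) : E :=
  fderiv ℝ J u (J u X) Y - fderiv ℝ J u (J u Y) X - J u (fderiv ℝ J u X Y)
    + J u (fderiv ℝ J u Y X)

/-- The Nijenhuis expression in two vector fields only depends on their values at the point. -/
theorem nijenhuis_eq_nijenhuisTensor {J : E → E →L[ℝ] E} {u : E} (hJ : DifferentiableAt ℝ J u)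
    (hJ2 : ∀ v, J u (J u v) = v) {X Y : E → E} (hX : DifferentiableAt ℝ X u)
    (hY : DifferentiableAt ℝ Y u) :
    VectorField.lieBracket ℝ X Y u
      + VectorField.lieBracket ℝ (fun u ↦ J u (X u)) (fun u ↦ J u (Y u)) u
      - J u (VectorField.lieBracket ℝ (fun u ↦ J u (X u)) Y u)
      - J u (VectorField.lieBracket ℝ X (fun u ↦ J u (Y u)) u)
      = nijenhuisTensor J u (X u) (Y u) := by
  have h {X : E → E} (hX : DifferentiableAt ℝ X u) (v : E) :
      fderiv ℝ (fun u ↦ J u (X u)) u v = fderiv ℝ J u v (X u) + J u (fderiv ℝ X u v) := by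
    rw [fderiv_clm_apply hJ hX]
    simp [add_comm]
  simp only [VectorField.lieBracket_eq, nijenhuisTensor, h hX, h hY, map_sub, map_add, hJ2]
  abel

theorem nijenhuis_eq_nijenhuisTensor_chartEnd [CompleteSpace E]
    {H : Type*} [TopologicalSpace H] (I : ModelWithCorners ℝ E H) [I.Boundaryless]
    {M : Type*} [TopologicalSpace M] [ChartedSpace H M] [IsManifold I ∞ M] {J : EndField I M}
    {p : M} (hJ : DifferentiableAt ℝ (chartEnd I J p) (extChartAt I p p))
    (hJ2 : ∀ v, chartEnd I J p (extChartAt I p p) (chartEnd I J p (extChartAt I p p) v) = v)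
    {X Y : ∀ x : M, TangentSpace I x}
    (hX : ContMDiffAt I I.tangent ∞ (fun x ↦ (⟨x, X x⟩ : TangentBundle I M)) p)
    (hY : ContMDiffAt I I.tangent ∞ (fun x ↦ (⟨x, Y x⟩ : TangentBundle I M)) p) :
    nijenhuis I J X Y p = nijenhuisTensor (chartEnd I J p) (extChartAt I p p)
      (chartField I X p (extChartAt I p p)) (chartField I Y p (extChartAt I p p)) := by
  have hC (V : ∀ x : M, TangentSpace I x) : chartField I (fun x ↦ J x (V x)) p
      =ᶠ[𝓝 (extChartAt I p p)] fun u ↦ chartEnd I J p u (chartField I V p u) := by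
    filter_upwards [extChartAt_target_mem_nhds p] with u hu
    exact chartField_end I J V hu
  have b1 := mlieBracket_eq_lieBracket_chartField I X Y p
  have b2 := (mlieBracket_eq_lieBracket_chartField I (fun x ↦ J x (X x)) (fun x ↦ J x (Y x)) p)
  rw [(hC X).lieBracket_vectorField_eq (hC Y)] at b2
  have b3 := mlieBracket_eq_lieBracket_chartField I (fun x ↦ J x (X x)) Y p
  rw [(hC X).lieBracket_vectorField_eq EventuallyEq.rfl] at b3
  have b4 := mlieBracket_eq_lieBracket_chartField I X (fun x ↦ J x (Y x)) p
  rw [EventuallyEq.rfl.lieBracket_vectorField_eq (hC Y)] at b4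
  rw [← nijenhuis_eq_nijenhuisTensor hJ hJ2 (differentiableAt_chartField I hX)
    (differentiableAt_chartField I hY), ← b1, ← b2, ← b3, ← b4, chartEnd_self]
  rfl

/-- On a plane, the Nijenhuis tensor of `J` with `J² = 1` vanishes: by skew-symmetry it suffices to
evaluate it on a frame `(e, J e)`. -/
theorem nijenhuisTensor_plane {J : Plane → Plane →L[ℝ] Plane} {u : Plane}
    (hJ : DifferentiableAt ℝ J u) (hJ2 : ∀ᶠ u' in 𝓝 u, ∀ v, J u' (J u' v) = v)
    {e : Module.Basis (Fin 2) ℝ Plane} (h0 : J u (e 0) = e 1) (h1 : J u (e 1) = e 0)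
    (X Y : Plane) : nijenhuisTensor J u X Y = 0 := by
  -- differentiating `J² = 1`
  have hd (v w : Plane) : fderiv ℝ J u v (J u w) + J u (fderiv ℝ J u v w) = 0 := by
    have hw : DifferentiableAt ℝ (fun u' ↦ J u' w) u := hJ.clm_apply (differentiableAt_const _)
    have h2 : fderiv ℝ (fun u' ↦ J u' (J u' w)) u v = 0 := by
      have : (fun u' ↦ J u' (J u' w)) =ᶠ[𝓝 u] fun _ ↦ w := by
        filter_upwards [hJ2] with u' hu'
        exact hu' w
      rw [this.fderiv_eq]
      simp
    rw [fderiv_clm_apply hJ hw, fderiv_clm_apply hJ (differentiableAt_const w)] at h2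
    simpa [add_comm] using h2
  have a0 := hd (e 0) (e 1)
  have a1 := hd (e 1) (e 0)
  rw [h1] at a0
  rw [h0] at a1
  rw [basis_eq e X, basis_eq e Y]
  simp only [nijenhuisTensor, map_add, map_smul, add_apply, smul_apply, h0, h1]
  rw [eq_neg_of_add_eq_zero_right a0, eq_neg_of_add_eq_zero_right a1]
  module

end Torsion

section ClosedForms

/-- Every 2-form on a plane is closed. -/
theorem cyclic_fderiv_plane {h : Plane → Plane →L[ℝ] Plane →L[ℝ] ℝ} {u : Plane}
    (hh : DifferentiableAt ℝ h u) (halt : ∀ᶠ u' in 𝓝 u, ∀ v, h u' v v = 0) (X Y Z : Plane) :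
    fderiv ℝ h u X Y Z + fderiv ℝ h u Y Z X + fderiv ℝ h u Z X Y = 0 := by
  have hself (X v : Plane) : fderiv ℝ h u X v v = 0 := by
    rw [← fderiv_clm_apply_const₂ hh]
    have : (fun u' ↦ h u' v v) =ᶠ[𝓝 u] fun _ ↦ 0 := by
      filter_upwards [halt] with u' hu'
      exact hu' v
    rw [this.fderiv_eq]
    simp
  have hskew (X Y Z : Plane) : fderiv ℝ h u X Y Z = -fderiv ℝ h u X Z Y := by
    have := hself X (Y + Z)
    simp only [map_add, add_apply, hself, zero_add, add_zero] at this
    linarith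
  have key (X Y Z : Plane) : fderiv ℝ h u X Y Z = (Y 0 * Z 1 - Y 1 * Z 0) *
      (X 0 * fderiv ℝ h u (stdBasis 0) (stdBasis 0) (stdBasis 1)
        + X 1 * fderiv ℝ h u (stdBasis 1) (stdBasis 0) (stdBasis 1)) := by
    have h1 := plane_skew_eq (fun Y Z ↦ fderiv ℝ h u X Y Z) (by simp) (by simp) (hskew X) Y Z
    rw [h1, smul_eq_mul]
    conv_lhs => rw [plane_eq X]
    simp only [map_add, map_smul, add_apply, smul_apply, smul_eq_mul]
  rw [key X Y Z, key Y Z X, key Z X Y]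
  ring

end ClosedForms

section ParaKahler

variable {S₁ S₂ : Type*} [TopologicalSpace S₁] [ChartedSpace Plane S₁] [IsManifold (𝓡 2) ∞ S₁]
    [TopologicalSpace S₂] [ChartedSpace Plane S₂] [IsManifold (𝓡 2) ∞ S₂]
    {g₁ : FormField (𝓡 2) S₁} {g₂ : FormField (𝓡 2) S₂} {ε : ℝ}
    {o₁ : ∀ x : S₁, Orientation ℝ (TangentSpace (𝓡 2) x) (Fin 2)}
    {o₂ : ∀ x : S₂, Orientation ℝ (TangentSpace (𝓡 2) x) (Fin 2)}

theorem smoothEnd_prodEnd_surfaceJ (hg₁ : IsLorentzian g₁) (ho₁ : IsSurfaceOrientation o₁)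
    (hg₂ : IsLorentzian g₂) (ho₂ : IsSurfaceOrientation o₂) :
    SmoothEnd ((𝓡 2).prod (𝓡 2)) (prodEnd (surfaceJ g₁ o₁) (surfaceJ g₂ o₂)) := by
  refine smoothEnd_of_contDiffOn _ fun p ↦ ?_
  have h₁ := contDiffOn_chartEnd_surfaceJ hg₁ ho₁ p.1
  have h₂ := contDiffOn_chartEnd_surfaceJ hg₂ ho₂ p.2
  rw [extChartAt_target_prod]
  have key : ContDiffOn ℝ ∞ (fun u : Plane × Plane ↦
      (chartEnd (𝓡 2) (surfaceJ g₁ o₁) p.1 u.1).prodMap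
        (chartEnd (𝓡 2) (surfaceJ g₂ o₂) p.2 u.2))
      ((extChartAt (𝓡 2) p.1).target ×ˢ (extChartAt (𝓡 2) p.2).target) := by
    rw [contDiffOn_clm_apply]
    intro v
    exact ((h₁.comp contDiffOn_fst fun u hu ↦ hu.1).clm_apply contDiffOn_const).prodMk
      ((h₂.comp contDiffOn_snd fun u hu ↦ hu.2).clm_apply contDiffOn_const)
  refine key.congr fun u hu ↦ chartEnd_prodEnd _ _ p ?_
  rwa [extChartAt_target_prod]

variable {S : Type*} [TopologicalSpace S] [ChartedSpace Plane S] [IsManifold (𝓡 2) ∞ S]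
  {g : FormField (𝓡 2) S}
  {o : ∀ x : S, Orientation ℝ (TangentSpace (𝓡 2) x) (Fin 2)}

theorem chartEnd_surfaceJ_sq (hg : IsLorentzian g) (p : S) {u : Plane}
    (hu : u ∈ (extChartAt (𝓡 2) p).target) (v : Plane) :
    chartEnd (𝓡 2) (surfaceJ g o) p u (chartEnd (𝓡 2) (surfaceJ g o) p u v) = v := by
  obtain ⟨A, hA⟩ := isInvertible_chartFrame (𝓡 2) hu
  rw [chartEnd_surfaceJ hg p A hA]
  exact (hg.isIndefinite_chartForm p hu).paraRotation_sq _ v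

/-- The paracomplex structure of a Lorentzian surface is integrable. -/
theorem nijenhuisTensor_chartEnd_surfaceJ (hg : IsLorentzian g) (ho : IsSurfaceOrientation o)
    (p : S) (X Y : Plane) : nijenhuisTensor (chartEnd (𝓡 2) (surfaceJ g o) p)
      (extChartAt (𝓡 2) p p) X Y = 0 := by
  obtain ⟨e, -, h0, h1⟩ := (hg.isIndefinite p).exists_frame (o p)
  refine nijenhuisTensor_plane (e := e) ?_ ?_ ?_ ?_ X Y
  · exact ((contDiffOn_chartEnd_surfaceJ hg ho p).contDiffAt
      (extChartAt_target_mem_nhds p)).differentiableAt (by simp)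
  · filter_upwards [extChartAt_target_mem_nhds p] with u hu
    exact chartEnd_surfaceJ_sq hg p hu
  · rw [chartEnd_self]
    exact h0
  · rw [chartEnd_self]
    exact h1

theorem nijenhuis_prodEnd_surfaceJ (hg₁ : IsLorentzian g₁) (ho₁ : IsSurfaceOrientation o₁)
    (hg₂ : IsLorentzian g₂) (ho₂ : IsSurfaceOrientation o₂)
    {X Y : ∀ x : S₁ × S₂, TangentSpace ((𝓡 2).prod (𝓡 2)) x} {p : S₁ × S₂}
    (hX : ContMDiffAt ((𝓡 2).prod (𝓡 2)) ((𝓡 2).prod (𝓡 2)).tangent ∞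
      (fun x ↦ (⟨x, X x⟩ : TangentBundle ((𝓡 2).prod (𝓡 2)) (S₁ × S₂))) p)
    (hY : ContMDiffAt ((𝓡 2).prod (𝓡 2)) ((𝓡 2).prod (𝓡 2)).tangent ∞
      (fun x ↦ (⟨x, Y x⟩ : TangentBundle ((𝓡 2).prod (𝓡 2)) (S₁ × S₂))) p) :
    nijenhuis ((𝓡 2).prod (𝓡 2)) (prodEnd (surfaceJ g₁ o₁) (surfaceJ g₂ o₂)) X Y p = 0 := by
  set u := extChartAt ((𝓡 2).prod (𝓡 2)) p p with hu
  set J := chartEnd ((𝓡 2).prod (𝓡 2)) (prodEnd (surfaceJ g₁ o₁) (surfaceJ g₂ o₂)) p with hJ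
  have hC₁ := contDiffOn_chartEnd_surfaceJ hg₁ ho₁ p.1
  have hC₂ := contDiffOn_chartEnd_surfaceJ hg₂ ho₂ p.2
  set J₁ := chartEnd (𝓡 2) (surfaceJ g₁ o₁) p.1
  set J₂ := chartEnd (𝓡 2) (surfaceJ g₂ o₂) p.2
  have hu12 : u ∈ (extChartAt (𝓡 2) p.1).target ×ˢ (extChartAt (𝓡 2) p.2).target := by
    rw [← extChartAt_target_prod]
    exact mem_extChartAt_target p
  have hprod : J =ᶠ[𝓝 u] fun u ↦ (J₁ u.1).prodMap (J₂ u.2) := by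
    filter_upwards [extChartAt_target_mem_nhds p] with u hu
    exact chartEnd_prodEnd _ _ p hu
  have d₁ : DifferentiableAt ℝ J₁ u.1 := (hC₁.contDiffAt
    ((isOpen_extChartAt_target p.1).mem_nhds hu12.1)).differentiableAt (by simp)
  have d₂ : DifferentiableAt ℝ J₂ u.2 := (hC₂.contDiffAt
    ((isOpen_extChartAt_target p.2).mem_nhds hu12.2)).differentiableAt (by simp)
  have hd : HasFDerivAt (fun u : Plane × Plane ↦ (J₁ u.1).prodMap (J₂ u.2))
      ((ContinuousLinearMap.prodMapL ℝ Plane Plane Plane Plane).comp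
        ((fderiv ℝ J₁ u.1).prodMap (fderiv ℝ J₂ u.2))) u :=
    (ContinuousLinearMap.prodMapL ℝ Plane Plane Plane Plane).hasFDerivAt.comp u
      (d₁.hasFDerivAt.prodMap u d₂.hasFDerivAt)
  have hd' := hd.congr_of_eventuallyEq hprod
  have hfd (v w : Plane × Plane) : fderiv ℝ J u v w
      = (fderiv ℝ J₁ u.1 v.1 w.1, fderiv ℝ J₂ u.2 v.2 w.2) := by
    rw [hd'.fderiv]
    rfl
  have hval (v : Plane × Plane) : J u v = (J₁ u.1 v.1, J₂ u.2 v.2) := by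
    rw [hprod.eq_of_nhds]
    rfl
  have hsq (v : Plane × Plane) : J u (J u v) = v := by
    rw [hval, hval]
    exact Prod.ext (chartEnd_surfaceJ_sq hg₁ p.1 hu12.1 v.1)
      (chartEnd_surfaceJ_sq hg₂ p.2 hu12.2 v.2)
  have hu1 : u.1 = extChartAt (𝓡 2) p.1 p.1 := by rw [hu, extChartAt_prod]; rfl
  have hu2 : u.2 = extChartAt (𝓡 2) p.2 p.2 := by rw [hu, extChartAt_prod]; rfl
  have hzero (v w : Plane × Plane) : nijenhuisTensor J u v w = 0 := by
    have h₁ := nijenhuisTensor_chartEnd_surfaceJ hg₁ ho₁ p.1 v.1 w.1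
    have h₂ := nijenhuisTensor_chartEnd_surfaceJ hg₂ ho₂ p.2 v.2 w.2
    rw [← hu1] at h₁
    rw [← hu2] at h₂
    refine Eq.trans ?_ (Prod.mk_eq_zero.2 ⟨h₁, h₂⟩)
    simp only [nijenhuisTensor, hfd, hval]
    rfl
  exact (nijenhuis_eq_nijenhuisTensor_chartEnd _ hd'.differentiableAt hsq hX hY).trans (hzero _ _)

theorem chartForm_surfaceForm_self (hg : IsLorentzian g) (p : S) (u v : Plane) :
    chartForm (𝓡 2) (surfaceForm g o) p u v v = 0 :=
  (hg.isIndefinite ((extChartAt (𝓡 2) p).symm u)).apply_paraRotation_self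
    (o ((extChartAt (𝓡 2) p).symm u)) (chartFrame (𝓡 2) p u v)

theorem isClosedForm_prodForm_surfaceForm (hg₁ : IsLorentzian g₁) (ho₁ : IsSurfaceOrientation o₁)
    (hg₂ : IsLorentzian g₂) (ho₂ : IsSurfaceOrientation o₂) (ε : ℝ) :
    IsClosedForm ((𝓡 2).prod (𝓡 2)) (prodForm ε (surfaceForm g₁ o₁) (surfaceForm g₂ o₂)) := by
  intro p X Y Z
  set u := extChartAt ((𝓡 2).prod (𝓡 2)) p p with hu
  have hC₁ := (smoothForm_surfaceForm hg₁ ho₁).contDiffOn (𝓡 2) p.1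
  have hC₂ := (smoothForm_surfaceForm hg₂ ho₂).contDiffOn (𝓡 2) p.2
  have hC := ((smoothForm_surfaceForm hg₁ ho₁).prodForm
    (smoothForm_surfaceForm hg₂ ho₂) ε).contDiffOn ((𝓡 2).prod (𝓡 2)) p
  have hu12 : u ∈ (extChartAt (𝓡 2) p.1).target ×ˢ (extChartAt (𝓡 2) p.2).target := by
    rw [← extChartAt_target_prod]
    exact mem_extChartAt_target p
  have n₁ := (isOpen_extChartAt_target p.1).mem_nhds hu12.1
  have n₂ := (isOpen_extChartAt_target p.2).mem_nhds hu12.2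
  have d₁ := (hC₁.contDiffAt n₁).differentiableAt (by simp)
  have d₂ := (hC₂.contDiffAt n₂).differentiableAt (by simp)
  have d := (hC.contDiffAt (extChartAt_target_mem_nhds p)).differentiableAt (by simp)
  have hprod : chartForm ((𝓡 2).prod (𝓡 2)) (prodForm ε (surfaceForm g₁ o₁) (surfaceForm g₂ o₂)) p =ᶠ[𝓝 u]
      prodMetric ε (chartForm (𝓡 2) (surfaceForm g₁ o₁) p.1)
        (chartForm (𝓡 2) (surfaceForm g₂ o₂) p.2) := by
    filter_upwards [extChartAt_target_mem_nhds p] with u hu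
    exact chartForm_prodForm ε _ _ p hu
  have key (X Y Z : Plane × Plane) := fderiv_prodMetric d₁ d₂ (hprod.differentiableAt_iff.1 d) X Y Z
  rw [fderiv_clm_apply_const₂ d, fderiv_clm_apply_const₂ d, fderiv_clm_apply_const₂ d,
    hprod.fderiv_eq, key, key, key]
  linear_combination cyclic_fderiv_plane d₁
    (Eventually.of_forall fun u v ↦ chartForm_surfaceForm_self hg₁ p.1 u v) X.1 Y.1 Z.1
    + ε * cyclic_fderiv_plane d₂
    (Eventually.of_forall fun u v ↦ chartForm_surfaceForm_self hg₂ p.2 u v) X.2 Y.2 Z.2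

theorem isParaKahler_prod (hg₁ : IsLorentzian g₁) (ho₁ : IsSurfaceOrientation o₁)
    (hg₂ : IsLorentzian g₂) (ho₂ : IsSurfaceOrientation o₂) (hε : ε ≠ 0) :
    IsParaKahler ((𝓡 2).prod (𝓡 2)) (prodForm ε g₁ g₂)
      (prodEnd (surfaceJ g₁ o₁) (surfaceJ g₂ o₂))
      (prodForm ε (surfaceForm g₁ o₁) (surfaceForm g₂ o₂)) where
  metric := hg₁.toIsPseudoRiemannian.prodForm hg₂.toIsPseudoRiemannian hε
  smooth_J := smoothEnd_prodEnd_surfaceJ hg₁ ho₁ hg₂ ho₂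
  J_sq p v := Prod.ext ((hg₁.isIndefinite p.1).paraRotation_sq (o₁ p.1) v.1)
    ((hg₂.isIndefinite p.2).paraRotation_sq (o₂ p.2) v.2)
  integrable X Y p hX hY := nijenhuis_prodEnd_surfaceJ hg₁ ho₁ hg₂ ho₂ hX hY
  compatible p v w := by
    have h₁ := (hg₁.isIndefinite p.1).apply_paraRotation (o₁ p.1) v.1 w.1
    have h₂ := (hg₂.isIndefinite p.2).apply_paraRotation (o₂ p.2) v.2 w.2
    have h (a b : ℝ) : -a + ε * -b = -(a + ε * b) := by ring
    exact (congrArg₂ (fun a b ↦ a + ε * b) h₁ h₂).trans (h _ _)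
  form_eq p v w := rfl
  symplectic :=
    { smooth := (smoothForm_surfaceForm hg₁ ho₁).prodForm (smoothForm_surfaceForm hg₂ ho₂) ε
      alt := fun p v ↦ by
        have h₁ := (hg₁.isIndefinite p.1).apply_paraRotation_self (o₁ p.1) v.1
        have h₂ := (hg₂.isIndefinite p.2).apply_paraRotation_self (o₂ p.2) v.2
        refine (congrArg₂ (fun a b ↦ a + ε * b) h₁ h₂).trans ?_
        simp
      nondeg := nondeg_prodForm hε
        (fun x v hv ↦ (hg₁.isIndefinite x).nondeg_paraRotation (o₁ x) v hv)
        (fun x v hv ↦ (hg₂.isIndefinite x).nondeg_paraRotation (o₂ x) v hv)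
      closed := isClosedForm_prodForm_surfaceForm hg₁ ho₁ hg₂ ho₂ ε }

end ParaKahler

end PK

open PK in
theorem theorem1
    {S₁ S₂ : Type*}
    [TopologicalSpace S₁] [ChartedSpace Plane S₁] [IsManifold (𝓡 2) ∞ S₁] [ConnectedSpace S₁]
    [TopologicalSpace S₂] [ChartedSpace Plane S₂] [IsManifold (𝓡 2) ∞ S₂] [ConnectedSpace S₂]
    (g₁ : FormField (𝓡 2) S₁) (hg₁ : IsLorentzian g₁)
    (o₁ : ∀ x : S₁, Orientation ℝ (TangentSpace (𝓡 2) x) (Fin 2)) (ho₁ : IsSurfaceOrientation o₁)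
    (g₂ : FormField (𝓡 2) S₂) (hg₂ : IsLorentzian g₂)
    (o₂ : ∀ x : S₂, Orientation ℝ (TangentSpace (𝓡 2) x) (Fin 2)) (ho₂ : IsSurfaceOrientation o₂)
    (ε : ℝ) (hε : ε = 1 ∨ ε = -1) :
    IsParaKahler ((𝓡 2).prod (𝓡 2)) (prodForm ε g₁ g₂)
      (prodEnd (surfaceJ g₁ o₁) (surfaceJ g₂ o₂))
      (prodForm ε (surfaceForm g₁ o₁) (surfaceForm g₂ o₂)) ∧
    (IsLocallyConformallyFlat ((𝓡 2).prod (𝓡 2)) (prodForm ε g₁ g₂) ↔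
      ∃ c₁ c₂ : ℝ, (∀ x : S₁, gaussCurvature g₁ x = c₁) ∧ (∀ y : S₂, gaussCurvature g₂ y = c₂) ∧
        c₁ = -ε * c₂) ∧
    (IsEinstein ((𝓡 2).prod (𝓡 2)) (prodForm ε g₁ g₂) ↔
      ∃ c₁ c₂ : ℝ, (∀ x : S₁, gaussCurvature g₁ x = c₁) ∧ (∀ y : S₂, gaussCurvature g₂ y = c₂) ∧
        c₁ = ε * c₂) := by
  have hεε : ε * ε = 1 := by rcases hε with rfl | rfl <;> norm_num
  exact ⟨isParaKahler_prod hg₁ ho₁ hg₂ ho₂ (by rintro rfl; simp at hεε),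
    isLocallyConformallyFlat_prodForm_iff hg₁ hg₂ hεε, isEinstein_prodForm_iff hg₁ hg₂ hεε⟩
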